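/- Let $(\Omega,\mathcal F,(\mathcal F_t)_{t\ge 0},\mathbb P)$ be a filtered probability space and let $Y=(Y_t)_{t\ge0}$ be a regular time-homogeneous diffusion on it, with state space an interval $I\subseteq\mathbb R$ and $Y_0=y$ almost surely for a point $y$ in the interior of $I$. That is, $Y$ is adapted, has continuous paths in $I$, is strongly Markov and time-homogeneous with respect to $(\mathcal F_t)$, and from each interior point of $I$ it reaches each point of $I$ with positive probability. Assume that $\mathcal F_0$ carries a real random variable with atomless law that is independent of $Y$. Let $s$ be a scale function for $Y$: it is continuous and strictly increasing on $I$, and $X:=s(Y)$ is a local martingale. Put $x=s(y)$ and $I^X=s(I)$, and let $\overline{I}^X$ be the closure of $I^X$ in $\mathbb R$. Let $\mathcal T$ be the set of all stopping times $\tau$ (with values in $[0,\infty]$) such that $\lim_{t\to\infty}Y_{t\wedge\tau}$ exists in $[-\infty,\infty]$ almost surely. Let $\overline I$ be the closure of $I$ in $[-\infty,\infty]$, and let $\mathcal T_R\subseteq\mathcal T$ be the set of randomized threshold times, i.e. of those $\tau\in\mathcal T$ that have the form $\tau=\inf\{u\ge 0: Y_u\notin(A,B)\}$ with $(A,B)$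 an $\mathcal F_0$-measurable random pair, independent of $Y$, whose law is a probability measure on $([-\infty,y]\cap\overline I)\times([y,\infty]\cap\overline I)$. For $\mathcal S\subseteq\mathcal T$ let $Q^X(\mathcal S)=\{\mathcal L(X_\tau):\tau\in\mathcal S\}$, where $X_\tau:=\lim_{t\to\infty}X_{t\wedge\tau}$. Then for every $\tau\in\mathcal T$ the limit $X_\tau$ exists in $\mathbb R$ almost surely, and $$Q^X(\mathcal T)=Q^X(\mathcal T_R).$$ Moreover, this common set is 1. $\{\nu\in\mathcal P(\overline{I}^X): \int |z|\,\nu(dz)<\infty,\ \int z\,\nu(dz)\le x\}$ if $I^X$ is bounded below and unbounded above (in particular if $I^X=[0,\infty)$ or $I^X=(0,\infty)$, when $\overline{I}^X=[0,\infty)$); 2. $\{\nu\in\mathcal P(\overline{I}^X): \int |z|\,\nu(dz)<\infty,\ \int z\,\nu(dz)\ge x\}$ if $I^X$ is bounded above and unbounded below; 3. $\{\nu\in\mathcal P(\overline{I}^X): \int z\,\nu(dz)=x\}$ if $I^X$ is bounded; 4. $\mathcal P(\mathbb R)$ if $I^X=\mathbb R$, i.e. if $I^X$ is unbounded above and below.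 -/

import Mathlib

open MeasureTheory ProbabilityTheory Filter Topology
open scoped NNReal ENNReal

noncomputable section

namespace ThresholdStopping

/-- The space of continuous real paths on `[0, ∞)`, with the σ-algebra generated by the
coordinate maps. -/
abbrev PathSpace : Type := {f : ℝ≥0 → ℝ // Continuous f}

/-- `Y` is a time-homogeneous strong Markov process for the filtration `𝓕`, with continuous paths
in `I` and transition laws `κ z` (the law on path space of the process started at `z ∈ I`):
for each `𝓕`-stopping time `τ`, each `E ∈ 𝓕_τ` and each measurable set `Γ` of paths,
`P(E ∩ {τ < ∞} ∩ {Y_{τ + ·} ∈ Γ}) = E[κ(Y_τ, Γ) ; E ∩ {τ < ∞}]`. -/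
structure IsContinuousStrongMarkov {Ω : Type*} [mΩ : MeasurableSpace Ω] (P : Measure Ω)
    (𝓕 : Filtration ℝ≥0 mΩ) (I : Set ℝ) (κ : Kernel ℝ PathSpace) (Y : ℝ≥0 → Ω → ℝ) : Prop where
  adapted : StronglyAdapted 𝓕 Y
  continuous_path : ∀ ω, Continuous fun t => Y t ω
  mem_state : ∀ t ω, Y t ω ∈ I
  prob_kernel : IsMarkovKernel κ
  kernel_start : ∀ z ∈ I, ∀ᵐ f ∂(κ z), f.1 0 = z ∧ ∀ t, f.1 t ∈ I
  strong_markov : ∀ (τ : Ω → WithTop ℝ≥0) (hτ : IsStoppingTime 𝓕 τ) (E : Set Ω),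
    MeasurableSet[hτ.measurableSpace] E → ∀ Γ : Set PathSpace, MeasurableSet Γ →
      P {ω | ω ∈ E ∧ τ ω ≠ ⊤ ∧
          (⟨fun u => Y ((τ ω).untopA + u) ω,
            (continuous_path ω).comp (continuous_const.add continuous_id)⟩ : PathSpace) ∈ Γ}
        = ∫⁻ ω in {ω | ω ∈ E ∧ τ ω ≠ ⊤}, κ (stoppedValue Y τ ω) Γ ∂P

/-- `Y` is a regular time-homogeneous diffusion with state space the interval `I`, started at the
interior point `y`. Regular: from each interior point each point of `I` is reached with positive
probability. -/
def IsRegularDiffusion {Ω : Type*} [mΩ : MeasurableSpace Ω] (P : Measure Ω)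
    (𝓕 : Filtration ℝ≥0 mΩ) (I : Set ℝ) (y : ℝ) (Y : ℝ≥0 → Ω → ℝ) : Prop :=
  I.OrdConnected ∧ y ∈ interior I ∧ (∀ᵐ ω ∂P, Y 0 ω = y) ∧
    ∃ κ : Kernel ℝ PathSpace, IsContinuousStrongMarkov P 𝓕 I κ Y ∧
      ∀ z ∈ interior I, ∀ w ∈ I, 0 < κ z {f | ∃ t, f.1 t = w}

/-- `X` is a local martingale for `𝓕`. -/
def IsLocalMartingale {Ω : Type*} [mΩ : MeasurableSpace Ω] (P : Measure Ω)
    (𝓕 : Filtration ℝ≥0 mΩ) (X : ℝ≥0 → Ω → ℝ) : Prop :=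
  Locally (fun Z => Martingale Z 𝓕 P) 𝓕 X P

/-- `s` is a scale function for `Y` on `I`: it is strictly increasing and continuous on `I` and
`s(Y)` is a local martingale. -/
def IsScaleFunction {Ω : Type*} [mΩ : MeasurableSpace Ω] (P : Measure Ω)
    (𝓕 : Filtration ℝ≥0 mΩ) (I : Set ℝ) (Y : ℝ≥0 → Ω → ℝ) (s : ℝ → ℝ) : Prop :=
  StrictMonoOn s I ∧ ContinuousOn s I ∧ IsLocalMartingale P 𝓕 fun t ω => s (Y t ω)

/-- `𝓕 0` carries a continuous (that is, atomless) random variable, independent of `Y`. -/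
def HasInitialRandomization {Ω : Type*} [mΩ : MeasurableSpace Ω] (P : Measure Ω)
    (𝓕 : Filtration ℝ≥0 mΩ) (Y : ℝ≥0 → Ω → ℝ) : Prop :=
  ∃ U : Ω → ℝ, Measurable[𝓕 0] U ∧ (∀ u, P.map U {u} = 0) ∧ IndepFun U (fun ω t => Y t ω) P

/-- The class `𝒯` of all stopping times `τ` for which `lim_{t → ∞} Y_{t ∧ τ}` exists almost surely
(in the extended real line; the limit then lies in the closure of the state space there). -/
def stoppingTimes {Ω : Type*} [mΩ : MeasurableSpace Ω] (P : Measure Ω)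
    (𝓕 : Filtration ℝ≥0 mΩ) (Y : ℝ≥0 → Ω → ℝ) : Set (Ω → WithTop ℝ≥0) :=
  {τ | IsStoppingTime 𝓕 τ ∧
    ∀ᵐ ω ∂P, ∃ l : EReal, Tendsto (fun t => ((stoppedProcess Y τ t ω : ℝ) : EReal)) atTop (𝓝 l)}

/-- The set `([-∞, y] ∩ Ī) × ([y, ∞] ∩ Ī)` of pairs of thresholds, where `Ī` is the closure of `I`
in the extended real line. -/
def thresholdPairs (I : Set ℝ) (y : ℝ) : Set (EReal × EReal) :=
  (Set.Iic (y : EReal) ∩ closure (Real.toEReal '' I)) ×ˢ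
    (Set.Ici (y : EReal) ∩ closure (Real.toEReal '' I))

/-- The first time (`⊤` if there is none) at which `Y` is outside of the random open interval
`(A, B)`, where `Θ = (A, B)`. -/
def exitTime {Ω : Type*} (Y : ℝ≥0 → Ω → ℝ) (Θ : Ω → EReal × EReal) : Ω → WithTop ℝ≥0 :=
  fun ω => hittingAfter Y {z : ℝ | (z : EReal) ∉ Set.Ioo (Θ ω).1 (Θ ω).2} 0 ω

/-- The class `𝒯_R` of randomized threshold times: the times in `𝒯` that are the first exit time
of `Y` from an interval `(A, B)` chosen at time `0`, independently of `Y`, with some law `ζ` on the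
set of pairs of thresholds. -/
def randomizedThresholdTimes {Ω : Type*} [mΩ : MeasurableSpace Ω] (P : Measure Ω)
    (𝓕 : Filtration ℝ≥0 mΩ) (I : Set ℝ) (y : ℝ) (Y : ℝ≥0 → Ω → ℝ) :
    Set (Ω → WithTop ℝ≥0) :=
  stoppingTimes P 𝓕 Y ∩
    {τ | ∃ ζ : Measure (EReal × EReal), IsProbabilityMeasure ζ ∧ ζ (thresholdPairs I y)ᶜ = 0 ∧
      ∃ Θ : Ω → EReal × EReal, Measurable[𝓕 0] Θ ∧ P.map Θ = ζ ∧
        IndepFun Θ (fun ω t => Y t ω) P ∧ τ = exitTime Y Θ}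

/-- `Z` is (a version of) the stopped value `X_τ = lim_{t → ∞} X_{t ∧ τ}`. -/
def IsStoppedLimit {Ω : Type*} [MeasurableSpace Ω] (P : Measure Ω)
    (X : ℝ≥0 → Ω → ℝ) (τ : Ω → WithTop ℝ≥0) (Z : Ω → ℝ) : Prop :=
  Measurable Z ∧ ∀ᵐ ω ∂P, Tendsto (fun t => stoppedProcess X τ t ω) atTop (𝓝 (Z ω))

/-- The set `{law of X_τ : τ ∈ S}`. -/
def stoppedLaws {Ω : Type*} [MeasurableSpace Ω] (P : Measure Ω)
    (X : ℝ≥0 → Ω → ℝ) (S : Set (Ω → WithTop ℝ≥0)) : Set (Measure ℝ) :=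
  {ν | ∃ τ ∈ S, ∃ Z : Ω → ℝ, IsStoppedLimit P X τ Z ∧ P.map Z = ν}

/-- The probability measures on `ℝ` that are carried by the set `C`. -/
def lawsOn (C : Set ℝ) : Set (Measure ℝ) :=
  {ν | IsProbabilityMeasure ν ∧ ν Cᶜ = 0}

end ThresholdStopping

end

open ThresholdStopping

/-! In natural scale the process X = s(Y) is a continuous local martingale, and the only restriction
on the law of a stopped value, besides its support, is the mean inequality that a one-sided bound
forces on X. Constraints. Since s is monotone, convergence of the stopped Y gives convergence of the
stopped X in [-∞, ∞] (`exists_tendsto_scale`). The limits ±∞ are excluded by Fatou's lemma once X is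
also stopped at a low level (`IsContLocalMartingale.not_tendsto_atTop`). If X is bounded below,
Fatou's lemma shows that the limit has mean at most x
(`IsContLocalMartingale.integrable_and_integral_le`). Reflection treats a bound above, and two
bounds give equality. Attainment. Let ν be a target law, U = ∫ (b - x)⁺ dν and D = ∫ (x - a)⁺ dν.
Draw at time 0 a pair a < x < b with density k (b - a) with respect to ν ⊗ ν. The interval (a, b) is
left through b with probability (x - a) / (b - a), so the factor b - a cancels and the exit point
has law k D ν above x; in the same way it has law k U ν below x. Missing mass comes from
half-infinite intervals: (a, ∞) with weight c₁ ν(da) and (-∞, b) with weight c₂ ν(db). These are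
left through the finite end almost surely, since level n is reached before a with probability (x -
a) / (n - a). The atom of ν at x is produced by stopping at once. So ν is attained as soon as k U +
c₁ = 1 and k D + c₂ = 1, where c₁ or c₂ may be nonzero only towards an unbounded side; the mean
condition in each of the four cases allows these equations to be solved. This is carried by
`mixLaw`, `map_eq_of_map_eq_mixLaw` and `IsRegularDiffusion.mem_stoppedLaws`. That X cannot settle
strictly inside an interval instead of leaving it follows from regularity and the strong Markov
property (`IsRegularDiffusion.exists_notMem_Icc`). Optional stopping in continuous time is obtained
from countably valued grid times, and convergence of bounded martingales from an L² maximal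
inequality. -/

noncomputable section

namespace ThresholdStopping

/-! ### Hitting and exit times of continuous paths -/

section Hitting

variable {Ω : Type*}

lemma measurableSet_exists_le {m : MeasurableSpace Ω} {V : ℝ≥0 → Ω → ℝ}
    (hc : ∀ ω, Continuous fun t => V t ω) {n t : ℝ≥0} (hnt : n ≤ t)
    (hV : ∀ u ∈ Set.Icc n t, Measurable (V u)) {B : Ω → EReal} (hB : Measurable B) :
    MeasurableSet {ω | ∃ u ∈ Set.Icc n t, B ω ≤ V u ω} := by
  -- The maximum of the path on the compact interval is attained, so staying below B means that a
  -- rational fits between the maximum and B. The expression `max n (min _ t)` clamps a dense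
  -- sequence of times into `[n, t]`.
  have key : {ω | ∃ u ∈ Set.Icc n t, B ω ≤ V u ω}ᶜ = ⋃ r : ℚ, {ω | (((r : ℝ)) : EReal) < B ω} ∩
      ⋂ q : ℕ, {ω | V (max n (min (TopologicalSpace.denseSeq ℝ≥0 q) t)) ω ≤ r} := by
    ext ω
    simp only [Set.mem_compl_iff, Set.mem_ofPred_eq, not_exists, not_and, not_le, Set.mem_iUnion,
      Set.mem_inter_iff, Set.mem_iInter]
    constructor
    · intro h
      obtain ⟨u, hu, hmax⟩ := isCompact_Icc.exists_isMaxOn (Set.nonempty_Icc.2 hnt)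
        (hc ω).continuousOn
      obtain ⟨r, hr1, hr2⟩ := EReal.lt_iff_exists_rat_btwn.1 (h u hu)
      refine ⟨r, hr2, fun q => ?_⟩
      exact (hmax ⟨le_max_left _ _, max_le hnt (min_le_right _ _)⟩ : V _ ω ≤ V u ω).trans
        (EReal.coe_lt_coe_iff.1 hr1).le
    · rintro ⟨r, hr, hq⟩ u hu
      have hcl : IsClosed {v : ℝ≥0 | V (max n (min v t)) ω ≤ r} :=
        isClosed_le ((hc ω).comp (by fun_prop)) continuous_const
      have h1 : ∀ v, V (max n (min v t)) ω ≤ r := by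
        intro v
        have := (TopologicalSpace.denseRange_denseSeq ℝ≥0).closure_range ▸ Set.mem_univ v
        exact hcl.closure_subset_iff.2 (by rintro _ ⟨q, rfl⟩; exact hq q) this
      have := h1 u
      rw [min_eq_left hu.2, max_eq_right hu.1] at this
      exact lt_of_le_of_lt (EReal.coe_le_coe_iff.2 this) hr
  rw [← MeasurableSet.compl_iff, key]
  refine MeasurableSet.iUnion fun r => (measurableSet_lt measurable_const hB).inter
    (MeasurableSet.iInter fun q => measurableSet_le (hV _ ?_) measurable_const)
  exact ⟨le_max_left _ _, max_le hnt (min_le_right _ _)⟩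

/-- Closedness of `S` and continuity of the path make the set of hitting times closed, so a finite
infimum is attained. -/
lemma hittingAfter_eq_coe {f : ℝ≥0 → Ω → ℝ} {ω : Ω} (hf : Continuous fun t => f t ω) {S : Set ℝ}
    (hS : IsClosed S) {n t : ℝ≥0} (h : hittingAfter f S n ω = t) :
    n ≤ t ∧ f t ω ∈ S ∧ ∀ u, n ≤ u → u < t → f u ω ∉ S := by
  classical
  have hex : ∃ j, n ≤ j ∧ f j ω ∈ S := by
    by_contra hne
    simp only [hittingAfter, hne, if_false] at h
    exact WithTop.coe_ne_top h.symm
  have hmem : sInf {i | n ≤ i ∧ f i ω ∈ S} ∈ {i | n ≤ i ∧ f i ω ∈ S} :=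
    (IsClosed.inter isClosed_Ici (hS.preimage hf)).csInf_mem hex (OrderBot.bddBelow _)
  have ht : t = sInf {i | n ≤ i ∧ f i ω ∈ S} := by
    simp only [hittingAfter, hex, if_true] at h
    exact (WithTop.coe_injective h).symm
  rw [← ht] at hmem
  exact ⟨hmem.1, hmem.2, fun u hu hut hmem' =>
    (ht.trans_le (csInf_le (OrderBot.bddBelow _) (show u ∈ {i | n ≤ i ∧ f i ω ∈ S} from
      ⟨hu, hmem'⟩))).not_gt hut⟩

lemma hittingAfter_le_coe_iff {f : ℝ≥0 → Ω → ℝ} {ω : Ω} (hf : Continuous fun t => f t ω)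
    {S : Set ℝ} (hS : IsClosed S) {n t : ℝ≥0} :
    hittingAfter f S n ω ≤ t ↔ ∃ u ∈ Set.Icc n t, f u ω ∈ S := by
  constructor
  · intro h
    obtain ⟨v, hv⟩ := WithTop.ne_top_iff_exists.1 (ne_top_of_le_ne_top WithTop.coe_ne_top h)
    obtain ⟨h1, h2, -⟩ := hittingAfter_eq_coe hf hS hv.symm
    rw [← hv] at h
    exact ⟨v, ⟨h1, WithTop.coe_le_coe.1 h⟩, h2⟩
  · rintro ⟨u, hu, hmem⟩
    exact (hittingAfter_le_of_mem hu.1 hmem).trans (WithTop.coe_le_coe.2 hu.2)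

lemma isClosed_coe_le (b : EReal) : IsClosed {z : ℝ | b ≤ z} :=
  isClosed_le continuous_const continuous_coe_real_ereal

lemma isStoppingTime_hittingAfter_ge [mΩ : MeasurableSpace Ω] {𝓕 : Filtration ℝ≥0 mΩ}
    {V : ℝ≥0 → Ω → ℝ} (hc : ∀ ω, Continuous fun t => V t ω) {n : ℝ≥0}
    (hV : ∀ t, n ≤ t → Measurable[𝓕 t] (V t)) (b : EReal) :
    IsStoppingTime 𝓕 (hittingAfter V {z : ℝ | b ≤ z} n) := by
  intro t
  have h1 : {ω | hittingAfter V {z : ℝ | b ≤ z} n ω ≤ t} =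
      {ω | ∃ u ∈ Set.Icc n t, b ≤ V u ω} := by
    ext ω
    exact hittingAfter_le_coe_iff (hc ω) (isClosed_coe_le _)
  rw [h1]
  by_cases hnt : n ≤ t
  · exact measurableSet_exists_le (m := 𝓕 t) hc hnt
      (fun u hu => (hV u hu.1).mono (𝓕.mono hu.2) le_rfl) measurable_const
  · convert! MeasurableSet.empty
    ext ω
    simp only [Set.mem_ofPred_eq, Set.mem_empty_iff_false, iff_false]
    rintro ⟨u, hu, -⟩
    exact hnt (hu.1.trans hu.2)

lemma isClosed_notMem_Ioo (a b : EReal) : IsClosed {z : ℝ | (z : EReal) ∉ Set.Ioo a b} := by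
  have : {z : ℝ | (z : EReal) ∉ Set.Ioo a b} = (Real.toEReal ⁻¹' Set.Ioo a b)ᶜ := rfl
  rw [this]
  exact (isOpen_Ioo.preimage continuous_coe_real_ereal).isClosed_compl

lemma isStoppingTime_exitTime [mΩ : MeasurableSpace Ω] {𝓕 : Filtration ℝ≥0 mΩ}
    {V : ℝ≥0 → Ω → ℝ} (hc : ∀ ω, Continuous fun t => V t ω)
    (hV : ∀ t, Measurable[𝓕 t] (V t)) {Θ : Ω → EReal × EReal} (hΘ : Measurable[𝓕 0] Θ) :
    IsStoppingTime 𝓕 (exitTime V Θ) := by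
  intro t
  -- Leaving through the lower threshold A is an upward passage of -V over -A, so one measurability
  -- lemma serves both ends.
  have h1 : {ω | exitTime V Θ ω ≤ t} = {ω | ∃ u ∈ Set.Icc 0 t, (Θ ω).2 ≤ V u ω} ∪
      {ω | ∃ u ∈ Set.Icc 0 t, -(Θ ω).1 ≤ ((fun t ω => - V t ω) u ω : ℝ)} := by
    ext ω
    rw [Set.mem_ofPred_eq, exitTime, hittingAfter_le_coe_iff (hc ω) (isClosed_notMem_Ioo _ _)]
    simp only [Set.mem_ofPred_eq, Set.mem_union, Set.mem_Ioo, not_and_or, not_lt, EReal.coe_neg, EReal.neg_le_neg_iff,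
      ← exists_or, ← and_or_left]
    simp only [or_comm]
  have hΘt : Measurable[𝓕 t] Θ := hΘ.mono (𝓕.mono zero_le) le_rfl
  rw [h1]
  refine MeasurableSet.union ?_ ?_
  · exact measurableSet_exists_le (m := 𝓕 t) hc zero_le
      (fun u hu => (hV u).mono (𝓕.mono hu.2) le_rfl) hΘt.snd
  · exact measurableSet_exists_le (m := 𝓕 t) (fun ω => (hc ω).neg) zero_le
      (fun u hu => ((hV u).mono (𝓕.mono hu.2) le_rfl).neg) hΘt.fst.neg

end Hitting

/-! ### Approximation of bounded stopping times by grid times -/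

section Discretization

lemma withTop_untopA_coe (r : ℝ≥0) : (r : WithTop ℝ≥0).untopA = r := rfl

variable {Ω : Type*}

/-- The approximation of a stopping time from above by multiples of `1 / (k + 1)`, capped at `T`. -/
def gridTime (ρ : Ω → WithTop ℝ≥0) (T : ℝ≥0) (k : ℕ) (ω : Ω) : ℝ≥0 :=
  min (⌈((k : ℝ≥0) + 1) * (ρ ω).untopA⌉₊ / ((k : ℝ≥0) + 1)) T

lemma le_gridTime {ρ : Ω → WithTop ℝ≥0} {T : ℝ≥0} {ω : Ω} (h : ρ ω ≤ T) (k : ℕ) :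
    (ρ ω).untopA ≤ gridTime ρ T k ω := by
  refine le_min ?_ (WithTop.untopA_le h)
  rw [le_div_iff₀ (by positivity), mul_comm]
  exact Nat.le_ceil _

lemma tendsto_gridTime {ρ : Ω → WithTop ℝ≥0} {T : ℝ≥0} {ω : Ω} (h : ρ ω ≤ T) :
    Tendsto (fun k => gridTime ρ T k ω) atTop (𝓝 (ρ ω).untopA) := by
  have hlim : Tendsto (fun k : ℕ => (ρ ω).untopA + 1 / ((k : ℝ≥0) + 1)) atTop
      (𝓝 ((ρ ω).untopA + 0)) :=
    tendsto_const_nhds.add tendsto_one_div_add_atTop_nhds_zero_nat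
  rw [add_zero] at hlim
  refine tendsto_of_tendsto_of_tendsto_of_le_of_le tendsto_const_nhds hlim
    (fun k => le_gridTime h k) fun k => (min_le_left _ _).trans ?_
  have hk : (0 : ℝ≥0) < k + 1 := by positivity
  rw [div_le_iff₀ hk, add_mul (ρ ω).untopA, one_div, inv_mul_cancel₀ hk.ne',
    mul_comm (ρ ω).untopA]
  exact (Nat.ceil_lt_add_one zero_le).le

lemma isStoppingTime_gridTime [mΩ : MeasurableSpace Ω] {𝓕 : Filtration ℝ≥0 mΩ}
    {ρ : Ω → WithTop ℝ≥0} (hρ : IsStoppingTime 𝓕 ρ) {T : ℝ≥0} (h : ∀ ω, ρ ω ≤ T) (k : ℕ) :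
    IsStoppingTime 𝓕 (fun ω => (gridTime ρ T k ω : WithTop ℝ≥0)) := by
  intro t
  by_cases hT : T ≤ t
  · convert! MeasurableSet.univ
    ext ω
    exact iff_of_true (WithTop.coe_le_coe.2 ((min_le_right _ _).trans hT)) trivial
  have hk : (0 : ℝ≥0) < k + 1 := by positivity
  -- For t below the cap, rounding ρ up to the grid gives at most t exactly when ρ is at most t
  -- rounded down to the grid, and the latter time is not after t.
  have : {ω | (gridTime ρ T k ω : WithTop ℝ≥0) ≤ t} =
      {ω | ρ ω ≤ ((⌊((k : ℝ≥0) + 1) * t⌋₊ / ((k : ℝ≥0) + 1) : ℝ≥0) : WithTop ℝ≥0)} := by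
    ext ω
    obtain ⟨r, hr⟩ := WithTop.ne_top_iff_exists.1 (ne_top_of_le_ne_top WithTop.coe_ne_top (h ω))
    simp only [Set.mem_ofPred_eq, gridTime, ← hr, WithTop.coe_le_coe, withTop_untopA_coe,
      min_le_iff, hT, or_false]
    rw [div_le_iff₀ hk, le_div_iff₀ hk, mul_comm t, mul_comm r, ← Nat.ceil_le,
      Nat.le_floor_iff zero_le]
  rw [this]
  refine 𝓕.mono ?_ _ (hρ _)
  rw [div_le_iff₀ hk, mul_comm t]
  exact Nat.floor_le zero_le

lemma countable_range_gridTime (ρ : Ω → WithTop ℝ≥0) (T : ℝ≥0) (k : ℕ) :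
    (Set.range fun ω => (gridTime ρ T k ω : WithTop ℝ≥0)).Countable := by
  refine (Set.countable_range
    (fun n : ℕ => ((min (n / ((k : ℝ≥0) + 1)) T : ℝ≥0) : WithTop ℝ≥0))).mono ?_
  rintro _ ⟨ω, rfl⟩
  exact ⟨_, rfl⟩

lemma tendsto_gridTime_path {N : ℝ≥0 → Ω → ℝ} (hc : ∀ ω, Continuous fun t => N t ω) {ρ : Ω → WithTop ℝ≥0} {T : ℝ≥0}
    (h : ∀ ω, ρ ω ≤ T) (ω : Ω) :
    Tendsto (fun k => N (gridTime ρ T k ω) ω) atTop (𝓝 (stoppedValue N ρ ω)) :=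
  ((hc ω).tendsto _).comp (tendsto_gridTime (h ω))

end Discretization

/-! ### Optional stopping for continuous martingales -/

section OptionalStopping

variable {Ω : Type*} [mΩ : MeasurableSpace Ω] {P : Measure Ω} [IsProbabilityMeasure P]
  {𝓕 : Filtration ℝ≥0 mΩ} {N : ℝ≥0 → Ω → ℝ}

lemma gridTime_value_ae_eq (hN : Martingale N 𝓕 P) {ρ : Ω → WithTop ℝ≥0}
    (hρ : IsStoppingTime 𝓕 ρ) {T : ℝ≥0} (h : ∀ ω, ρ ω ≤ T) (k : ℕ) :
    (fun ω => N (gridTime ρ T k ω) ω) =ᵐ[P]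
      P[N T | (isStoppingTime_gridTime hρ h k).measurableSpace] :=
  hN.stoppedValue_ae_eq_condExp_of_le_const_of_countable_range (isStoppingTime_gridTime hρ h k)
    (fun _ => WithTop.coe_le_coe.2 (min_le_right _ _)) (countable_range_gridTime ρ T k)

/-- All these values are conditional expectations of the single integrable variable `N T`. Uniform
integrability is what turns pathwise convergence along the grids into convergence in L¹. -/
lemma uniformIntegrable_gridTime (hN : Martingale N 𝓕 P) {ρ : Ω → WithTop ℝ≥0}
    (hρ : IsStoppingTime 𝓕 ρ) {T : ℝ≥0} (h : ∀ ω, ρ ω ≤ T) :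
    UniformIntegrable (fun k ω => N (gridTime ρ T k ω) ω) 1 P :=
  (Integrable.uniformIntegrable_condExp (hN.integrable T)
    fun k => (isStoppingTime_gridTime hρ h k).measurableSpace_le).ae_eq
      fun k => (gridTime_value_ae_eq hN hρ h k).symm

lemma integrable_stoppedValue_of_continuous (hN : Martingale N 𝓕 P)
    (hc : ∀ ω, Continuous fun t => N t ω) {ρ : Ω → WithTop ℝ≥0}
    (hρ : IsStoppingTime 𝓕 ρ) {T : ℝ≥0} (h : ∀ ω, ρ ω ≤ T) :
    Integrable (stoppedValue N ρ) P :=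
  (uniformIntegrable_gridTime hN hρ h).integrable_of_ae_tendsto
    (ae_of_all _ (tendsto_gridTime_path hc h))

/-- Optional stopping for martingales with continuous paths, with a bounded weight. -/
theorem integral_mul_stoppedValue (hN : Martingale N 𝓕 P)
    (hc : ∀ ω, Continuous fun t => N t ω) {ρ : Ω → WithTop ℝ≥0}
    (hρ : IsStoppingTime 𝓕 ρ) {i T : ℝ≥0} (hi : ∀ ω, i ≤ ρ ω) (h : ∀ ω, ρ ω ≤ T)
    {G : Ω → ℝ} (hG : StronglyMeasurable[𝓕 i] G) {C : ℝ} (hGC : ∀ᵐ ω ∂P, ‖G ω‖ ≤ C) :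
    ∫ ω, G ω * stoppedValue N ρ ω ∂P = ∫ ω, G ω * N T ω ∂P := by
  have hGm : AEStronglyMeasurable G P := (hG.mono (𝓕.le i)).aestronglyMeasurable
  have hstep : ∀ k, ∫ ω, G ω * N (gridTime ρ T k ω) ω ∂P = ∫ ω, G ω * N T ω ∂P := by
    intro k
    have hst := isStoppingTime_gridTime hρ h k
    -- Grid times lie above ρ, hence above i, so the weight G is measurable at the grid time and can
    -- be pulled out of the conditional expectation.
    have hle : 𝓕 i ≤ hst.measurableSpace := hst.le_measurableSpace_of_const_le fun ω => by
      refine WithTop.coe_le_coe.2 (le_trans ?_ (le_gridTime (h ω) k))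
      exact (WithTop.le_untopA_iff (ne_top_of_le_ne_top WithTop.coe_ne_top (h ω))).2 (hi ω)
    have hint : Integrable (G * N T) P := (hN.integrable T).bdd_mul hGm hGC
    calc ∫ ω, G ω * N (gridTime ρ T k ω) ω ∂P
        = ∫ ω, (G * P[N T | hst.measurableSpace]) ω ∂P := by
          refine integral_congr_ae ?_
          filter_upwards [gridTime_value_ae_eq hN hρ h k] with ω hω
          simp [hω]
      _ = ∫ ω, (P[G * N T | hst.measurableSpace]) ω ∂P :=
          integral_congr_ae (condExp_mul_of_stronglyMeasurable_left (hG.mono hle) hint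
            (hN.integrable T)).symm
      _ = _ := integral_condExp hst.measurableSpace_le
  have hui := uniformIntegrable_gridTime hN hρ h
  have hlim := tendsto_Lp_finite_of_tendsto_ae le_rfl ENNReal.one_ne_top
    (fun k => hui.aestronglyMeasurable k)
    (memLp_one_iff_integrable.2 (integrable_stoppedValue_of_continuous hN hc hρ h)) hui.unifIntegrable
    (ae_of_all _ (tendsto_gridTime_path hc h))
  have hlim2 : Tendsto (fun k => ∫ ω, G ω * N (gridTime ρ T k ω) ω ∂P) atTop
      (𝓝 (∫ ω, G ω * stoppedValue N ρ ω ∂P)) := by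
    refine tendsto_integral_of_L1' _
      ((integrable_stoppedValue_of_continuous hN hc hρ h).bdd_mul hGm hGC).1
      (Eventually.of_forall fun k => (memLp_one_iff_integrable.1 (hui.memLp k)).bdd_mul hGm hGC) ?_
    have hb := ENNReal.Tendsto.const_mul (a := ENNReal.ofReal C) hlim (Or.inr ENNReal.ofReal_ne_top)
    rw [mul_zero] at hb
    refine tendsto_of_tendsto_of_tendsto_of_le_of_le tendsto_const_nhds hb (fun _ => zero_le)
      fun k => ?_
    refine eLpNorm_le_mul_eLpNorm_of_ae_le_mul ?_ 1
    filter_upwards [hGC] with ω hω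
    have : (fun ω => G ω * N (gridTime ρ T k ω) ω) ω - (fun ω => G ω * stoppedValue N ρ ω) ω
      = G ω * (N (gridTime ρ T k ω) ω - stoppedValue N ρ ω) := by ring
    simp only [Pi.sub_apply]
    rw [← mul_sub, norm_mul]
    exact mul_le_mul_of_nonneg_right hω (norm_nonneg _)
  exact tendsto_nhds_unique hlim2 (by simp_rw [hstep]; exact tendsto_const_nhds)

/-- At a grid time this is the L² contraction property of conditional expectation; boundedness of
the martingale allows passage to the limit. -/
lemma integral_sq_stoppedValue_le (hN : Martingale N 𝓕 P)
    (hc : ∀ ω, Continuous fun t => N t ω) {C : ℝ} (hC : ∀ᵐ ω ∂P, ∀ t, |N t ω| ≤ C)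
    {ρ : Ω → WithTop ℝ≥0} (hρ : IsStoppingTime 𝓕 ρ) {T : ℝ≥0} (h : ∀ ω, ρ ω ≤ T) :
    ∫ ω, stoppedValue N ρ ω ^ 2 ∂P ≤ ∫ ω, N T ω ^ 2 ∂P := by
  have hmeas := (uniformIntegrable_gridTime hN hρ h).aestronglyMeasurable
  have hL2 : MemLp (N T) 2 P := MemLp.of_bound (hN.integrable T).1 C (by
    filter_upwards [hC] with ω hω using hω T)
  have hstep : ∀ k, ∫ ω, N (gridTime ρ T k ω) ω ^ 2 ∂P ≤ ∫ ω, N T ω ^ 2 ∂P := by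
    intro k
    have hk2 : MemLp (fun ω => N (gridTime ρ T k ω) ω) 2 P := MemLp.of_bound (hmeas k) C (by
      filter_upwards [hC] with ω hω using hω _)
    have h1 := (eLpNorm_congr_ae (p := 2) (gridTime_value_ae_eq hN hρ h k)).trans_le
      (eLpNorm_condExp_le_eLpNorm (N T) (by norm_num))
    rw [hk2.eLpNorm_eq_integral_rpow_norm (by norm_num) (by norm_num),
      hL2.eLpNorm_eq_integral_rpow_norm (by norm_num) (by norm_num),
      ENNReal.ofReal_le_ofReal_iff (by positivity)] at h1
    have h2 := (Real.rpow_le_rpow_iff (by positivity) (by positivity) (by norm_num)).1 h1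
    simpa using h2
  have hlim : Tendsto (fun k => ∫ ω, N (gridTime ρ T k ω) ω ^ 2 ∂P) atTop
      (𝓝 (∫ ω, stoppedValue N ρ ω ^ 2 ∂P)) := by
    refine tendsto_integral_of_dominated_convergence (fun _ => C ^ 2) (fun k => (hmeas k).pow 2)
      (integrable_const _) (fun k => ?_)
      (ae_of_all _ fun ω => (tendsto_gridTime_path hc h ω).pow 2)
    filter_upwards [hC] with ω hω
    rw [Real.norm_eq_abs, abs_pow]
    exact pow_le_pow_left₀ (abs_nonneg _) (hω _) 2
  exact le_of_tendsto hlim (Eventually.of_forall hstep)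

end OptionalStopping

/-! ### Continuous local martingales: optional stopping, Fatou bounds, stopped martingales -/

section LocalMartingale

variable {Ω : Type*} [mΩ : MeasurableSpace Ω] {P : Measure Ω} {𝓕 : Filtration ℝ≥0 mΩ}
  {X : ℝ≥0 → Ω → ℝ} {x : ℝ}

/-- A local martingale with continuous paths that starts at `x`. -/
structure IsContLocalMartingale (P : Measure Ω) (𝓕 : Filtration ℝ≥0 mΩ) (X : ℝ≥0 → Ω → ℝ)
    (x : ℝ) : Prop where
  adapted : StronglyAdapted 𝓕 X
  continuous_path : ∀ ω, Continuous fun t => X t ω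
  isLocalMartingale : IsLocalMartingale P 𝓕 X
  init : ∀ᵐ ω ∂P, X 0 ω = x

lemma IsContLocalMartingale.neg (hX : IsContLocalMartingale P 𝓕 X x) :
    IsContLocalMartingale P 𝓕 (fun t ω => - X t ω) (-x) where
  adapted := fun t => (hX.adapted t).neg
  continuous_path := fun ω => (hX.continuous_path ω).neg
  isLocalMartingale := by
    obtain ⟨τ, hτ, hM⟩ := hX.isLocalMartingale
    refine ⟨τ, hτ, fun n => ?_⟩
    convert! (hM n).neg using 1
    ext t ω
    simp [stoppedProcess, Set.indicator_apply]
    split_ifs <;> simp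
  init := by filter_upwards [hX.init] with ω h using by rw [h]

lemma exists_stoppedProcess_eq {Ω : Type*} (X : ℝ≥0 → Ω → ℝ) (τ : Ω → WithTop ℝ≥0) (t : ℝ≥0) (ω : Ω) :
    ∃ u : ℝ≥0, u ≤ t ∧ (u : WithTop ℝ≥0) ≤ τ ω ∧ stoppedProcess X τ t ω = X u ω := by
  obtain ⟨u, hu⟩ := WithTop.ne_top_iff_exists.1
    (ne_top_of_le_ne_top WithTop.coe_ne_top (min_le_left (t : WithTop ℝ≥0) (τ ω)))
  refine ⟨u, WithTop.coe_le_coe.1 (hu ▸ min_le_left _ _), hu ▸ min_le_right _ _, ?_⟩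
  rw [stoppedProcess, ← hu, withTop_untopA_coe]

lemma continuous_stoppedProcess {Ω : Type*} {X : ℝ≥0 → Ω → ℝ} {ω : Ω} (hc : Continuous fun t => X t ω)
    (τ : Ω → WithTop ℝ≥0) : Continuous fun t => stoppedProcess X τ t ω := by
  rcases eq_or_ne (τ ω) ⊤ with h | h
  · have : (fun t => stoppedProcess X τ t ω) = fun t => X t ω := by
      ext t
      exact stoppedProcess_eq_of_le (h ▸ le_top)
    rwa [this]
  · obtain ⟨r, hr⟩ := WithTop.ne_top_iff_exists.1 h
    have : (fun t => stoppedProcess X τ t ω) = fun t => X (min t r) ω := by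
      ext t
      rw [stoppedProcess, ← hr, ← WithTop.coe_min, withTop_untopA_coe]
    rw [this]
    exact hc.comp (by fun_prop)

/-- Localization multiplies X by the indicator of `{⊥ < τ k}` before stopping, so a value of `N k`
is either 0 or an earlier value of X. Through this alternative, bounds on X pass to all `N k`
uniformly in k. -/
lemma IsContLocalMartingale.exists_localization (hX : IsContLocalMartingale P 𝓕 X x) :
    ∃ N : ℕ → ℝ≥0 → Ω → ℝ, (∀ k, Martingale (N k) 𝓕 P) ∧
      (∀ k ω, Continuous fun t => N k t ω) ∧
      (∀ᵐ ω ∂P, ∀ T : ℝ≥0, ∀ᶠ k in atTop, ∀ t ≤ T, N k t ω = X t ω) ∧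
      ∀ k t ω, N k t ω = 0 ∨ ∃ u ≤ t, N k t ω = X u ω := by
  obtain ⟨τ, hτ, hM⟩ := hX.isLocalMartingale
  refine ⟨_, hM, fun k ω => ?_, ?_, fun k t ω => ?_⟩
  · refine continuous_stoppedProcess ?_ _
    by_cases h : ω ∈ {ω | ⊥ < τ k ω}
    · simp_rw [Set.indicator_of_mem h]
      exact hX.continuous_path ω
    · simp_rw [Set.indicator_of_notMem h]
      exact continuous_const
  · filter_upwards [hτ.tendsto_top] with ω hω T
    filter_upwards [hω.eventually (lt_mem_nhds (WithTop.coe_lt_top T))] with k hk t ht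
    have h0 : ω ∈ {ω | ⊥ < τ k ω} := bot_le.trans_lt hk
    rw [stoppedProcess_eq_of_le ((WithTop.coe_le_coe.2 ht).trans hk.le), Set.indicator_of_mem h0]
  · obtain ⟨u, hu, -, h⟩ := exists_stoppedProcess_eq
      (fun i => {ω | ⊥ < τ k ω}.indicator (X i)) (τ k) t ω
    rw [h, Set.indicator_apply]
    split_ifs
    · exact Or.inr ⟨u, hu, rfl⟩
    · exact Or.inl rfl

lemma coe_le_of_le_untopA {a : WithTop ℝ≥0} {T u : ℝ≥0} (ha : a ≤ T) (hu : u ≤ a.untopA) :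
    (u : WithTop ℝ≥0) ≤ a :=
  (WithTop.le_untopA_iff (ne_top_of_le_ne_top WithTop.coe_ne_top ha)).1 hu

lemma stronglyMeasurable_stoppedValue_of_continuous (hX : IsContLocalMartingale P 𝓕 X x)
    {ρ : Ω → WithTop ℝ≥0} (hρ : IsStoppingTime 𝓕 ρ) {T : ℝ≥0} (hT : ∀ ω, ρ ω ≤ T) :
    StronglyMeasurable (stoppedValue X ρ) :=
  (stronglyMeasurable_stoppedValue_of_le
    (hX.adapted.isStronglyProgressive_of_continuous hX.continuous_path) hρ hT).mono (𝓕.le T)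

variable [IsProbabilityMeasure P]

/-- Optional stopping for continuous local martingales that stay bounded up to the stopping time,
with a weight. -/
theorem IsContLocalMartingale.integral_mul_stoppedValue (hX : IsContLocalMartingale P 𝓕 X x)
    {ρ : Ω → WithTop ℝ≥0} (hρ : IsStoppingTime 𝓕 ρ) {i T : ℝ≥0} (hi : ∀ ω, i ≤ ρ ω)
    (hT : ∀ ω, ρ ω ≤ T) {G : Ω → ℝ} (hG : StronglyMeasurable[𝓕 i] G) {D : ℝ}
    (hGD : ∀ᵐ ω ∂P, ‖G ω‖ ≤ D) {C : ℝ}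
    (hC : ∀ᵐ ω ∂P, ∀ u : ℝ≥0, u ≤ ρ ω → |G ω * X u ω| ≤ C) :
    ∫ ω, G ω * stoppedValue X ρ ω ∂P = ∫ ω, G ω * X i ω ∂P := by
  obtain ⟨N, hN, hNc, hNX, hN0⟩ := hX.exists_localization
  have hGm : AEStronglyMeasurable G P := (hG.mono (𝓕.le i)).aestronglyMeasurable
  -- The integrals of `G * N k T` do not involve ρ', while their limit is the integral at ρ'. Taking
  -- ρ' = ρ and then ρ' = i identifies the two sides by uniqueness of the limit.
  have hgen : ∀ ρ' : Ω → WithTop ℝ≥0, IsStoppingTime 𝓕 ρ' → (∀ ω, i ≤ ρ' ω) → (∀ ω, ρ' ω ≤ T) →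
      (∀ ω, ρ' ω ≤ ρ ω) → Tendsto (fun k => ∫ ω, G ω * N k T ω ∂P) atTop
        (𝓝 (∫ ω, G ω * stoppedValue X ρ' ω ∂P)) := by
    intro ρ' hρ' hi' hT' hle
    have h1 : ∀ k, ∫ ω, G ω * N k T ω ∂P = ∫ ω, G ω * stoppedValue (N k) ρ' ω ∂P := fun k =>
      (ThresholdStopping.integral_mul_stoppedValue (hN k) (hNc k) hρ' hi' hT' hG hGD).symm
    simp_rw [h1]
    refine tendsto_integral_of_dominated_convergence (fun _ => C)
      (fun k => hGm.mul (integrable_stoppedValue_of_continuous (hN k) (hNc k) hρ' hT').1)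
      (integrable_const _) (fun k => ?_) ?_
    · filter_upwards [hC] with ω hω
      have hC0 : 0 ≤ C := (abs_nonneg _).trans (hω 0 bot_le)
      rw [Real.norm_eq_abs]
      rcases hN0 k (ρ' ω).untopA ω with h | ⟨u, hu, h⟩
      · simpa [stoppedValue, h] using hC0
      · rw [stoppedValue, h]
        exact hω u ((coe_le_of_le_untopA (hT' ω) hu).trans (hle ω))
    · filter_upwards [hNX] with ω hω
      refine Tendsto.const_mul _ (tendsto_const_nhds.congr' ?_)
      filter_upwards [hω T] with k hk
      exact (hk _ (WithTop.untopA_le (hT' ω))).symm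
  have ha := hgen ρ hρ hi hT fun _ => le_rfl
  have hb := hgen (fun _ => i) (isStoppingTime_const 𝓕 i) (fun _ => le_rfl)
    (fun ω => (hi ω).trans (hT ω)) hi
  exact tendsto_nhds_unique ha hb

/-- Continuous local martingales bounded below are supermartingales. -/
theorem IsContLocalMartingale.lintegral_stoppedValue_le (hX : IsContLocalMartingale P 𝓕 X x)
    {ρ : Ω → WithTop ℝ≥0} (hρ : IsStoppingTime 𝓕 ρ) {T : ℝ≥0} (hT : ∀ ω, ρ ω ≤ T) {c : ℝ}
    (hc0 : 0 ≤ c) (hc : ∀ᵐ ω ∂P, ∀ u : ℝ≥0, u ≤ ρ ω → -c ≤ X u ω) :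
    ∫⁻ ω, ENNReal.ofReal (stoppedValue X ρ ω + c) ∂P ≤ ENNReal.ofReal (x + c) := by
  obtain ⟨N, hN, hNc, hNX, hN0⟩ := hX.exists_localization
  have hint : ∀ k, Integrable (stoppedValue (N k) ρ) P := fun k =>
    integrable_stoppedValue_of_continuous (hN k) (hNc k) hρ hT
  -- The sum `N k + c` is nonnegative at ρ; the case where `N k` is 0 is the reason for assuming `0
  -- ≤ c`. The mean is then exact for each k, and Fatou's lemma in k turns it into an inequality for
  -- X.
  have hstep : ∀ k, ∫⁻ ω, ENNReal.ofReal (stoppedValue (N k) ρ ω + c) ∂P =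
      ENNReal.ofReal (∫ ω, N k 0 ω ∂P + c) := by
    intro k
    have hE : ∫ ω, stoppedValue (N k) ρ ω ∂P = ∫ ω, N k 0 ω ∂P := by
      have h1 := ThresholdStopping.integral_mul_stoppedValue (hN k) (hNc k) hρ
        (i := 0) (fun _ => bot_le) hT (G := fun _ => 1) stronglyMeasurable_const (C := 1) (by simp)
      have h2 := ThresholdStopping.integral_mul_stoppedValue (hN k) (hNc k)
        (isStoppingTime_const 𝓕 0) (i := 0) (T := T) (fun _ => le_rfl)
        (fun _ => WithTop.coe_le_coe.2 zero_le)
        (G := fun _ => 1) stronglyMeasurable_const (C := 1) (by simp)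
      simp only [one_mul] at h1 h2
      rw [h1, ← h2]
      rfl
    have hic : Integrable (fun ω => stoppedValue (N k) ρ ω + c) P :=
      (hint k).add (integrable_const c)
    rw [← hE, ← ofReal_integral_eq_lintegral_ofReal hic, integral_add (hint k) (integrable_const c)]
    · simp
    · filter_upwards [hc] with ω hω
      rcases hN0 k (ρ ω).untopA ω with h | ⟨u, hu, h⟩
      · simpa [stoppedValue, h] using hc0
      · have := hω u (coe_le_of_le_untopA (hT ω) hu)
        simp only [Pi.zero_apply, stoppedValue, h]
        linarith
  have hlim0 : Tendsto (fun k => ∫ ω, N k 0 ω ∂P) atTop (𝓝 x) := by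
    have : x = ∫ _, x ∂P := by simp
    rw [this]
    refine tendsto_integral_of_dominated_convergence (fun _ => |x|)
      (fun k => ((hN k).integrable 0).1) (integrable_const _) (fun k => ?_) ?_
    · filter_upwards [hX.init] with ω hω
      rcases hN0 k 0 ω with h | ⟨u, hu, h⟩
      · simp [h]
      · rw [h, nonpos_iff_eq_zero.1 hu, hω, Real.norm_eq_abs]
    · filter_upwards [hNX, hX.init] with ω hω h0
      refine tendsto_const_nhds.congr' ?_
      filter_upwards [hω 0] with k hk
      rw [hk 0 le_rfl, h0]
  calc ∫⁻ ω, ENNReal.ofReal (stoppedValue X ρ ω + c) ∂P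
      ≤ ∫⁻ ω, liminf (fun k => ENNReal.ofReal (stoppedValue (N k) ρ ω + c)) atTop ∂P := by
        refine lintegral_mono_ae ?_
        filter_upwards [hNX] with ω hω
        refine le_of_eq (Tendsto.liminf_eq (tendsto_const_nhds.congr' ?_)).symm
        filter_upwards [hω T] with k hk
        rw [stoppedValue, stoppedValue, hk _ (WithTop.untopA_le (hT ω))]
    _ ≤ liminf (fun k => ∫⁻ ω, ENNReal.ofReal (stoppedValue (N k) ρ ω + c) ∂P) atTop :=
        lintegral_liminf_le' fun k => ((hint k).1.aemeasurable.add_const c).ennreal_ofReal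
    _ = ENNReal.ofReal (x + c) := by
        simp_rw [hstep]
        exact (ENNReal.tendsto_ofReal (hlim0.add_const c)).liminf_eq

/-- A second use of Fatou's lemma, now along the times n ∧ τ. No convergence of the stopped path is
assumed, so the bound can be used to exclude divergence to infinity. -/
lemma IsContLocalMartingale.lintegral_liminf_le (hX : IsContLocalMartingale P 𝓕 X x)
    {τ : Ω → WithTop ℝ≥0} (hτ : IsStoppingTime 𝓕 τ) {c : ℝ} (hc0 : 0 ≤ c)
    (hc : ∀ᵐ ω ∂P, ∀ u : ℝ≥0, u ≤ τ ω → -c ≤ X u ω) :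
    ∫⁻ ω, liminf (fun n : ℕ => ENNReal.ofReal (stoppedProcess X τ n ω + c)) atTop ∂P ≤
      ENNReal.ofReal (x + c) := by
  have hst : ∀ n : ℕ, IsStoppingTime 𝓕 fun ω => min ((n : ℝ≥0) : WithTop ℝ≥0) (τ ω) :=
    fun n => (isStoppingTime_const 𝓕 (n : ℝ≥0)).min hτ
  refine (MeasureTheory.lintegral_liminf_le fun n => ?_).trans ?_
  · exact ((stronglyMeasurable_stoppedValue_of_continuous hX (hst n)
      fun ω => min_le_left _ _).measurable.add_const c).ennreal_ofReal
  · refine (liminf_le_liminf (Eventually.of_forall fun n =>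
      hX.lintegral_stoppedValue_le (hst n) (fun ω => min_le_left _ _) hc0 ?_)).trans
        (le_of_eq (liminf_const _))
    filter_upwards [hc] with ω hω u hu using hω u (hu.trans (min_le_right _ _))

lemma IsContLocalMartingale.not_tendsto_atTop_of_ge (hX : IsContLocalMartingale P 𝓕 X x)
    {τ : Ω → WithTop ℝ≥0} (hτ : IsStoppingTime 𝓕 τ) {c : ℝ} (hc0 : 0 ≤ c)
    (hc : ∀ᵐ ω ∂P, ∀ u : ℝ≥0, u ≤ τ ω → -c ≤ X u ω) :
    ∀ᵐ ω ∂P, ¬ Tendsto (fun t => stoppedProcess X τ t ω) atTop atTop := by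
  have hst : ∀ n : ℕ, IsStoppingTime 𝓕 fun ω => min ((n : ℝ≥0) : WithTop ℝ≥0) (τ ω) :=
    fun n => (isStoppingTime_const 𝓕 (n : ℝ≥0)).min hτ
  have hfin := ae_lt_top (.liminf fun n => ((stronglyMeasurable_stoppedValue_of_continuous hX (hst n)
      fun ω => min_le_left _ _).measurable.add_const c).ennreal_ofReal)
    ((hX.lintegral_liminf_le hτ hc0 hc).trans_lt ENNReal.ofReal_lt_top).ne
  filter_upwards [hfin] with ω hω ht
  have h1 : Tendsto (fun n : ℕ => stoppedProcess X τ n ω + c) atTop atTop :=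
    tendsto_atTop_add_const_right _ c (ht.comp tendsto_natCast_atTop_atTop)
  exact hω.ne (ENNReal.tendsto_ofReal_atTop.comp h1).liminf_eq

/-- A stopped continuous local martingale almost surely does not tend to `∞`. -/
theorem IsContLocalMartingale.not_tendsto_atTop (hX : IsContLocalMartingale P 𝓕 X x)
    {τ : Ω → WithTop ℝ≥0} (hτ : IsStoppingTime 𝓕 τ) :
    ∀ᵐ ω ∂P, ¬ Tendsto (fun t => stoppedProcess X τ t ω) atTop atTop := by
  have hlev : ∀ m : ℕ, IsStoppingTime 𝓕
      (hittingAfter (fun t ω => - X t ω) {z : ℝ | ((m : ℝ) : EReal) ≤ z} 0) := fun m =>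
    isStoppingTime_hittingAfter_ge (fun ω => (hX.continuous_path ω).neg)
      (fun t _ => (hX.adapted t).measurable.neg) _
  -- Stopping also at the first passage to or below -m makes the process bounded below by -m,
  -- provided that it starts above this level.
  have hm : ∀ m : ℕ, |x| ≤ m → ∀ᵐ ω ∂P, ¬ Tendsto (fun t => stoppedProcess X (fun ω => min (τ ω)
      (hittingAfter (fun t ω => - X t ω) {z : ℝ | ((m : ℝ) : EReal) ≤ z} 0 ω)) t ω) atTop atTop := by
    intro m hxm
    refine hX.not_tendsto_atTop_of_ge (hτ.min (hlev m)) (c := m) (by positivity) ?_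
    filter_upwards [hX.init] with ω h0 u hu
    have hu2 := hu.trans (min_le_right _ _)
    by_contra! hlt
    have hpos : ∃ v ∈ Set.Icc 0 u, - X v ω = m := by
      refine intermediate_value_Icc zero_le ((hX.continuous_path ω).neg).continuousOn
        ⟨?_, ?_⟩
      · change - X 0 ω ≤ m
        rw [h0]
        exact (neg_le_abs x).trans hxm
      · change (m : ℝ) ≤ - X u ω
        linarith
    obtain ⟨v, hv, hveq⟩ := hpos
    have hvle : hittingAfter (fun t ω => - X t ω) {z : ℝ | ((m : ℝ) : EReal) ≤ z} 0 ω ≤ v :=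
      hittingAfter_le_of_mem zero_le (by simp [hveq])
    have : u = v := le_antisymm (WithTop.coe_le_coe.1 (hu2.trans hvle)) hv.2
    rw [this] at hlt
    linarith
  have hall : ∀ᵐ ω ∂P, ∀ m : ℕ, |x| ≤ m → ¬ Tendsto (fun t => stoppedProcess X (fun ω => min (τ ω)
      (hittingAfter (fun t ω => - X t ω) {z : ℝ | ((m : ℝ) : EReal) ≤ z} 0 ω)) t ω)
        atTop atTop := by
    rw [ae_all_iff]
    intro m
    by_cases h : |x| ≤ m
    · filter_upwards [hm m h] with ω hω _ using hω
    · exact ae_of_all _ fun ω h' => absurd h' h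
  filter_upwards [hall] with ω hω ht
  -- A continuous path tending to ∞ is bounded below. For large m the extra stopping is therefore
  -- inactive on this path, and the case already treated applies.
  have hcont := continuous_stoppedProcess (hX.continuous_path ω) τ
  obtain ⟨T, hT⟩ := (tendsto_atTop.1 ht 0).exists_forall_of_atTop
  obtain ⟨b, hb⟩ := (isCompact_Icc (a := (0 : ℝ≥0)) (b := T)).bddBelow_image hcont.continuousOn
  obtain ⟨m, hmx⟩ := exists_nat_gt (max |x| (-b))
  have hm1 := (le_max_left _ _).trans_lt hmx
  have hm2 := (le_max_right _ _).trans_lt hmx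
  have hmpos : (0 : ℝ) < m := (abs_nonneg x).trans_lt hm1
  have hgt : ∀ t, -(m : ℝ) < stoppedProcess X τ t ω := by
    intro t
    rcases le_total t T with h | h
    · have := hb ⟨t, ⟨zero_le, h⟩, rfl⟩
      linarith
    · have := hT t h
      linarith
  refine hω m hm1.le (ht.congr fun t => ?_)
  have hle : τ ω ≤ hittingAfter (fun t ω => - X t ω) {z : ℝ | ((m : ℝ) : EReal) ≤ z} 0 ω := by
    by_contra! hlt
    obtain ⟨v, hv⟩ := WithTop.ne_top_iff_exists.1 hlt.ne_top
    obtain ⟨-, h2, -⟩ := hittingAfter_eq_coe (hX.continuous_path ω).neg (isClosed_coe_le _) hv.symm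
    have h3 : (m : ℝ) ≤ - X v ω := EReal.coe_le_coe_iff.1 h2
    have := hgt v
    rw [stoppedProcess_eq_of_le (hv.le.trans hlt.le)] at this
    linarith
  simp only [stoppedProcess, min_eq_left hle]

/-- If a stopped continuous local martingale bounded below converges, then the limit has at most
the initial mean. -/
theorem IsContLocalMartingale.integrable_and_integral_le (hX : IsContLocalMartingale P 𝓕 X x)
    {τ : Ω → WithTop ℝ≥0} (hτ : IsStoppingTime 𝓕 τ) {c : ℝ}
    (hc : ∀ᵐ ω ∂P, ∀ u : ℝ≥0, u ≤ τ ω → -c ≤ X u ω) {Z : Ω → ℝ} (hZ : IsStoppedLimit P X τ Z) :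
    Integrable Z P ∧ ∫ ω, Z ω ∂P ≤ x := by
  wlog hc0 : 0 ≤ c generalizing c
  · refine this (c := |c|) ?_ (abs_nonneg c)
    filter_upwards [hc] with ω hω u hu using (neg_le_neg (le_abs_self c)).trans (hω u hu)
  have hxc : 0 ≤ x + c := by
    obtain ⟨ω, h1, h2⟩ := (hc.and hX.init).exists
    have := h1 0 bot_le
    linarith
  have hseq : ∀ᵐ ω ∂P, Tendsto (fun n : ℕ => stoppedProcess X τ n ω) atTop (𝓝 (Z ω)) := by
    filter_upwards [hZ.2] with ω hω using hω.comp tendsto_natCast_atTop_atTop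
  have hnn : ∀ᵐ ω ∂P, 0 ≤ Z ω + c := by
    filter_upwards [hseq, hc] with ω h1 h2
    have : -c ≤ Z ω := ge_of_tendsto h1 (Eventually.of_forall fun n => by
      obtain ⟨u, -, hu, h⟩ := exists_stoppedProcess_eq X τ n ω
      rw [h]
      exact h2 u hu)
    linarith
  have hle : ∫⁻ ω, ENNReal.ofReal (Z ω + c) ∂P ≤ ENNReal.ofReal (x + c) := by
    refine le_trans (lintegral_mono_ae ?_) (hX.lintegral_liminf_le hτ hc0 hc)
    filter_upwards [hseq] with ω hω
    exact (ENNReal.tendsto_ofReal (hω.add_const c)).liminf_eq.ge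
  have hint : Integrable (fun ω => Z ω + c) P := by
    refine ⟨(hZ.1.add_const c).aestronglyMeasurable, ?_⟩
    rw [hasFiniteIntegral_iff_ofReal hnn]
    exact hle.trans_lt ENNReal.ofReal_lt_top
  have hintZ : Integrable Z P := by
    refine (hint.sub (integrable_const c)).congr (ae_of_all _ fun ω => ?_)
    simp
  refine ⟨hintZ, ?_⟩
  rw [← ofReal_integral_eq_lintegral_ofReal hint hnn, ENNReal.ofReal_le_ofReal_iff hxc,
    integral_add hintZ (integrable_const c)] at hle
  simpa using hle

/-- A continuous local martingale stopped while it is bounded is a martingale. -/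
theorem IsContLocalMartingale.martingale_stoppedProcess (hX : IsContLocalMartingale P 𝓕 X x)
    {σ : Ω → WithTop ℝ≥0} (hσ : IsStoppingTime 𝓕 σ) {C : ℝ}
    (hC : ∀ᵐ ω ∂P, ∀ u : ℝ≥0, u ≤ σ ω → |X u ω| ≤ C) :
    Martingale (stoppedProcess X σ) 𝓕 P := by
  have had := hX.adapted.stoppedProcess hX.continuous_path hσ
  have hint : ∀ t, Integrable (stoppedProcess X σ t) P := fun t =>
    Integrable.of_bound ((had t).mono (𝓕.le t)).aestronglyMeasurable C (by
      filter_upwards [hC] with ω hω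
      obtain ⟨u, -, hu, h⟩ := exists_stoppedProcess_eq X σ t ω
      rw [h]
      exact hω u hu)
  refine ⟨had, fun i j hij => ?_⟩
  refine (ae_eq_condExp_of_forall_setIntegral_eq (𝓕.le i) (hint j)
    (fun E _ _ => (hint i).integrableOn) (fun E hE _ => ?_) (had i).aestronglyMeasurable).symm
  -- On `{σ ≤ i}` the stopped process is constant between i and j, so only the `𝓕 i`-event `E ∩ {i <
  -- σ}` contributes to the increment. On it ρ equals j ∧ σ; the maximum with i makes ρ at least i
  -- everywhere, as optional stopping requires.
  set ρ : Ω → WithTop ℝ≥0 := fun ω => max (min (j : WithTop ℝ≥0) (σ ω)) i with hρdef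
  have hρ : IsStoppingTime 𝓕 ρ :=
    ((isStoppingTime_const 𝓕 j).min hσ).max (isStoppingTime_const 𝓕 i)
  have hS : MeasurableSet[𝓕 i] (E ∩ {ω | (i : WithTop ℝ≥0) < σ ω}) :=
    hE.inter (hσ.measurableSet_gt i)
  have hE' := 𝓕.le i _ hE
  have hS' := 𝓕.le i _ hS
  have hρT : ∀ ω, ρ ω ≤ j := fun ω => max_le (min_le_left _ _) (WithTop.coe_le_coe.2 hij)
  have hbd : ∀ᵐ ω ∂P, ∀ u : ℝ≥0, u ≤ ρ ω →
      |(E ∩ {ω | (i : WithTop ℝ≥0) < σ ω}).indicator (fun _ => (1 : ℝ)) ω * X u ω| ≤ C := by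
    filter_upwards [hC] with ω hω u hu
    by_cases h : ω ∈ E ∩ {ω | (i : WithTop ℝ≥0) < σ ω}
    · rw [Set.indicator_of_mem h, one_mul]
      exact hω u (hu.trans (max_le (min_le_right _ _) (le_of_lt h.2)))
    · rw [Set.indicator_of_notMem h, zero_mul, abs_zero]
      exact (abs_nonneg _).trans (hω 0 bot_le)
  have key := hX.integral_mul_stoppedValue hρ (i := i) (T := j) (fun ω => le_max_right _ _) hρT
    (G := (E ∩ {ω | (i : WithTop ℝ≥0) < σ ω}).indicator fun _ => (1 : ℝ))
    (stronglyMeasurable_const.indicator hS) (D := 1)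
    (ae_of_all _ fun ω => (norm_indicator_le_norm_self _ _).trans (by simp)) hbd
  have hdiff : ∀ ω, E.indicator (stoppedProcess X σ j) ω - E.indicator (stoppedProcess X σ i) ω =
      (E ∩ {ω | (i : WithTop ℝ≥0) < σ ω}).indicator (fun _ => (1 : ℝ)) ω * stoppedValue X ρ ω -
      (E ∩ {ω | (i : WithTop ℝ≥0) < σ ω}).indicator (fun _ => (1 : ℝ)) ω * X i ω := by
    intro ω
    by_cases hωE : ω ∈ E
    · by_cases hi : (i : WithTop ℝ≥0) < σ ω
      · have h1 : ω ∈ E ∩ {ω | (i : WithTop ℝ≥0) < σ ω} := ⟨hωE, hi⟩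
        have h2 : ρ ω = min (j : WithTop ℝ≥0) (σ ω) :=
          max_eq_left (le_min (WithTop.coe_le_coe.2 hij) hi.le)
        rw [Set.indicator_of_mem h1, Set.indicator_of_mem hωE, Set.indicator_of_mem hωE,
          stoppedProcess_eq_of_le hi.le, stoppedValue, h2, one_mul, one_mul]
        rfl
      · have h1 : ω ∉ E ∩ {ω | (i : WithTop ℝ≥0) < σ ω} := fun h => hi h.2
        rw [not_lt] at hi
        rw [Set.indicator_of_notMem h1, Set.indicator_of_mem hωE, Set.indicator_of_mem hωE,
          stoppedProcess_eq_of_ge hi,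
          stoppedProcess_eq_of_ge (hi.trans (WithTop.coe_le_coe.2 hij))]
        ring
    · have h1 : ω ∉ E ∩ {ω | (i : WithTop ℝ≥0) < σ ω} := fun h => hωE h.1
      rw [Set.indicator_of_notMem h1, Set.indicator_of_notMem hωE, Set.indicator_of_notMem hωE]
      ring
  have hbdint : ∀ V : Ω → ℝ, AEStronglyMeasurable V P →
      (∀ᵐ ω ∂P, ∃ u : ℝ≥0, u ≤ ρ ω ∧ V ω = X u ω) →
      Integrable (fun ω => (E ∩ {ω | (i : WithTop ℝ≥0) < σ ω}).indicator (fun _ => (1 : ℝ)) ω *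
        V ω) P := fun V hV h =>
    Integrable.of_bound ((stronglyMeasurable_const.indicator hS').aestronglyMeasurable.mul hV) C (by
      filter_upwards [hbd, h] with ω h1 ⟨u, hu, h2⟩
      rw [h2]
      exact h1 u hu)
  have hI1 := hbdint _ (stronglyMeasurable_stoppedValue_of_continuous hX hρ
    hρT).aestronglyMeasurable (ae_of_all _ fun ω => ⟨(ρ ω).untopA,
      coe_le_of_le_untopA (hρT ω) le_rfl, rfl⟩)
  have hI2 := hbdint _ ((hX.adapted i).mono (𝓕.le i)).aestronglyMeasurable
    (ae_of_all _ fun ω => ⟨i, le_max_right _ _, rfl⟩)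
  have h3 : ∫ ω, (E.indicator (stoppedProcess X σ j) ω - E.indicator (stoppedProcess X σ i) ω) ∂P
      = 0 := by
    simp_rw [hdiff]
    rw [integral_sub hI1 hI2, key, sub_self]
  rw [integral_sub ((hint j).indicator hE') ((hint i).indicator hE'), integral_indicator hE',
    integral_indicator hE'] at h3
  linarith

end LocalMartingale

/-! ### Almost sure convergence of bounded continuous martingales -/

section Convergence

variable {Ω : Type*} [mΩ : MeasurableSpace Ω] {P : Measure Ω} [IsProbabilityMeasure P]
  {𝓕 : Filtration ℝ≥0 mΩ} {M : ℝ≥0 → Ω → ℝ}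

/-- The square maximal inequality for the increments of a bounded continuous martingale. -/
lemma sq_mul_measureReal_increment_ge (hM : Martingale M 𝓕 P)
    (hc : ∀ ω, Continuous fun t => M t ω) {C : ℝ} (hC : ∀ᵐ ω ∂P, ∀ t, |M t ω| ≤ C)
    {ε : ℝ} (hε : 0 < ε) {n N : ℝ≥0} (hnN : n ≤ N) :
    ε ^ 2 * P.real {ω | ∃ u ∈ Set.Icc n N, ((ε : ℝ) : EReal) ≤ (|M u ω - M n ω| : ℝ)} ≤
      ∫ ω, M N ω ^ 2 ∂P - ∫ ω, M n ω ^ 2 ∂P := by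
  set V : ℝ≥0 → Ω → ℝ := fun t ω => |M t ω - M n ω|
  have hVc : ∀ ω, Continuous fun t => V t ω := fun ω => ((hc ω).sub continuous_const).abs
  have hVm : ∀ t, n ≤ t → Measurable[𝓕 t] (V t) := fun t ht =>
    ((hM.stronglyAdapted t).sub
      ((hM.stronglyAdapted n).mono (𝓕.mono ht))).norm.measurable
  -- The first time after n at which the increment reaches ε, cut off at N below. If it occurs by N,
  -- the squared increment at ρ is at least ε², and Markov's inequality applies.
  set η := hittingAfter V {z : ℝ | (ε : EReal) ≤ z} n
  have hη : IsStoppingTime 𝓕 η := isStoppingTime_hittingAfter_ge hVc hVm _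
  set ρ : Ω → WithTop ℝ≥0 := fun ω => min (η ω) N
  have hρ : IsStoppingTime 𝓕 ρ := hη.min (isStoppingTime_const 𝓕 N)
  have hρN : ∀ ω, ρ ω ≤ N := fun ω => min_le_right _ _
  have hnρ : ∀ ω, n ≤ ρ ω := fun ω => le_min (le_hittingAfter ω) (WithTop.coe_le_coe.2 hnN)
  have hbd : ∀ W : Ω → ℝ, AEStronglyMeasurable W P → (∀ᵐ ω ∂P, |W ω| ≤ C) → MemLp W 2 P :=
    fun W hW h => MemLp.of_bound hW C h
  have hρm := integrable_stoppedValue_of_continuous hM hc hρ hρN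
  have hL1 : MemLp (stoppedValue M ρ) 2 P := hbd _ hρm.1 (by
    filter_upwards [hC] with ω hω using hω _)
  have hL2 : MemLp (M n) 2 P := hbd _ (hM.integrable n).1 (by
    filter_upwards [hC] with ω hω using hω _)
  have hGb : ∀ᵐ ω ∂P, ‖M n ω‖ ≤ C := by filter_upwards [hC] with ω hω using hω _
  -- Orthogonality of martingale increments: by it the second moment of the increment is the
  -- difference of second moments.
  have hprod : ∫ ω, M n ω * stoppedValue M ρ ω ∂P = ∫ ω, M n ω ^ 2 ∂P := by
    rw [integral_mul_stoppedValue hM hc hρ hnρ hρN (hM.stronglyAdapted n) hGb,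
      ← integral_mul_stoppedValue hM hc (isStoppingTime_const 𝓕 n) (fun _ => le_rfl)
        (fun _ => WithTop.coe_le_coe.2 hnN) (hM.stronglyAdapted n) hGb]
    simp_rw [pow_two]
    rfl
  have hexp : ∫ ω, (stoppedValue M ρ ω - M n ω) ^ 2 ∂P =
      ∫ ω, stoppedValue M ρ ω ^ 2 ∂P - ∫ ω, M n ω ^ 2 ∂P := by
    have hm : Integrable (fun ω => M n ω * stoppedValue M ρ ω) P := hL2.integrable_mul hL1
    have : ∀ ω, (stoppedValue M ρ ω - M n ω) ^ 2 =
        stoppedValue M ρ ω ^ 2 + M n ω ^ 2 - 2 * (M n ω * stoppedValue M ρ ω) := fun ω => by ring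
    simp_rw [this]
    have hi1 := hL1.integrable_sq
    have hi2 := hL2.integrable_sq
    have hi3 : Integrable (fun ω => stoppedValue M ρ ω ^ 2 + M n ω ^ 2) P := hi1.add hi2
    rw [integral_sub hi3 (hm.const_mul 2), integral_add hi1 hi2, integral_const_mul,
      hprod]
    ring
  have hmark := mul_meas_ge_le_integral_of_nonneg (μ := P)
    (f := fun ω => (stoppedValue M ρ ω - M n ω) ^ 2) (ae_of_all _ fun ω => sq_nonneg _)
    (hL1.sub hL2).integrable_sq (ε ^ 2)
  refine (mul_le_mul_of_nonneg_left (measureReal_mono ?_) (sq_nonneg ε)).trans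
    (hmark.trans (hexp.trans_le (sub_le_sub_right
      (integral_sq_stoppedValue_le hM hc hC hρ hρN) _)))
  intro ω hω
  have hle : η ω ≤ N := (hittingAfter_le_coe_iff (hVc ω) (isClosed_coe_le _)).2 hω
  obtain ⟨v, hv⟩ := WithTop.ne_top_iff_exists.1 (ne_top_of_le_ne_top WithTop.coe_ne_top hle)
  obtain ⟨-, h2, -⟩ := hittingAfter_eq_coe (hVc ω) (isClosed_coe_le _) hv.symm
  have h3 : ε ≤ |M v ω - M n ω| := EReal.coe_le_coe_iff.1 h2
  have h4 : stoppedValue M ρ ω = M v ω := by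
    have : ρ ω = v := (min_eq_left hle).trans hv.symm
    rw [stoppedValue, this, withTop_untopA_coe]
  change ε ^ 2 ≤ (stoppedValue M ρ ω - M n ω) ^ 2
  rw [h4, ← sq_abs (M v ω - M n ω)]
  exact pow_le_pow_left₀ hε.le h3 2

/-- A bounded continuous martingale converges almost surely. -/
theorem exists_tendsto_of_bounded_martingale (hM : Martingale M 𝓕 P)
    (hc : ∀ ω, Continuous fun t => M t ω) {C : ℝ} (hC : ∀ᵐ ω ∂P, ∀ t, |M t ω| ≤ C) :
    ∀ᵐ ω ∂P, ∃ l, Tendsto (fun t => M t ω) atTop (𝓝 l) := by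
  set e : ℕ → ℝ := fun n => ∫ ω, M n ω ^ 2 ∂P with he
  have hinc : ∀ {ε : ℝ}, 0 < ε → ∀ {n N : ℕ}, n ≤ N →
      ε ^ 2 * P.real {ω | ∃ u ∈ Set.Icc (n : ℝ≥0) N, ((ε : ℝ) : EReal) ≤ (|M u ω - M n ω| : ℝ)} ≤
        e N - e n := fun hε n N h =>
    sq_mul_measureReal_increment_ge hM hc hC hε (Nat.cast_le.2 h)
  have hmono : Monotone e := fun n N h => by
    have := hinc one_pos h
    have h0 := measureReal_nonneg (μ := P)
      (s := {ω | ∃ u ∈ Set.Icc (n : ℝ≥0) N, (((1 : ℝ) : ℝ) : EReal) ≤ (|M u ω - M n ω| : ℝ)})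
    nlinarith
  have hbdd : BddAbove (Set.range e) := by
    refine ⟨C ^ 2, ?_⟩
    rintro _ ⟨n, rfl⟩
    have : ∫ ω, M n ω ^ 2 ∂P ≤ ∫ _, C ^ 2 ∂P := by
      refine integral_mono_of_nonneg (ae_of_all _ fun ω => sq_nonneg _) (integrable_const _) ?_
      filter_upwards [hC] with ω hω
      rw [← sq_abs]
      exact pow_le_pow_left₀ (abs_nonneg _) (hω n) 2
    simpa using this
  have hlim := tendsto_atTop_ciSup hmono hbdd
  set L := ⨆ n, e n
  -- The second moments e n increase to a finite limit L, so an oscillation of size ε after time n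
  -- has probability at most (L - e n) / ε², which tends to 0.
  have htail : ∀ ε : ℝ, 0 < ε → P (⋂ n : ℕ, ⋃ N : ℕ,
      {ω | ∃ u ∈ Set.Icc (n : ℝ≥0) N, ((ε : ℝ) : EReal) ≤ (|M u ω - M n ω| : ℝ)}) = 0 := by
    intro ε hε
    have h1 : ∀ n : ℕ, P.real (⋃ N : ℕ,
        {ω | ∃ u ∈ Set.Icc (n : ℝ≥0) N, ((ε : ℝ) : EReal) ≤ (|M u ω - M n ω| : ℝ)}) ≤
          (L - e n) / ε ^ 2 := by
      intro n
      have hmonoset : Monotone fun N : ℕ =>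
          {ω | ∃ u ∈ Set.Icc (n : ℝ≥0) N, ((ε : ℝ) : EReal) ≤ (|M u ω - M n ω| : ℝ)} := by
        rintro a b hab ω ⟨u, hu, h⟩
        exact ⟨u, ⟨hu.1, hu.2.trans (Nat.cast_le.2 hab)⟩, h⟩
      have ht := tendsto_measure_iUnion_atTop (μ := P) hmonoset
      have ht' := (ENNReal.tendsto_toReal (measure_ne_top P _)).comp ht
      refine le_of_tendsto ht' ?_
      filter_upwards [eventually_ge_atTop n] with N hN
      rw [le_div_iff₀ (by positivity), mul_comm]
      exact (hinc hε hN).trans (sub_le_sub_right (le_ciSup hbdd N) _)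
    have h2 : P.real (⋂ n : ℕ, ⋃ N : ℕ,
        {ω | ∃ u ∈ Set.Icc (n : ℝ≥0) N, ((ε : ℝ) : EReal) ≤ (|M u ω - M n ω| : ℝ)}) ≤ 0 := by
      have h3 : Tendsto (fun n => (L - e n) / ε ^ 2) atTop (𝓝 ((L - L) / ε ^ 2)) :=
        (tendsto_const_nhds.sub hlim).div_const _
      rw [sub_self, zero_div] at h3
      exact ge_of_tendsto h3 (Eventually.of_forall fun n =>
        (measureReal_mono (Set.iInter_subset _ n)).trans (h1 n))
    exact (measureReal_eq_zero_iff).1 (le_antisymm h2 measureReal_nonneg)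
  have hall : ∀ᵐ ω ∂P, ∀ k : ℕ, ω ∉ ⋂ n : ℕ, ⋃ N : ℕ,
      {ω | ∃ u ∈ Set.Icc (n : ℝ≥0) N,
        ((1 / ((k : ℝ) + 1) : ℝ) : EReal) ≤ (|M u ω - M n ω| : ℝ)} :=
    ae_all_iff.2 fun k => measure_eq_zero_iff_ae_notMem.1 (htail _ Nat.one_div_pos_of_nat)
  filter_upwards [hall] with ω hω
  refine cauchy_map_iff_exists_tendsto.1 (Metric.cauchy_iff.2 ⟨inferInstance, fun ε hε => ?_⟩)
  obtain ⟨k, hk⟩ := exists_nat_one_div_lt (half_pos hε)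
  have h := hω k
  simp only [Set.mem_iInter, Set.mem_iUnion, Set.mem_ofPred_eq, not_forall, not_exists, not_and,
    not_le, EReal.coe_lt_coe_iff] at h
  obtain ⟨n, hn⟩ := h
  refine ⟨(fun t => M t ω) '' Set.Ici (n : ℝ≥0), image_mem_map (Ici_mem_atTop _), ?_⟩
  have hdist : ∀ u, (n : ℝ≥0) ≤ u → |M u ω - M n ω| < ε / 2 := fun u hu => by
    obtain ⟨N, hN⟩ := exists_nat_ge u
    exact (hn N u ⟨hu, hN⟩).trans hk
  rintro _ ⟨a, ha, rfl⟩ _ ⟨b, hb, rfl⟩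
  have h1 := hdist a ha
  have h2 := hdist b hb
  rw [Real.dist_eq]
  rw [abs_lt] at *
  constructor <;> linarith [h1.1, h1.2, h2.1, h2.2]

end Convergence

/-! ### Regularity: the diffusion does not stay in a compact interval inside the state space -/

section Escape

/-- The set of paths that visit `O` before time `T`. -/
def visitSet (O : Set ℝ) (T : ℝ≥0) : Set PathSpace := {f | ∃ t < T, f.1 t ∈ O}

lemma measurableSet_visitSet {O : Set ℝ} (hO : IsOpen O) (T : ℝ≥0) :
    MeasurableSet (visitSet O T) := by
  have : visitSet O T = ⋃ q : ℕ, {f : PathSpace | TopologicalSpace.denseSeq ℝ≥0 q < T ∧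
      f.1 (TopologicalSpace.denseSeq ℝ≥0 q) ∈ O} := by
    ext f
    simp only [visitSet, Set.mem_ofPred_eq, Set.mem_iUnion]
    constructor
    · rintro ⟨t, ht, hf⟩
      have hop : IsOpen (Set.Iio T ∩ f.1 ⁻¹' O) := isOpen_Iio.inter (hO.preimage f.2)
      obtain ⟨q, hq⟩ := (TopologicalSpace.denseRange_denseSeq ℝ≥0).exists_mem_open hop ⟨t, ht, hf⟩
      exact ⟨q, hq⟩
    · rintro ⟨q, hq⟩
      exact ⟨_, hq⟩
  rw [this]
  refine MeasurableSet.iUnion fun q => ?_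
  have hm : Measurable fun f : PathSpace => f.1 (TopologicalSpace.denseSeq ℝ≥0 q) :=
    (measurable_pi_apply _).comp measurable_subtype_coe
  exact (MeasurableSet.const _).inter (hm hO.measurableSet)

lemma visitSet_mono {O O' : Set ℝ} {T T' : ℝ≥0} (hO : O ⊆ O') (hT : T ≤ T') :
    visitSet O T ⊆ visitSet O' T' :=
  fun _ ⟨t, ht, h⟩ => ⟨t, ht.trans_le hT, hO h⟩

variable {Ω : Type*} [mΩ : MeasurableSpace Ω] {P : Measure Ω}
  {𝓕 : Filtration ℝ≥0 mΩ} {I : Set ℝ} {y : ℝ} {Y : ℝ≥0 → Ω → ℝ} {κ : Kernel ℝ PathSpace}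

lemma IsContinuousStrongMarkov.measure_visit (hM : IsContinuousStrongMarkov P 𝓕 I κ Y)
    {τ : Ω → WithTop ℝ≥0} (hτ : IsStoppingTime 𝓕 τ) {E : Set Ω}
    (hE : MeasurableSet[hτ.measurableSpace] E) {O : Set ℝ} (hO : IsOpen O) (T : ℝ≥0) :
    P {ω | ω ∈ E ∧ τ ω ≠ ⊤ ∧ ∃ t < T, Y ((τ ω).untopA + t) ω ∈ O} =
      ∫⁻ ω in {ω | ω ∈ E ∧ τ ω ≠ ⊤}, κ (stoppedValue Y τ ω) (visitSet O T) ∂P :=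
  hM.strong_markov τ hτ E hE _ (measurableSet_visitSet hO T)

variable [IsProbabilityMeasure P]

lemma IsContinuousStrongMarkov.measure_visit_start (hM : IsContinuousStrongMarkov P 𝓕 I κ Y)
    (hy : ∀ᵐ ω ∂P, Y 0 ω = y) {O : Set ℝ} (hO : IsOpen O) (T : ℝ≥0) :
    P {ω | ∃ t < T, Y t ω ∈ O} = κ y (visitSet O T) := by
  have h := hM.measure_visit (isStoppingTime_const 𝓕 0) (E := Set.univ) MeasurableSet.univ hO T
  have h1 : {ω : Ω | ω ∈ Set.univ ∧ (((0 : ℝ≥0) : WithTop ℝ≥0)) ≠ ⊤} = Set.univ := by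
    ext ω
    simp
  rw [h1, Measure.restrict_univ] at h
  have h2 : ∫⁻ ω, κ (stoppedValue Y (fun _ => ((0 : ℝ≥0) : WithTop ℝ≥0)) ω) (visitSet O T) ∂P =
      ∫⁻ _, κ y (visitSet O T) ∂P := by
    refine lintegral_congr_ae ?_
    filter_upwards [hy] with ω hω
    rw [stoppedValue_const, hω]
  rw [h2, lintegral_const, measure_univ, mul_one] at h
  rw [← h]
  congr 1
  ext ω
  simp only [Set.mem_ofPred_eq, Set.mem_univ, ne_eq, WithTop.coe_ne_top, not_false_eq_true,
    withTop_untopA_coe, zero_add, true_and]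

/-- A continuous path from y to O has to pass through z. The strong Markov property at the first
passage restarts the process at z, with at least as much time left as the path needs to get from z
to O. -/
lemma IsContinuousStrongMarkov.kernel_visit_le (hM : IsContinuousStrongMarkov P 𝓕 I κ Y)
    (hy : ∀ᵐ ω ∂P, Y 0 ω = y) {O : Set ℝ} (hO : IsOpen O) (T : ℝ≥0) {z : ℝ}
    (hz : ∀ w ∈ O, z ∈ Set.uIcc y w) :
    κ y (visitSet O T) ≤ κ z (visitSet O T) := by
  -- Y hits z exactly when V reaches level 0, which expresses the hitting time as an upward passage.
  set V : ℝ≥0 → Ω → ℝ := fun t ω => - |Y t ω - z|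
  have hVc : ∀ ω, Continuous fun t => V t ω := fun ω =>
    ((hM.continuous_path ω).sub continuous_const).abs.neg
  have hVm : ∀ t, (0 : ℝ≥0) ≤ t → Measurable[𝓕 t] (V t) := fun t _ =>
    ((hM.adapted t).sub stronglyMeasurable_const).norm.measurable.neg
  set τ := hittingAfter V {z : ℝ | ((0 : ℝ) : EReal) ≤ z} 0
  have hτ : IsStoppingTime 𝓕 τ := isStoppingTime_hittingAfter_ge hVc hVm _
  have hval : ∀ ω t, τ ω = ((t : ℝ≥0) : WithTop ℝ≥0) → Y t ω = z := fun ω t h => by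
    obtain ⟨-, h2, -⟩ := hittingAfter_eq_coe (hVc ω) (isClosed_coe_le _) h
    have h3 : 0 ≤ - |Y t ω - z| := EReal.coe_le_coe_iff.1 h2
    have := abs_eq_zero.1 (le_antisymm (by linarith) (abs_nonneg (Y t ω - z)))
    linarith
  rw [← hM.measure_visit_start hy hO T]
  calc P {ω | ∃ t < T, Y t ω ∈ O}
      ≤ P {ω | ω ∈ Set.univ ∧ τ ω ≠ ⊤ ∧ ∃ t < T, Y ((τ ω).untopA + t) ω ∈ O} := by
        refine measure_mono_ae ?_
        filter_upwards [hy] with ω hω ⟨t, ht, hmem⟩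
        obtain ⟨u, hu, huz⟩ := intermediate_value_uIcc
          (hM.continuous_path ω).continuousOn (hω ▸ hz _ hmem : z ∈ Set.uIcc (Y 0 ω) (Y t ω))
        rw [Set.uIcc_of_le zero_le] at hu
        have hle : τ ω ≤ u := hittingAfter_le_of_mem zero_le (by simp [V, huz])
        obtain ⟨v, hv⟩ := WithTop.ne_top_iff_exists.1
          (ne_top_of_le_ne_top WithTop.coe_ne_top hle)
        have hvt : v ≤ t := (WithTop.coe_le_coe.1 (hv.trans_le hle)).trans hu.2
        refine ⟨trivial, hv ▸ WithTop.coe_ne_top, t - v, tsub_le_self.trans_lt ht, ?_⟩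
        rwa [← hv, withTop_untopA_coe, add_tsub_cancel_of_le hvt]
    _ = ∫⁻ ω in {ω | ω ∈ Set.univ ∧ τ ω ≠ ⊤}, κ (stoppedValue Y τ ω) (visitSet O T) ∂P :=
        hM.measure_visit hτ MeasurableSet.univ hO T
    _ = ∫⁻ _ in {ω | ω ∈ Set.univ ∧ τ ω ≠ ⊤}, κ z (visitSet O T) ∂P := by
        have hms : MeasurableSet {ω | ω ∈ Set.univ ∧ τ ω ≠ ⊤} := by
          have := hτ.measurableSet_eq_top'.compl
          simp only [Set.mem_univ, true_and]
          exact (iSup_le fun i => 𝓕.le i) _ this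
        refine setLIntegral_congr_fun hms fun ω hω => ?_
        obtain ⟨v, hv⟩ := WithTop.ne_top_iff_exists.1 hω.2
        rw [stoppedValue, ← hv, withTop_untopA_coe, hval ω v hv.symm]
    _ ≤ κ z (visitSet O T) := by
        rw [setLIntegral_const]
        exact mul_le_of_le_one_right' prob_le_one

lemma exists_kernel_visit_pos {w : ℝ} (h : 0 < κ y {f | ∃ t, f.1 t = w}) {O : Set ℝ}
    (hw : w ∈ O) : ∃ T : ℕ, 0 < κ y (visitSet O T) := by
  by_contra! hne
  have h0 : κ y (⋃ T : ℕ, visitSet O T) = 0 :=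
    measure_iUnion_null fun T => le_antisymm (hne T) zero_le
  refine h.ne' (measure_mono_null ?_ h0)
  rintro f ⟨t, ht⟩
  obtain ⟨T, hT⟩ := exists_nat_gt t
  exact Set.mem_iUnion.2 ⟨T, t, hT, ht ▸ hw⟩

lemma measurableSet_forall_mem {Ω : Type*} {m : MeasurableSpace Ω} {V : ℝ≥0 → Ω → ℝ}
    (hc : ∀ ω, Continuous fun t => V t ω) {n t : ℝ≥0} (hnt : n ≤ t)
    (hV : ∀ u ∈ Set.Icc n t, Measurable (V u)) {S : Set ℝ} (hS : IsClosed S) :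
    MeasurableSet {ω | ∀ u ∈ Set.Icc n t, V u ω ∈ S} := by
  have : {ω | ∀ u ∈ Set.Icc n t, V u ω ∈ S} =
      ⋂ q : ℕ, {ω | V (max n (min (TopologicalSpace.denseSeq ℝ≥0 q) t)) ω ∈ S} := by
    ext ω
    simp only [Set.mem_ofPred_eq, Set.mem_iInter]
    refine ⟨fun h q => h _ ⟨le_max_left _ _, max_le hnt (min_le_right _ _)⟩, fun h u hu => ?_⟩
    have hcl : IsClosed {v : ℝ≥0 | V (max n (min v t)) ω ∈ S} :=
      hS.preimage ((hc ω).comp (by fun_prop))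
    have h1 : u ∈ {v : ℝ≥0 | V (max n (min v t)) ω ∈ S} := by
      have := (TopologicalSpace.denseRange_denseSeq ℝ≥0).closure_range ▸ Set.mem_univ u
      exact hcl.closure_subset_iff.2 (by rintro _ ⟨q, rfl⟩; exact h q) this
    rwa [Set.mem_ofPred_eq, min_eq_left hu.2, max_eq_right hu.1] at h1
  rw [this]
  exact MeasurableSet.iInter fun q =>
    hV _ ⟨le_max_left _ _, max_le hnt (min_le_right _ _)⟩ hS.measurableSet

/-- If the process leaves `[c, d]` before time `T` with probability at least `δ`, whatever its
starting point in `[c, d]`, then it almost surely does not stay in `[c, d]` forever. -/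
lemma IsContinuousStrongMarkov.measure_stay_eq_zero (hM : IsContinuousStrongMarkov P 𝓕 I κ Y)
    {c d : ℝ} {T : ℝ≥0} {δ : ℝ≥0∞} (hδ : 0 < δ) (hδ1 : δ ≤ 1)
    (hesc : ∀ z ∈ Set.Icc c d, δ ≤ κ z (visitSet (Set.Icc c d)ᶜ T)) (n : ℝ≥0) :
    P {ω | ∀ t, n ≤ t → Y t ω ∈ Set.Icc c d} = 0 := by
  set S : ℕ → Set Ω := fun k => {ω | ∀ u ∈ Set.Icc n (n + k * T), Y u ω ∈ Set.Icc c d} with hSdef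
  have hSm' : ∀ k : ℕ, MeasurableSet[𝓕 (n + k * T)] (S k) := fun k =>
    measurableSet_forall_mem (m := 𝓕 (n + k * T)) hM.continuous_path le_self_add
      (fun u hu => (hM.adapted u).measurable.mono (𝓕.mono hu.2) le_rfl) isClosed_Icc
  have hSm : ∀ k, MeasurableSet (S k) := fun k => 𝓕.le _ _ (hSm' k)
  -- The Markov property at time n + kT: from any point of `[c, d]` the process escapes within the
  -- next T with probability at least δ. The survival probability thus decays geometrically; the
  -- additive form avoids truncated subtraction.
  have hstep : ∀ k, P (S (k + 1)) + δ * P (S k) ≤ P (S k) := by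
    intro k
    have hst := isStoppingTime_const 𝓕 (n + k * T)
    have hE : MeasurableSet[hst.measurableSpace] (S k) := by
      rw [IsStoppingTime.measurableSpace_const]
      exact hSm' k
    have hmk := hM.measure_visit hst hE (isClosed_Icc (a := c) (b := d)).isOpen_compl T
    have h1 : {ω : Ω | ω ∈ S k ∧ ((n + k * T : ℝ≥0) : WithTop ℝ≥0) ≠ ⊤} = S k := by
      ext ω
      simp only [Set.mem_ofPred_eq, ne_eq, WithTop.coe_ne_top, not_false_eq_true, and_true]
    rw [h1] at hmk
    set F : Set Ω := {ω | ω ∈ S k ∧ ((n + k * T : ℝ≥0) : WithTop ℝ≥0) ≠ ⊤ ∧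
      ∃ t < T, Y (((n + k * T : ℝ≥0) : WithTop ℝ≥0).untopA + t) ω ∈ (Set.Icc c d)ᶜ} with hF
    have hge : δ * P (S k) ≤ P F := by
      rw [hmk, ← setLIntegral_const]
      refine setLIntegral_mono' (hSm k) fun ω hω => ?_
      rw [stoppedValue_const]
      exact hesc _ (hω _ ⟨le_self_add, le_rfl⟩)
    have hdisj : Disjoint F (S (k + 1)) := by
      rw [Set.disjoint_left]
      rintro ω ⟨-, -, t, ht, hmem⟩ hω
      rw [withTop_untopA_coe] at hmem
      refine hmem (hω _ ⟨(le_self_add).trans le_self_add, ?_⟩)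
      rw [Nat.cast_add, Nat.cast_one, add_mul, one_mul, ← add_assoc]
      exact add_le_add_right ht.le _
    have hsub : F ∪ S (k + 1) ⊆ S k := by
      rintro ω (hω | hω)
      · exact hω.1
      · intro u hu
        refine hω u ⟨hu.1, hu.2.trans ?_⟩
        gcongr
        simp
    calc P (S (k + 1)) + δ * P (S k) ≤ P F + P (S (k + 1)) := by
          rw [add_comm]
          gcongr
      _ = P (F ∪ S (k + 1)) := (measure_union hdisj (hSm _)).symm
      _ ≤ P (S k) := measure_mono hsub
  have hδt : δ ≠ ⊤ := ne_top_of_le_ne_top ENNReal.one_ne_top hδ1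
  have hreal : ∀ k, P.real (S (k + 1)) ≤ (1 - δ.toReal) * P.real (S k) := by
    intro k
    have := ENNReal.toReal_mono (measure_ne_top P _) (hstep k)
    rw [ENNReal.toReal_add (measure_ne_top P _)
      (ENNReal.mul_ne_top hδt (measure_ne_top P _)), ENNReal.toReal_mul] at this
    simp only [Measure.real]
    linarith
  have hδ1' : δ.toReal ≤ 1 := by simpa using ENNReal.toReal_mono ENNReal.one_ne_top hδ1
  have hδ0' : 0 < δ.toReal := ENNReal.toReal_pos hδ.ne' hδt
  have hpow : ∀ k, P.real (S k) ≤ (1 - δ.toReal) ^ k := by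
    intro k
    induction k with
    | zero => simp
    | succ k ih =>
      refine (hreal k).trans ?_
      rw [pow_succ']
      exact mul_le_mul_of_nonneg_left ih (by linarith)
  have hlim := tendsto_pow_atTop_nhds_zero_of_lt_one (r := 1 - δ.toReal) (by linarith)
    (by linarith)
  have hsub : ∀ k, {ω | ∀ t, n ≤ t → Y t ω ∈ Set.Icc c d} ⊆ S k := fun k ω hω u hu => hω u hu.1
  have hle : P.real {ω | ∀ t, n ≤ t → Y t ω ∈ Set.Icc c d} ≤ 0 :=
    ge_of_tendsto hlim (Eventually.of_forall fun k =>
      (measureReal_mono (hsub k)).trans (hpow k))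
  exact (measureReal_eq_zero_iff).1 (le_antisymm hle measureReal_nonneg)

/-- A regular diffusion almost surely does not stay in a compact subinterval of the interior of
its state space. -/
theorem IsRegularDiffusion.exists_notMem_Icc (hY : IsRegularDiffusion P 𝓕 I y Y) {c d : ℝ}
    (hc : ∃ w ∈ I, w < c) (hd : ∃ w ∈ I, d < w) :
    ∀ᵐ ω ∂P, ∀ n : ℕ, ∃ t : ℝ≥0, n ≤ t ∧ Y t ω ∉ Set.Icc c d := by
  obtain ⟨-, hyI, hy0, κ, hM, hreg⟩ := hY
  have := hM.prob_kernel
  obtain ⟨w₁, hw₁, hw₁c⟩ := hc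
  obtain ⟨w₂, hw₂, hw₂d⟩ := hd
  obtain ⟨T₁, hT₁⟩ := exists_kernel_visit_pos (hreg y hyI w₁ hw₁) (O := Set.Iio c) hw₁c
  obtain ⟨T₂, hT₂⟩ := exists_kernel_visit_pos (hreg y hyI w₂ hw₂) (O := Set.Ioi d) hw₂d
  set δ := min (κ y (visitSet (Set.Iio c) T₁)) (κ y (visitSet (Set.Ioi d) T₂))
  -- A starting point z ≤ y lies on the way from y down to below c, and a point z ≥ y on the way up
  -- to above d. Comparison with the start at y gives one lower bound for all z.
  have hesc : ∀ z ∈ Set.Icc c d, δ ≤ κ z (visitSet (Set.Icc c d)ᶜ (max (T₁ : ℝ≥0) T₂)) := by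
    intro z hz
    rcases le_total z y with h | h
    · refine (min_le_left _ _).trans ((hM.kernel_visit_le hy0 isOpen_Iio T₁ fun w hw => ?_).trans
        (measure_mono (visitSet_mono (fun w hw => ?_) (le_max_left _ _))))
      · exact Set.mem_uIcc_of_ge ((le_of_lt hw).trans hz.1) h
      · exact fun h => not_le.2 hw h.1
    · refine (min_le_right _ _).trans ((hM.kernel_visit_le hy0 isOpen_Ioi T₂ fun w hw => ?_).trans
        (measure_mono (visitSet_mono (fun w hw => ?_) (le_max_right _ _))))
      · exact Set.mem_uIcc_of_le h (hz.2.trans (le_of_lt hw))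
      · exact fun h => not_le.2 hw h.2
  rw [ae_all_iff]
  intro n
  have h0 := hM.measure_stay_eq_zero (lt_min hT₁ hT₂) ((min_le_left _ _).trans prob_le_one)
    hesc n
  filter_upwards [measure_eq_zero_iff_ae_notMem.1 h0] with ω hω
  simpa using hω

end Escape

/-! ### Pathwise behaviour at exit times -/

section ExitPath

variable {Ω : Type*} {X : ℝ≥0 → Ω → ℝ} {Θ Θ' : Ω → EReal × EReal} {ω : Ω}

lemma mem_Ioo_of_lt_exitTime {u : ℝ≥0} (hu : (u : WithTop ℝ≥0) < exitTime X Θ ω) :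
    (X u ω : EReal) ∈ Set.Ioo (Θ ω).1 (Θ ω).2 :=
  not_not.1 (notMem_of_lt_hittingAfter hu zero_le)

lemma mem_Icc_of_le_exitTime (hc : Continuous fun t => X t ω)
    (h0 : (X 0 ω : EReal) ∈ Set.Icc (Θ ω).1 (Θ ω).2) {u : ℝ≥0}
    (hu : (u : WithTop ℝ≥0) ≤ exitTime X Θ ω) : (X u ω : EReal) ∈ Set.Icc (Θ ω).1 (Θ ω).2 := by
  rcases eq_or_ne u 0 with rfl | hne
  · exact h0
  have hpos : 0 < u := pos_iff_ne_zero.2 hne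
  have : (𝓝[<] u).NeBot := nhdsLT_neBot_of_exists_lt ⟨0, hpos⟩
  have hcE : Continuous fun t => (X t ω : EReal) := continuous_coe_real_ereal.comp hc
  refine isClosed_Icc.mem_of_tendsto (b := 𝓝[<] u) ((hcE.tendsto u).mono_left nhdsWithin_le_nhds) ?_
  filter_upwards [self_mem_nhdsWithin] with t ht
  exact Set.Ioo_subset_Icc_self (mem_Ioo_of_lt_exitTime ((WithTop.coe_lt_coe.2 ht).trans_le hu))

lemma eq_or_eq_of_exitTime_eq (hc : Continuous fun t => X t ω)
    (h0 : (X 0 ω : EReal) ∈ Set.Icc (Θ ω).1 (Θ ω).2) {t : ℝ≥0} (ht : exitTime X Θ ω = t) :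
    (X t ω : EReal) = (Θ ω).1 ∨ (X t ω : EReal) = (Θ ω).2 := by
  have h1 := mem_Icc_of_le_exitTime hc h0 ht.ge
  have h2 := (hittingAfter_eq_coe hc (isClosed_notMem_Ioo _ _) ht).2.1
  by_contra! h
  exact h2 ⟨lt_of_le_of_ne h1.1 h.1.symm, lt_of_le_of_ne h1.2 h.2⟩

lemma tendsto_stoppedProcess_of_eq_coe {τ : Ω → WithTop ℝ≥0} {t : ℝ≥0} (h : τ ω = t) :
    Tendsto (fun s => stoppedProcess X τ s ω) atTop (𝓝 (X t ω)) := by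
  refine tendsto_const_nhds.congr' ?_
  filter_upwards [eventually_ge_atTop t] with s hs
  rw [stoppedProcess_eq_of_ge (h.le.trans (WithTop.coe_le_coe.2 hs)), h, withTop_untopA_coe]

/-- This removes truncations: if the path stopped on leaving the smaller interval ends outside the
larger one, it has left both at the same time. The case of an infinite exit time is included. -/
lemma exitTime_eq_of_tendsto (hsub : Set.Ioo (Θ' ω).1 (Θ' ω).2 ⊆ Set.Ioo (Θ ω).1 (Θ ω).2) {z : ℝ}
    (hz : Tendsto (fun t => stoppedProcess X (exitTime X Θ') t ω) atTop (𝓝 z))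
    (hzΘ : (z : EReal) ∉ Set.Ioo (Θ ω).1 (Θ ω).2) : exitTime X Θ ω = exitTime X Θ' ω := by
  have hle : exitTime X Θ' ω ≤ exitTime X Θ ω :=
    hittingAfter_apply_anti X 0 ω fun v hv h => hv (hsub h)
  refine le_antisymm ?_ hle
  rcases eq_or_ne (exitTime X Θ' ω) ⊤ with h | h
  · exact h ▸ le_top
  obtain ⟨t, ht⟩ := WithTop.ne_top_iff_exists.1 h
  have hzt : z = X t ω := tendsto_nhds_unique hz (tendsto_stoppedProcess_of_eq_coe ht.symm)
  rw [← ht]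
  exact hittingAfter_le_of_mem zero_le (by simpa [← hzt] using hzΘ)

end ExitPath

/-! ### Exit from random intervals, bounded and unbounded -/

section Thresholds

variable {Ω : Type*} [mΩ : MeasurableSpace Ω] {P : Measure Ω}
  {𝓕 : Filtration ℝ≥0 mΩ} {X : ℝ≥0 → Ω → ℝ} {x : ℝ}

lemma IsContLocalMartingale.exists_isStoppedLimit (hX : IsContLocalMartingale P 𝓕 X x)
    {τ : Ω → WithTop ℝ≥0} (hτ : IsStoppingTime 𝓕 τ)
    (h : ∀ᵐ ω ∂P, ∃ l : ℝ, Tendsto (fun t => stoppedProcess X τ t ω) atTop (𝓝 l)) :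
    ∃ Z, IsStoppedLimit P X τ Z := by
  have hm : ∀ n : ℕ, AEMeasurable (stoppedProcess X τ n) P := fun n =>
    ((hX.adapted.stoppedProcess hX.continuous_path hτ n).mono (𝓕.le _)).measurable.aemeasurable
  obtain ⟨Z, hZm, hZ⟩ := measurable_limit_of_tendsto_metrizable_ae hm
    (L := atTop) (by
      filter_upwards [h] with ω ⟨l, hl⟩
      exact ⟨l, hl.comp tendsto_natCast_atTop_atTop⟩)
  refine ⟨Z, hZm, ?_⟩
  filter_upwards [h, hZ] with ω ⟨l, hl⟩ hω
  rwa [tendsto_nhds_unique hω (hl.comp tendsto_natCast_atTop_atTop)]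

variable [IsProbabilityMeasure P]

/-- Exit from a random interval chosen at time `0`, with bounded thresholds. -/
lemma IsContLocalMartingale.exists_exit_of_bounded (hX : IsContLocalMartingale P 𝓕 X x) {J : Set ℝ}
    (hesc : ∀ᵐ ω ∂P, ∀ L : ℝ, (∃ p ∈ J, p < L) → (∃ q ∈ J, L < q) →
      ¬ Tendsto (fun t => X t ω) atTop (𝓝 L))
    {Θ : Ω → EReal × EReal} (hΘm : Measurable[𝓕 0] Θ) {n : ℝ}
    (h1 : ∀ ω, ((-n : ℝ) : EReal) ≤ (Θ ω).1) (h2 : ∀ ω, (Θ ω).1 ≤ x) (h3 : ∀ ω, x ≤ (Θ ω).2)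
    (h4 : ∀ ω, (Θ ω).2 ≤ (n : ℝ))
    (hJ1 : ∀ ω, ∀ z : ℝ, (Θ ω).1 < z → ∃ p ∈ J, p < z)
    (hJ2 : ∀ ω, ∀ z : ℝ, z < (Θ ω).2 → ∃ q ∈ J, z < q) :
    ∃ Z, IsStoppedLimit P X (exitTime X Θ) Z ∧
      (∀ᵐ ω ∂P, (Z ω : EReal) = (Θ ω).1 ∨ (Z ω : EReal) = (Θ ω).2) ∧
      ∀ (G : Ω → ℝ) (D : ℝ), StronglyMeasurable[𝓕 0] G → (∀ ω, ‖G ω‖ ≤ D) →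
        ∫ ω, G ω * Z ω ∂P = x * ∫ ω, G ω ∂P := by
  have hσ : IsStoppingTime 𝓕 (exitTime X Θ) :=
    isStoppingTime_exitTime hX.continuous_path (fun t => (hX.adapted t).measurable) hΘm
  have hin : ∀ᵐ ω ∂P, ∀ u : ℝ≥0, u ≤ exitTime X Θ ω →
      (X u ω : EReal) ∈ Set.Icc (Θ ω).1 (Θ ω).2 := by
    filter_upwards [hX.init] with ω h0 u hu
    exact mem_Icc_of_le_exitTime (hX.continuous_path ω) (by rw [h0]; exact ⟨h2 ω, h3 ω⟩) hu
  have hbd : ∀ᵐ ω ∂P, ∀ u : ℝ≥0, u ≤ exitTime X Θ ω → |X u ω| ≤ n := by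
    filter_upwards [hin] with ω hω u hu
    exact abs_le.2 ⟨EReal.coe_le_coe_iff.1 ((h1 ω).trans (hω u hu).1),
      EReal.coe_le_coe_iff.1 ((hω u hu).2.trans (h4 ω))⟩
  have hconv := exists_tendsto_of_bounded_martingale (hX.martingale_stoppedProcess hσ hbd)
    (fun ω => continuous_stoppedProcess (hX.continuous_path ω) _) (C := n) (by
      filter_upwards [hbd] with ω hω t
      obtain ⟨u, -, hu, h⟩ := exists_stoppedProcess_eq X (exitTime X Θ) t ω
      rw [h]
      exact hω u hu)
  obtain ⟨Z, hZ⟩ := hX.exists_isStoppedLimit hσ hconv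
  refine ⟨Z, hZ, ?_, fun G D hG hGD => ?_⟩
  · filter_upwards [hZ.2, hin, hX.init, hesc] with ω hω hinω h0 hescω
    -- Without exit, X itself converges to Z inside the closed interval. A limit strictly between
    -- the thresholds would have points of J on both sides, which `hesc` excludes; so the limit is a
    -- threshold.
    rcases eq_or_ne (exitTime X Θ ω) ⊤ with h | h
    · have hXZ : Tendsto (fun t => X t ω) atTop (𝓝 (Z ω)) := by
        refine hω.congr fun t => stoppedProcess_eq_of_le (h ▸ le_top)
      have hmem : (Z ω : EReal) ∈ Set.Icc (Θ ω).1 (Θ ω).2 :=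
        isClosed_Icc.mem_of_tendsto ((continuous_coe_real_ereal.tendsto _).comp hXZ)
          (Eventually.of_forall fun t => hinω t (h ▸ le_top))
      by_contra! hne
      exact hescω (Z ω) (hJ1 ω _ (lt_of_le_of_ne hmem.1 hne.1.symm))
        (hJ2 ω _ (lt_of_le_of_ne hmem.2 hne.2)) hXZ
    · obtain ⟨t, ht⟩ := WithTop.ne_top_iff_exists.1 h
      rw [tendsto_nhds_unique hω (tendsto_stoppedProcess_of_eq_coe ht.symm)]
      exact eq_or_eq_of_exitTime_eq (hX.continuous_path ω) (by rw [h0]; exact ⟨h2 ω, h3 ω⟩) ht.symm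
  · have hGm := (hG.mono (𝓕.le 0)).aestronglyMeasurable (μ := P)
    have hst : ∀ k : ℕ, IsStoppingTime 𝓕 fun ω => min ((k : ℝ≥0) : WithTop ℝ≥0) (exitTime X Θ ω) :=
      fun k => (isStoppingTime_const 𝓕 (k : ℝ≥0)).min hσ
    have hDn : ∀ᵐ ω ∂P, ∀ u : ℝ≥0, u ≤ exitTime X Θ ω → |G ω * X u ω| ≤ D * n := by
      filter_upwards [hbd] with ω hω u hu
      rw [abs_mul]
      exact mul_le_mul (hGD ω) (hω u hu) (abs_nonneg _) ((norm_nonneg _).trans (hGD ω))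
    have hk : ∀ k : ℕ, ∫ ω, G ω * stoppedProcess X (exitTime X Θ) k ω ∂P = x * ∫ ω, G ω ∂P := by
      intro k
      have := hX.integral_mul_stoppedValue (hst k) (i := 0) (fun _ => bot_le)
        (fun ω => min_le_left _ _) hG (ae_of_all _ hGD) (C := D * n) (by
          filter_upwards [hDn] with ω hω u hu using hω u (hu.trans (min_le_right _ _)))
      rw [stoppedProcess_eq_stoppedValue, this, ← integral_const_mul]
      refine integral_congr_ae ?_
      filter_upwards [hX.init] with ω h0
      rw [h0, mul_comm]
    have hlim : Tendsto (fun k : ℕ => ∫ ω, G ω * stoppedProcess X (exitTime X Θ) k ω ∂P) atTop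
        (𝓝 (∫ ω, G ω * Z ω ∂P)) := by
      refine tendsto_integral_of_dominated_convergence (fun _ => D * n)
        (fun k => hGm.mul ((hX.adapted.stoppedProcess hX.continuous_path hσ k).mono
          (𝓕.le _)).aestronglyMeasurable) (integrable_const _) (fun k => ?_) ?_
      · filter_upwards [hDn] with ω hω
        obtain ⟨u, -, hu, h⟩ := exists_stoppedProcess_eq X (exitTime X Θ) k ω
        rw [h]
        exact hω u hu
      · filter_upwards [hZ.2] with ω hω
        exact (hω.comp tendsto_natCast_atTop_atTop).const_mul _
    simp_rw [hk] at hlim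
    exact tendsto_nhds_unique hlim tendsto_const_nhds

/-- Fair two-valued variables with values in truncations of `{A, B}` end up in `{A, B}`. -/
lemma ae_exists_eq_of_truncated {A B : Ω → EReal} (hA : Measurable[𝓕 0] A)
    (hB : Measurable[𝓕 0] B) {N₀ : ℕ} {Z : ℕ → Ω → ℝ} (hZm : ∀ n, Measurable (Z n))
    (hZ : ∀ n, ∀ᵐ ω ∂P, (Z n ω : EReal) = max (A ω) ((-((n + N₀ : ℕ) : ℝ) : ℝ) : EReal) ∨
      (Z n ω : EReal) = min (B ω) (((n + N₀ : ℕ) : ℝ) : EReal))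
    (hE : ∀ n, ∀ (G : Ω → ℝ) (D : ℝ), StronglyMeasurable[𝓕 0] G → (∀ ω, ‖G ω‖ ≤ D) →
        ∫ ω, G ω * Z n ω ∂P = x * ∫ ω, G ω ∂P)
    (hAx : ∀ ω, A ω ≤ x) (hN₀ : |x| ≤ N₀) :
    ∀ᵐ ω ∂P, A ω ≠ ⊥ → ∃ n, (Z n ω : EReal) = A ω ∨ (Z n ω : EReal) = B ω := by
  -- The bad event: although A ≥ -m, every stage n ≥ m ends at its artificial upper cutoff n + N₀ <
  -- B. For these n the lower cutoff is inactive.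
  have hbadm : ∀ m : ℕ, ∀ᵐ ω ∂P, ¬ ∀ n : ℕ, m ≤ n → ω ∈ {ω | ((-(m : ℝ) : ℝ) : EReal) ≤ A ω ∧
      (((n + N₀ : ℕ) : ℝ) : EReal) < B ω} ∩ {ω | Z n ω = ((n + N₀ : ℕ) : ℝ)} := by
    intro m
    have hbound : ∀ n : ℕ, m ≤ n → P.real ({ω | ((-(m : ℝ) : ℝ) : EReal) ≤ A ω ∧
        (((n + N₀ : ℕ) : ℝ) : EReal) < B ω} ∩ {ω | Z n ω = ((n + N₀ : ℕ) : ℝ)}) * n ≤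
          |x| + m := by
      intro n hmn
      set D := {ω | ((-(m : ℝ) : ℝ) : EReal) ≤ A ω ∧ (((n + N₀ : ℕ) : ℝ) : EReal) < B ω} with hD
      set W := {ω | Z n ω = ((n + N₀ : ℕ) : ℝ)} with hW
      have hDm : MeasurableSet[𝓕 0] D :=
        (measurableSet_le measurable_const hA).inter (measurableSet_lt measurable_const hB)
      have hDm' : MeasurableSet D := 𝓕.le 0 _ hDm
      have hWm : MeasurableSet W := hZm n (measurableSet_singleton _)
      have hED := hE n (D.indicator fun _ => 1) 1 (stronglyMeasurable_const.indicator hDm)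
        (fun ω => (norm_indicator_le_norm_self _ _).trans (by simp))
      rw [integral_indicator hDm', setIntegral_const, smul_eq_mul, mul_one] at hED
      have hmN : (m : ℝ) ≤ ((n + N₀ : ℕ) : ℝ) := by exact_mod_cast hmn.trans (Nat.le_add_right _ _)
      -- On D the variable is n + N₀ on W and at least -m elsewhere, while its mean over D is x
      -- P(D). This bounds n P(D ∩ W) by |x| + m, so the probability of ending at the cutoff is of
      -- order 1/n.
      have hpt : ∀ᵐ ω ∂P, (D ∩ W).indicator (fun _ => (((n + N₀ : ℕ) : ℝ) + m)) ω +
          D.indicator (fun _ => -(m : ℝ)) ω ≤ D.indicator (fun _ => (1 : ℝ)) ω * Z n ω := by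
        filter_upwards [hZ n] with ω hω
        by_cases hωD : ω ∈ D
        · rw [Set.indicator_of_mem hωD, Set.indicator_of_mem hωD, one_mul]
          by_cases hωW : ω ∈ W
          · rw [Set.indicator_of_mem (show ω ∈ D ∩ W from ⟨hωD, hωW⟩), show Z n ω = _ from hωW]
            linarith
          · rw [Set.indicator_of_notMem fun h => hωW h.2, zero_add]
            rcases hω with h | h
            · exact EReal.coe_le_coe_iff.1 (h ▸ hωD.1.trans (le_max_left _ _))
            · rw [min_eq_right hωD.2.le] at h
              exact absurd (EReal.coe_eq_coe_iff.1 h) hωW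
        · rw [Set.indicator_of_notMem hωD, Set.indicator_of_notMem hωD,
            Set.indicator_of_notMem fun h => hωD h.1]
          simp
      have hZb : ∀ᵐ ω ∂P, ‖D.indicator (fun _ => (1 : ℝ)) ω * Z n ω‖ ≤ ((n + N₀ : ℕ) : ℝ) := by
        filter_upwards [hZ n] with ω hω
        by_cases hωD : ω ∈ D
        · rw [Set.indicator_of_mem hωD, one_mul, Real.norm_eq_abs, abs_le]
          have hxl := abs_le.1 hN₀
          have hN1 : (N₀ : ℝ) ≤ ((n + N₀ : ℕ) : ℝ) := by exact_mod_cast Nat.le_add_left _ _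
          have hn0 : (0 : ℝ) ≤ ((n + N₀ : ℕ) : ℝ) := Nat.cast_nonneg _
          rcases hω with h | h
          · constructor
            · exact EReal.coe_le_coe_iff.1 (h ▸ le_max_right _ _)
            · refine EReal.coe_le_coe_iff.1 (h ▸ max_le ((hAx ω).trans ?_) ?_)
              · exact EReal.coe_le_coe_iff.2 (hxl.2.trans hN1)
              · exact EReal.coe_le_coe_iff.2 (by linarith)
          · rw [min_eq_right hωD.2.le] at h
            rw [EReal.coe_eq_coe_iff.1 h]
            constructor <;> linarith
        · rw [Set.indicator_of_notMem hωD, zero_mul, norm_zero]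
          exact Nat.cast_nonneg _
      have hI1 : Integrable ((D ∩ W).indicator (fun _ => (((n + N₀ : ℕ) : ℝ) + m))) P :=
        (integrable_const _).indicator (hDm'.inter hWm)
      have hI2 : Integrable (D.indicator (fun _ => -(m : ℝ))) P := (integrable_const _).indicator hDm'
      have hI3 : Integrable (fun ω => D.indicator (fun _ => (1 : ℝ)) ω * Z n ω) P :=
        Integrable.of_bound ((stronglyMeasurable_const.indicator hDm').aestronglyMeasurable.mul
          (hZm n).aestronglyMeasurable) _ hZb
      have hint := integral_mono_ae (hI1.add hI2) hI3 hpt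
      simp only [Pi.add_apply] at hint
      rw [integral_add hI1 hI2, integral_indicator (hDm'.inter hWm), integral_indicator hDm',
        setIntegral_const, setIntegral_const, hED, smul_eq_mul, smul_eq_mul] at hint
      have hPD : P.real D ≤ 1 := measureReal_le_one
      have hPD0 : 0 ≤ P.real D := measureReal_nonneg
      have hPW0 : 0 ≤ P.real (D ∩ W) := measureReal_nonneg
      have hm0 : (0 : ℝ) ≤ m := Nat.cast_nonneg _
      have hN2 : (n : ℝ) ≤ ((n + N₀ : ℕ) : ℝ) := by exact_mod_cast Nat.le_add_right _ _
      have hfin : P.real (D ∩ W) * n ≤ |x| + m := by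
        have e1 : P.real (D ∩ W) * n ≤ P.real (D ∩ W) * (((n + N₀ : ℕ) : ℝ) + m) :=
          mul_le_mul_of_nonneg_left (by linarith) hPW0
        have e2 : (x + m) * P.real D ≤ (|x| + m) * 1 :=
          (mul_le_mul_of_nonneg_right (by linarith [le_abs_self x]) hPD0).trans
            (mul_le_mul_of_nonneg_left hPD (by positivity))
        nlinarith
      exact hfin
    suffices h0 : P {ω | ∀ n : ℕ, m ≤ n →
        ω ∈ {ω | ((-(m : ℝ) : ℝ) : EReal) ≤ A ω ∧ (((n + N₀ : ℕ) : ℝ) : EReal) < B ω} ∩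
          {ω | Z n ω = ((n + N₀ : ℕ) : ℝ)}} = 0 from measure_eq_zero_iff_ae_notMem.1 h0
    refine (measureReal_eq_zero_iff).1 (le_antisymm ?_ measureReal_nonneg)
    by_contra! hpos
    obtain ⟨k, hk⟩ := exists_nat_gt ((|x| + m) / P.real {ω | ∀ n : ℕ, m ≤ n →
      ω ∈ {ω | ((-(m : ℝ) : ℝ) : EReal) ≤ A ω ∧ (((n + N₀ : ℕ) : ℝ) : EReal) < B ω} ∩
        {ω | Z n ω = ((n + N₀ : ℕ) : ℝ)}})
    have hb := hbound (max m k) (le_max_left _ _)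
    rw [div_lt_iff₀ hpos, mul_comm] at hk
    refine absurd hb (not_le.2 (hk.trans_le (mul_le_mul (measureReal_mono ?_) ?_ (by positivity)
      measureReal_nonneg)))
    · exact fun ω (hω : ∀ n : ℕ, m ≤ n → _) => hω (max m k) (le_max_left _ _)
    · exact_mod_cast le_max_right _ _
  filter_upwards [ae_all_iff.2 hbadm, ae_all_iff.2 hZ] with ω h1 h2 hbot
  obtain ⟨m, hm⟩ : ∃ m : ℕ, ((-(m : ℝ) : ℝ) : EReal) ≤ A ω := by
    obtain ⟨r, -, hr⟩ := EReal.lt_iff_exists_real_btwn.1 (bot_lt_iff_ne_bot.2 hbot)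
    obtain ⟨m, hm⟩ := exists_nat_gt (-r)
    exact ⟨m, (EReal.coe_le_coe_iff.2 (by linarith)).trans hr.le⟩
  have h3 := h1 m
  push Not at h3
  obtain ⟨n, hmn, hn⟩ := h3
  refine ⟨n, ?_⟩
  rcases h2 n with h | h
  · left
    rw [h]
    refine max_eq_left (le_trans (EReal.coe_le_coe_iff.2 (neg_le_neg ?_)) hm)
    exact_mod_cast hmn.trans (Nat.le_add_right _ _)
  · right
    by_cases hlt : (((n + N₀ : ℕ) : ℝ) : EReal) < B ω
    · rw [min_eq_right hlt.le] at h
      exact absurd ⟨⟨hm, hlt⟩, EReal.coe_eq_coe_iff.1 h⟩ hn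
    · rw [h]
      exact min_eq_left (not_lt.1 hlt)

/-- Exit from a random interval chosen at time `0`. -/
theorem IsContLocalMartingale.exists_exit (hX : IsContLocalMartingale P 𝓕 X x) {J : Set ℝ}
    (hesc : ∀ᵐ ω ∂P, ∀ L : ℝ, (∃ p ∈ J, p < L) → (∃ q ∈ J, L < q) →
      ¬ Tendsto (fun t => X t ω) atTop (𝓝 L))
    {Θ : Ω → EReal × EReal} (hΘm : Measurable[𝓕 0] Θ)
    (h2 : ∀ ω, (Θ ω).1 ≤ x) (h3 : ∀ ω, x ≤ (Θ ω).2)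
    (hJ1 : ∀ ω, ∀ z : ℝ, (Θ ω).1 < z → ∃ p ∈ J, p < z)
    (hJ2 : ∀ ω, ∀ z : ℝ, z < (Θ ω).2 → ∃ q ∈ J, z < q)
    (hne : ∀ᵐ ω ∂P, (Θ ω).1 ≠ ⊥ ∨ (Θ ω).2 ≠ ⊤) :
    ∃ Z, IsStoppedLimit P X (exitTime X Θ) Z ∧
      (∀ᵐ ω ∂P, (Z ω : EReal) = (Θ ω).1 ∨ (Z ω : EReal) = (Θ ω).2) ∧
      ∀ (n : ℕ) (G : Ω → ℝ) (D : ℝ), StronglyMeasurable[𝓕 0] G → (∀ ω, ‖G ω‖ ≤ D) →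
        (∀ ω, G ω ≠ 0 → ((-(n : ℝ) : ℝ) : EReal) ≤ (Θ ω).1 ∧ (Θ ω).2 ≤ (n : ℝ)) →
        ∫ ω, G ω * Z ω ∂P = x * ∫ ω, G ω ∂P := by
  obtain ⟨N₀, hN₀⟩ := exists_nat_ge |x|
  have hxl := abs_le.1 hN₀
  -- Since `N₀` is at least |x|, truncation at ±(n + N₀) keeps x between the thresholds for every n.
  set Θn : ℕ → Ω → EReal × EReal := fun n ω => (max (Θ ω).1 ((-((n + N₀ : ℕ) : ℝ) : ℝ) : EReal),
    min (Θ ω).2 (((n + N₀ : ℕ) : ℝ) : EReal)) with hΘn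
  have hcast : ∀ n : ℕ, (N₀ : ℝ) ≤ ((n + N₀ : ℕ) : ℝ) := fun n => by
    exact_mod_cast Nat.le_add_left _ _
  have hex : ∀ n, ∃ Z, IsStoppedLimit P X (exitTime X (Θn n)) Z ∧
      (∀ᵐ ω ∂P, (Z ω : EReal) = (Θn n ω).1 ∨ (Z ω : EReal) = (Θn n ω).2) ∧
      ∀ (G : Ω → ℝ) (D : ℝ), StronglyMeasurable[𝓕 0] G → (∀ ω, ‖G ω‖ ≤ D) →
        ∫ ω, G ω * Z ω ∂P = x * ∫ ω, G ω ∂P := by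
    intro n
    refine hX.exists_exit_of_bounded hesc (n := ((n + N₀ : ℕ) : ℝ)) ?_ (fun ω => le_max_right _ _)
      (fun ω => max_le (h2 ω) ?_) (fun ω => le_min (h3 ω) ?_) (fun ω => min_le_right _ _)
      (fun ω z hz => hJ1 ω z ((le_max_left _ _).trans_lt hz))
      (fun ω z hz => hJ2 ω z (hz.trans_le (min_le_left _ _)))
    · exact (hΘm.fst.max measurable_const).prodMk (hΘm.snd.min measurable_const)
    · exact EReal.coe_le_coe_iff.2 (by linarith [hcast n])
    · exact EReal.coe_le_coe_iff.2 (by linarith [hcast n])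
  choose Zn hZn hZnΘ hZnE using hex
  have hex1 := ae_exists_eq_of_truncated (x := x) hΘm.fst hΘm.snd (fun n => (hZn n).1) hZnΘ hZnE
    h2 hN₀
  -- The reflected statement covers a lower threshold `⊥` with finite upper threshold.
  have hex2 := ae_exists_eq_of_truncated (P := P) (𝓕 := 𝓕) (x := -x) (A := fun ω => -(Θ ω).2)
    (B := fun ω => -(Θ ω).1) (N₀ := N₀) (Z := fun n ω => - Zn n ω) hΘm.snd.neg hΘm.fst.neg
    (fun n => (hZn n).1.neg) (fun n => by
      filter_upwards [hZnΘ n] with ω hω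
      rcases hω with h | h
      · right
        rw [EReal.coe_neg, h, hΘn, EReal.neg_strictAnti.antitone.map_max, EReal.coe_neg, neg_neg]
      · left
        rw [EReal.coe_neg, h, hΘn, EReal.neg_strictAnti.antitone.map_min, EReal.coe_neg])
    (fun n G D hG hGD => by
      have := hZnE n G D hG hGD
      simp only [mul_neg, integral_neg, this, neg_mul])
    (fun ω => by rw [EReal.coe_neg]; exact EReal.neg_le_neg_iff.2 (h3 ω)) (by rwa [abs_neg])
  have hsub : ∀ n ω, Set.Ioo (Θn n ω).1 (Θn n ω).2 ⊆ Set.Ioo (Θ ω).1 (Θ ω).2 := fun n ω =>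
    Set.Ioo_subset_Ioo (le_max_left _ _) (min_le_left _ _)
  have hgood : ∀ᵐ ω ∂P, ∃ n, ((Zn n ω : EReal) = (Θ ω).1 ∨ (Zn n ω : EReal) = (Θ ω).2) ∧
      Tendsto (fun t => stoppedProcess X (exitTime X Θ) t ω) atTop (𝓝 (Zn n ω)) := by
    filter_upwards [hex1, hex2, hne, ae_all_iff.2 fun n => (hZn n).2] with ω e1 e2 e3 e4
    obtain ⟨n, hn⟩ : ∃ n, (Zn n ω : EReal) = (Θ ω).1 ∨ (Zn n ω : EReal) = (Θ ω).2 := by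
      rcases e3 with h | h
      · exact e1 h
      · obtain ⟨n, hn⟩ := e2 (by simpa using h)
        refine ⟨n, ?_⟩
        simp only [EReal.coe_neg, neg_inj] at hn
        exact hn.symm
    refine ⟨n, hn, ?_⟩
    have hst : exitTime X Θ ω = exitTime X (Θn n) ω := by
      refine exitTime_eq_of_tendsto (hsub n ω) (e4 n) ?_
      rcases hn with h | h <;> rw [h] <;> simp
    simpa only [stoppedProcess, hst] using e4 n
  have hσ : IsStoppingTime 𝓕 (exitTime X Θ) :=
    isStoppingTime_exitTime hX.continuous_path (fun t => (hX.adapted t).measurable) hΘm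
  obtain ⟨Z, hZ⟩ := hX.exists_isStoppedLimit hσ (by
    filter_upwards [hgood] with ω ⟨n, _, h⟩ using ⟨_, h⟩)
  refine ⟨Z, hZ, ?_, fun n G D hG hGD hsupp => ?_⟩
  · filter_upwards [hgood, hZ.2] with ω ⟨n, h, ht⟩ hω
    rwa [tendsto_nhds_unique hω ht]
  · rw [← hZnE n G D hG hGD]
    refine integral_congr_ae ?_
    filter_upwards [hZ.2, (hZn n).2] with ω h1 h4
    by_cases hG0 : G ω = 0
    · simp [hG0]
    · obtain ⟨h5, h6⟩ := hsupp ω hG0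
      have hnN : (n : ℝ) ≤ ((n + N₀ : ℕ) : ℝ) := by exact_mod_cast Nat.le_add_right _ _
      -- Where G is nonzero both thresholds lie within ±n, so stage n is not truncated at all and
      -- its mean identity is the one wanted.
      have hΘeq : Θn n ω = Θ ω := by
        refine Prod.ext (max_eq_left (le_trans ?_ h5)) (min_eq_left (h6.trans ?_))
        · exact EReal.coe_le_coe_iff.2 (by linarith)
        · exact EReal.coe_le_coe_iff.2 hnN
      have hst : exitTime X (Θn n) ω = exitTime X Θ ω := by simp only [exitTime, hΘeq]
      simp only [stoppedProcess, hst] at h4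
      rw [tendsto_nhds_unique h1 h4]

end Thresholds

/-! ### Exit probabilities -/

section UpperLaw

variable {Ω : Type*} [mΩ : MeasurableSpace Ω] {P : Measure Ω} [IsProbabilityMeasure P]
  {𝓕 : Filtration ℝ≥0 mΩ} {x : ℝ}

lemma measurableSet_coe_image {C : Set ℝ} (hC : MeasurableSet C) :
    MeasurableSet (Real.toEReal '' C) :=
  EReal.isOpenEmbedding_coe.measurableEmbedding.measurableSet_image.2 hC

/-- The law above `x` of a fair two-valued variable with values in `{A, B}`. -/
lemma measure_preimage_of_subset_Ioi {A B : Ω → EReal} (hA : Measurable[𝓕 0] A)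
    (hB : Measurable[𝓕 0] B) {Z : Ω → ℝ} (hZm : Measurable Z)
    (hZ : ∀ᵐ ω ∂P, (Z ω : EReal) = A ω ∨ (Z ω : EReal) = B ω)
    (hE : ∀ (n : ℕ) (G : Ω → ℝ) (D : ℝ), StronglyMeasurable[𝓕 0] G → (∀ ω, ‖G ω‖ ≤ D) →
        (∀ ω, G ω ≠ 0 → ((-(n : ℝ) : ℝ) : EReal) ≤ A ω ∧ B ω ≤ (n : ℝ)) →
        ∫ ω, G ω * Z ω ∂P = x * ∫ ω, G ω ∂P)
    (hAx : ∀ ω, A ω ≤ x) {C : Set ℝ} (hC : MeasurableSet C) (hCx : C ⊆ Set.Ioi x) :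
    P (Z ⁻¹' C) = P {ω | A ω = ⊥ ∧ B ω ∈ Real.toEReal '' C} +
      ∫⁻ ω in {ω | A ω ≠ ⊥ ∧ B ω ∈ Real.toEReal '' C},
        ENNReal.ofReal ((x - (A ω).toReal) / ((B ω).toReal - (A ω).toReal)) ∂P := by
  have hCE := measurableSet_coe_image hC
  have hF := 𝓕.le 0
  have hA' := hA.mono hF le_rfl
  have hB' := hB.mono hF le_rfl
  set S₁ := {ω | A ω = ⊥ ∧ B ω ∈ Real.toEReal '' C} with hS₁
  set S₂ := {ω | A ω ≠ ⊥ ∧ B ω ∈ Real.toEReal '' C} with hS₂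
  have hS₁m : MeasurableSet S₁ := (hA' (measurableSet_singleton ⊥)).inter (hB' hCE)
  have hS₂m₀ : MeasurableSet[𝓕 0] S₂ :=
    (hA (measurableSet_singleton ⊥)).compl.inter (hB hCE)
  have hS₂m : MeasurableSet S₂ := hF _ hS₂m₀
  set W := {ω | (Z ω : EReal) = B ω}
  have hWm : MeasurableSet W :=
    measurableSet_eq_fun (measurable_coe_real_ereal.comp hZm) hB'
  set w : Ω → ℝ := fun ω => (x - (A ω).toReal) / ((B ω).toReal - (A ω).toReal) with hw
  have hBC : ∀ ω, B ω ∈ Real.toEReal '' C → x < (B ω).toReal ∧ ((B ω).toReal : EReal) = B ω := by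
    rintro ω ⟨b, hb, hbB⟩
    rw [← hbB]
    exact ⟨hCx hb, rfl⟩
  have hAr : ∀ ω, A ω ≠ ⊥ → ((A ω).toReal : EReal) = A ω := fun ω h =>
    EReal.coe_toReal ((hAx ω).trans_lt (EReal.coe_lt_top x)).ne h
  have hArx : ∀ ω, A ω ≠ ⊥ → (A ω).toReal ≤ x := fun ω h =>
    EReal.coe_le_coe_iff.1 ((hAr ω h).le.trans (hAx ω))
  have hsplit : P (Z ⁻¹' C) = P S₁ + P (S₂ ∩ W) := by
    rw [← measure_union (Set.disjoint_left.2 fun ω h1 h2 => h2.1.1 h1.1) (hS₂m.inter hWm)]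
    refine measure_congr ?_
    filter_upwards [hZ] with ω hω
    refine propext ⟨fun h => ?_, fun h => ?_⟩
    · have hZx : x < Z ω := hCx h
      have hne : (Z ω : EReal) ≠ A ω := fun h' =>
        absurd (h' ▸ hAx ω) (not_le.2 (EReal.coe_lt_coe_iff.2 hZx))
      have hZB := hω.resolve_left hne
      have hmem : B ω ∈ Real.toEReal '' C := ⟨Z ω, h, hZB⟩
      by_cases hb : A ω = ⊥
      · exact Or.inl ⟨hb, hmem⟩
      · exact Or.inr ⟨⟨hb, hmem⟩, hZB⟩
    · have key : (Z ω : EReal) = B ω → B ω ∈ Real.toEReal '' C → ω ∈ Z ⁻¹' C := by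
        rintro h1 ⟨b, hb, hbB⟩
        rw [← hbB] at h1
        rw [Set.mem_preimage, EReal.coe_eq_coe_iff.1 h1]
        exact hb
      rcases h with h | h
      · exact key (hω.resolve_left fun h' => by rw [h.1] at h'; exact EReal.coe_ne_bot _ h') h.2
      · exact key h.2 h.1.2
  rw [hsplit]
  congr 1
  -- On `E n` the thresholds are bounded and B - A is bounded away from 0, so 1 / (B - A) is an
  -- admissible weight in the mean identity. These sets increase to `S₂`.
  set E : ℕ → Set Ω := fun n => S₂ ∩ {ω | ((-((n + 1 : ℕ) : ℝ) : ℝ) : EReal) ≤ A ω ∧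
    B ω ≤ (((n + 1 : ℕ) : ℝ) : EReal) ∧ 1 / ((n + 1 : ℕ) : ℝ) ≤ (B ω).toReal - (A ω).toReal} with hEdef
  have hEm₀ : ∀ n, MeasurableSet[𝓕 0] (E n) := fun n =>
    hS₂m₀.inter ((measurableSet_le measurable_const hA).inter
      ((measurableSet_le hB measurable_const).inter
        (measurableSet_le measurable_const (hB.ereal_toReal.sub hA.ereal_toReal))))
  have hEm : ∀ n, MeasurableSet (E n) := fun n => hF _ (hEm₀ n)
  have hEmono : Monotone E := by
    rintro i j hij ω ⟨h1, h2, h3, h4⟩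
    have hij' : ((i + 1 : ℕ) : ℝ) ≤ ((j + 1 : ℕ) : ℝ) := by exact_mod_cast Nat.succ_le_succ hij
    refine ⟨h1, le_trans (EReal.coe_le_coe_iff.2 (neg_le_neg hij')) h2,
      h3.trans (EReal.coe_le_coe_iff.2 hij'), le_trans ?_ h4⟩
    exact one_div_le_one_div_of_le (by positivity) hij'
  have hEU : ⋃ n, E n = S₂ := by
    refine Set.Subset.antisymm (Set.iUnion_subset fun n => Set.inter_subset_left) fun ω hω => ?_
    obtain ⟨hb1, hb2⟩ := hBC ω hω.2
    have ha1 := hArx ω hω.1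
    have ha2 := hAr ω hω.1
    obtain ⟨n, hn⟩ := exists_nat_gt (max (-(A ω).toReal) (max (B ω).toReal
      (1 / ((B ω).toReal - (A ω).toReal))))
    simp only [max_lt_iff] at hn
    have hn1 : (n : ℝ) ≤ ((n + 1 : ℕ) : ℝ) := by exact_mod_cast Nat.le_succ n
    refine Set.mem_iUnion.2 ⟨n, hω, ?_, ?_, ?_⟩
    · rw [← ha2]
      exact EReal.coe_le_coe_iff.2 (by linarith)
    · rw [← hb2]
      exact EReal.coe_le_coe_iff.2 (by linarith)
    · rw [one_div_le (by positivity) (by linarith)]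
      linarith
  have hwm : Measurable[𝓕 0] w := (hA.ereal_toReal.const_sub x).div
    (hB.ereal_toReal.sub hA.ereal_toReal)
  have hstep : ∀ n, P (E n ∩ W) = ∫⁻ ω in E n, ENNReal.ofReal (w ω) ∂P := by
    intro n
    have hwb : ∀ ω ∈ E n, 0 ≤ w ω ∧ w ω ≤ 1 := by
      intro ω hω
      have hb1 := (hBC ω hω.1.2).1
      have ha1 := hArx ω hω.1.1
      refine ⟨div_nonneg (by linarith) (by linarith), ?_⟩
      rw [hw, div_le_one (by linarith)]
      linarith
    set G : Ω → ℝ := (E n).indicator fun ω => 1 / ((B ω).toReal - (A ω).toReal) with hG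
    have hGm : StronglyMeasurable[𝓕 0] G :=
      ((measurable_const.div (hB.ereal_toReal.sub hA.ereal_toReal)).indicator
        (hEm₀ n)).stronglyMeasurable
    have hGb : ∀ ω, ‖G ω‖ ≤ ((n + 1 : ℕ) : ℝ) := by
      intro ω
      by_cases hω : ω ∈ E n
      · have hp : (0 : ℝ) < 1 / ((n + 1 : ℕ) : ℝ) := by positivity
        have h4 := hω.2.2.2
        rw [hG, Set.indicator_of_mem hω, Real.norm_eq_abs, abs_of_nonneg (by
          exact one_div_nonneg.2 (hp.le.trans h4)), one_div_le (hp.trans_le h4) (by positivity)]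
        exact h4
      · rw [hG, Set.indicator_of_notMem hω, norm_zero]
        positivity
    have hGE := hE (n + 1) G _ hGm hGb (fun ω h => by
      have hω : ω ∈ E n := by
        by_contra h'
        exact h (Set.indicator_of_notMem h' _)
      exact ⟨hω.2.1, hω.2.2.1⟩)
    have hGint : Integrable G P := Integrable.of_bound (hGm.mono hF).aestronglyMeasurable _
      (ae_of_all _ hGb)
    -- The indicator of Z = B is (Z - A) / (B - A) = (x - A) / (B - A) + (Z - x) / (B - A), and the
    -- last term has mean zero on `E n`.
    have hpt : ∀ᵐ ω ∂P, (E n ∩ W).indicator (fun _ => (1 : ℝ)) ω =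
        (E n).indicator w ω + (G ω * Z ω - x * G ω) := by
      filter_upwards [hZ] with ω hω
      by_cases hωE : ω ∈ E n
      · obtain ⟨hb1, hb2⟩ := hBC ω hωE.1.2
        have ha1 := hArx ω hωE.1.1
        have ha2 := hAr ω hωE.1.1
        have hne : (B ω).toReal - (A ω).toReal ≠ 0 := by
          intro h
          linarith
        rw [hG, Set.indicator_of_mem hωE, Set.indicator_of_mem hωE]
        by_cases hωW : ω ∈ W
        · have hz : Z ω = (B ω).toReal := EReal.coe_eq_coe_iff.1 ((show (Z ω : EReal) = B ω from
            hωW).trans hb2.symm)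
          rw [Set.indicator_of_mem (show ω ∈ E n ∩ W from ⟨hωE, hωW⟩), hz, hw]
          field_simp
          ring
        · have hz : Z ω = (A ω).toReal := EReal.coe_eq_coe_iff.1
            ((hω.resolve_right hωW).trans ha2.symm)
          rw [Set.indicator_of_notMem (fun h : ω ∈ E n ∩ W => hωW h.2), hz, hw]
          field_simp
          ring
      · rw [hG, Set.indicator_of_notMem hωE, Set.indicator_of_notMem hωE,
          Set.indicator_of_notMem (fun h : ω ∈ E n ∩ W => hωE h.1)]
        ring
    have hwint : Integrable ((E n).indicator w) P := by
      refine Integrable.of_bound ((hwm.mono hF le_rfl).indicator (hEm n)).aestronglyMeasurable 1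
        (ae_of_all _ fun ω => ?_)
      by_cases hω : ω ∈ E n
      · rw [Set.indicator_of_mem hω, Real.norm_eq_abs, abs_of_nonneg (hwb ω hω).1]
        exact (hwb ω hω).2
      · rw [Set.indicator_of_notMem hω, norm_zero]
        exact zero_le_one
    have hind : Integrable ((E n ∩ W).indicator fun _ => (1 : ℝ)) P :=
      (integrable_const _).indicator ((hEm n).inter hWm)
    have hGZ : Integrable (fun ω => G ω * Z ω - x * G ω) P := by
      refine (hind.sub hwint).congr ?_
      filter_upwards [hpt] with ω hω
      rw [Pi.sub_apply, hω]
      ring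
    have hGZ' : Integrable (fun ω => G ω * Z ω) P := by
      refine (hGZ.add (hGint.const_mul x)).congr (ae_of_all _ fun ω => ?_)
      simp
    have hI := integral_congr_ae hpt
    rw [integral_indicator ((hEm n).inter hWm), setIntegral_const, smul_eq_mul, mul_one,
      integral_add hwint hGZ, integral_sub hGZ' (hGint.const_mul x), integral_const_mul, hGE,
      sub_self, add_zero, integral_indicator (hEm n)] at hI
    rw [← ofReal_measureReal, hI, ofReal_integral_eq_lintegral_ofReal
      ((integrable_indicator_iff (hEm n)).1 hwint)]
    filter_upwards [ae_restrict_mem (hEm n)] with ω hω using (hwb ω hω).1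
  have hmono' : Monotone fun n => E n ∩ W := fun i j h => Set.inter_subset_inter_left _ (hEmono h)
  have hl1 := tendsto_measure_iUnion_atTop (μ := P) hmono'
  have hl2 := tendsto_measure_iUnion_atTop
    (μ := P.withDensity fun ω => ENNReal.ofReal (w ω)) hEmono
  rw [← Set.iUnion_inter, hEU] at hl1
  rw [hEU, withDensity_apply _ hS₂m] at hl2
  refine tendsto_nhds_unique hl1 (hl2.congr fun n => ?_)
  rw [Function.comp_apply, withDensity_apply _ (hEm n), Function.comp_apply, hstep]

end UpperLaw

/-! ### The law of the thresholds and the law at the exit -/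

section MixLaw

/-- Mixture of the laws of pairs of thresholds `(a, b)`, `(a, ∞)`, `(-∞, b)` and `(x, x)` where
`a < x` and `b > x` are distributed according to the measure `ν`. -/
def mixLaw (ν : Measure ℝ) (x : ℝ) (k c₁ c₂ : ℝ≥0∞) : Measure (EReal × EReal) :=
  k • (((ν.restrict (Set.Iio x)).prod (ν.restrict (Set.Ioi x))).withDensity
      fun p => ENNReal.ofReal (p.2 - p.1)).map (fun p => ((p.1 : EReal), (p.2 : EReal))) +
    c₁ • (ν.restrict (Set.Iio x)).map (fun a : ℝ => ((a : EReal), (⊤ : EReal))) +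
    c₂ • (ν.restrict (Set.Ioi x)).map (fun b : ℝ => ((⊥ : EReal), (b : EReal))) +
    ν {x} • Measure.dirac ((x : EReal), (x : EReal))

variable {ν : Measure ℝ} [IsProbabilityMeasure ν] {x : ℝ} {k c₁ c₂ : ℝ≥0∞}

lemma lintegral_mixLaw {φ : EReal × EReal → ℝ≥0∞} (hφ : Measurable φ) :
    ∫⁻ p, φ p ∂(mixLaw ν x k c₁ c₂) =
      k * ∫⁻ a in Set.Iio x, ∫⁻ b in Set.Ioi x, ENNReal.ofReal (b - a) * φ (a, b) ∂ν ∂ν +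
      c₁ * ∫⁻ a in Set.Iio x, φ (a, ⊤) ∂ν + c₂ * ∫⁻ b in Set.Ioi x, φ (⊥, b) ∂ν +
      ν {x} * φ (x, x) := by
  have hc := measurable_coe_real_ereal
  have hd : Measurable fun p : ℝ × ℝ => ENNReal.ofReal (p.2 - p.1) := by fun_prop
  have hp : Measurable fun p : ℝ × ℝ => ((p.1 : EReal), (p.2 : EReal)) :=
    (hc.comp measurable_fst).prodMk (hc.comp measurable_snd)
  have h : ∫⁻ p : ℝ × ℝ, φ (p.1, p.2) ∂(((ν.restrict (Set.Iio x)).prod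
      (ν.restrict (Set.Ioi x))).withDensity fun p => ENNReal.ofReal (p.2 - p.1)) =
      ∫⁻ a in Set.Iio x, ∫⁻ b in Set.Ioi x, ENNReal.ofReal (b - a) * φ (a, b) ∂ν ∂ν :=
    (lintegral_withDensity_eq_lintegral_mul _ hd (hφ.comp hp)).trans
      (lintegral_prod _ (hd.mul (hφ.comp hp)).aemeasurable)
  rw [mixLaw, lintegral_add_measure, lintegral_add_measure, lintegral_add_measure,
    lintegral_smul_measure, lintegral_smul_measure, lintegral_smul_measure, lintegral_smul_measure,
    lintegral_map hφ hp, lintegral_map hφ (hc.prodMk measurable_const),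
    lintegral_map hφ (measurable_const.prodMk hc), lintegral_dirac' _ hφ,
    h]
  rfl

/-- Reflection exchanges the roles of the two thresholds and of `c₁` and `c₂`, so that only laws
above x have to be computed. -/
lemma map_neg_mixLaw :
    (mixLaw ν x k c₁ c₂).map (fun p => (-p.2, -p.1)) =
      mixLaw (ν.map fun z => -z) (-x) k c₂ c₁ := by
  have hg : Measurable fun p : EReal × EReal => (-p.2, -p.1) :=
    measurable_snd.neg.prodMk measurable_fst.neg
  have : IsProbabilityMeasure (ν.map fun z => -z) :=
    Measure.isProbabilityMeasure_map measurable_neg.aemeasurable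
  have hc := measurable_coe_real_ereal
  refine Measure.ext_of_lintegral _ fun φ hφ => ?_
  have m : ∀ a : ℝ, Measurable fun b : ℝ => ENNReal.ofReal (b - a) * φ (a, b) := fun a =>
    (measurable_id.sub_const a).ennreal_ofReal.mul (hφ.comp (measurable_const.prodMk hc))
  have m' : Measurable fun p : ℝ × ℝ => ENNReal.ofReal (p.2 - p.1) * φ (p.1, p.2) :=
    (measurable_snd.sub measurable_fst).ennreal_ofReal.mul
      (hφ.comp ((hc.comp measurable_fst).prodMk (hc.comp measurable_snd)))
  have hp1 : (fun z : ℝ => -z) ⁻¹' Set.Iio (-x) = Set.Ioi x := by ext; simp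
  have hp2 : (fun z : ℝ => -z) ⁻¹' Set.Ioi (-x) = Set.Iio x := by ext; simp
  have n1 : ∀ f : ℝ → ℝ≥0∞, Measurable f →
      ∫⁻ z in Set.Iio (-x), f z ∂(ν.map fun z => -z) = ∫⁻ z in Set.Ioi x, f (-z) ∂ν := fun f hf => by
    rw [setLIntegral_map measurableSet_Iio hf measurable_neg, hp1]
  have n2 : ∀ f : ℝ → ℝ≥0∞, Measurable f →
      ∫⁻ z in Set.Ioi (-x), f z ∂(ν.map fun z => -z) = ∫⁻ z in Set.Iio x, f (-z) ∂ν := fun f hf => by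
    rw [setLIntegral_map measurableSet_Ioi hf measurable_neg, hp2]
  have hx : (ν.map fun z => -z) {-x} = ν {x} := by
    rw [Measure.map_apply measurable_neg (measurableSet_singleton _)]
    congr 1
    ext
    simp
  have hφg : Measurable fun p : EReal × EReal => φ (-p.2, -p.1) := hφ.comp hg
  rw [lintegral_map hφ hg, lintegral_mixLaw hφg, lintegral_mixLaw hφ,
    n1 _ m'.lintegral_prod_right', n1 (fun a => φ (a, ⊤)) (hφ.comp (hc.prodMk measurable_const)),
    n2 (fun b => φ (⊥, b)) (hφ.comp (measurable_const.prodMk hc)), hx]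
  simp only [n2 _ (m _)]
  rw [lintegral_lintegral_swap]
  · simp only [EReal.coe_neg, EReal.neg_top, EReal.neg_bot, neg_sub_neg]
    ring
  · have := m'.comp ((measurable_neg.comp measurable_snd).prodMk
      (measurable_neg.comp measurable_fst))
    simp only [Function.comp_def, neg_sub_neg, EReal.coe_neg] at this
    exact this.aemeasurable

/-- Writing b - a = (b - x) + (x - a) splits the double integral into U ν(-∞, x) + D ν(x, ∞). The
two normalizations then turn the total mass into that of ν. A side without ν-mass needs no
normalization. -/
lemma isProbabilityMeasure_mixLaw
    (h₁ : ν (Set.Iio x) ≠ 0 → k * ∫⁻ b in Set.Ioi x, ENNReal.ofReal (b - x) ∂ν + c₁ = 1)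
    (h₂ : ν (Set.Ioi x) ≠ 0 → k * ∫⁻ a in Set.Iio x, ENNReal.ofReal (x - a) ∂ν + c₂ = 1) :
    IsProbabilityMeasure (mixLaw ν x k c₁ c₂) := by
  have hU : Measurable fun b : ℝ => ENNReal.ofReal (b - x) := by fun_prop
  have hD : Measurable fun a : ℝ => ENNReal.ofReal (x - a) := by fun_prop
  have hint : ∫⁻ a in Set.Iio x, ∫⁻ b in Set.Ioi x, ENNReal.ofReal (b - a) ∂ν ∂ν =
      (∫⁻ b in Set.Ioi x, ENNReal.ofReal (b - x) ∂ν) * ν (Set.Iio x) +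
        (∫⁻ a in Set.Iio x, ENNReal.ofReal (x - a) ∂ν) * ν (Set.Ioi x) := by
    have h : ∀ a ∈ Set.Iio x, ∫⁻ b in Set.Ioi x, ENNReal.ofReal (b - a) ∂ν =
        ∫⁻ b in Set.Ioi x, ENNReal.ofReal (b - x) ∂ν + ENNReal.ofReal (x - a) * ν (Set.Ioi x) := by
      intro a ha
      rw [← setLIntegral_const, ← lintegral_add_left hU]
      refine setLIntegral_congr_fun measurableSet_Ioi fun b hb => ?_
      rw [← ENNReal.ofReal_add (sub_nonneg.2 (le_of_lt hb)) (sub_nonneg.2 (le_of_lt ha))]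
      congr 1
      ring
    rw [setLIntegral_congr_fun measurableSet_Iio h, lintegral_add_left measurable_const,
      setLIntegral_const, lintegral_mul_const _ hD]
  refine ⟨?_⟩
  rw [← lintegral_one, lintegral_mixLaw measurable_const]
  simp only [mul_one, setLIntegral_const, one_mul]
  rw [hint]
  have e1 : k * ((∫⁻ b in Set.Ioi x, ENNReal.ofReal (b - x) ∂ν) * ν (Set.Iio x)) +
      c₁ * ν (Set.Iio x) = ν (Set.Iio x) := by
    rw [← mul_assoc, ← add_mul]
    by_cases h : ν (Set.Iio x) = 0
    · simp [h]
    · rw [h₁ h, one_mul]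
  have e2 : k * ((∫⁻ a in Set.Iio x, ENNReal.ofReal (x - a) ∂ν) * ν (Set.Ioi x)) +
      c₂ * ν (Set.Ioi x) = ν (Set.Ioi x) := by
    rw [← mul_assoc, ← add_mul]
    by_cases h : ν (Set.Ioi x) = 0
    · simp [h]
    · rw [h₂ h, one_mul]
  have e3 : ν (Set.Iio x) + ν (Set.Ioi x) + ν {x} = 1 := by
    have hdis : Disjoint (Set.Iio x) (Set.Ioi x) := Set.disjoint_left.2 fun a h1 h2 =>
      lt_asymm (show a < x from h1) (show x < a from h2)
    rw [← measure_union hdis measurableSet_Ioi,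
      Set.Iio_union_Ioi, add_comm, measure_add_measure_compl (measurableSet_singleton x),
      measure_univ]
  rw [← e3]
  nth_rewrite 3 [← e1]
  nth_rewrite 3 [← e2]
  rw [mul_add]
  ring

/-- The atom at x needs no separate check: it is the mass that remains. -/
lemma eq_of_forall_subset_eq {μ ν : Measure ℝ} [IsProbabilityMeasure μ] [IsProbabilityMeasure ν]
    (h₁ : ∀ C, MeasurableSet C → C ⊆ Set.Iio x → μ C = ν C)
    (h₂ : ∀ C, MeasurableSet C → C ⊆ Set.Ioi x → μ C = ν C) : μ = ν := by
  have hsplit : ∀ (ρ : Measure ℝ) (C : Set ℝ), MeasurableSet C →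
      ρ C = ρ (C ∩ Set.Iio x) + ρ (C ∩ Set.Ioi x) + ρ (C ∩ {x}) := by
    intro ρ C hC
    rw [← measure_union (Set.disjoint_left.2 fun a h1 h2 =>
        lt_asymm (show a < x from h1.2) (show x < a from h2.2))
      (hC.inter measurableSet_Ioi), ← Set.inter_union_distrib_left, Set.Iio_union_Ioi, add_comm,
      ← Set.sdiff_eq, measure_inter_add_sdiff _ (measurableSet_singleton x)]
  have hx : μ {x} = ν {x} := by
    have h : ∀ (ρ : Measure ℝ) [IsProbabilityMeasure ρ],
        ρ {x} = 1 - (ρ (Set.Iio x) + ρ (Set.Ioi x)) := by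
      intro ρ _
      have := hsplit ρ Set.univ MeasurableSet.univ
      simp only [Set.univ_inter, measure_univ] at this
      rw [this, ENNReal.add_sub_cancel_left (ENNReal.add_ne_top.2 ⟨measure_ne_top _ _,
        measure_ne_top _ _⟩)]
    rw [h μ, h ν, h₁ _ measurableSet_Iio subset_rfl, h₂ _ measurableSet_Ioi subset_rfl]
  ext C hC
  rw [hsplit μ C hC, hsplit ν C hC, h₁ _ (hC.inter measurableSet_Iio) Set.inter_subset_right,
    h₂ _ (hC.inter measurableSet_Ioi) Set.inter_subset_right]
  congr 1
  by_cases hxC : x ∈ C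
  · rw [Set.inter_eq_right.2 (Set.singleton_subset_iff.2 hxC), hx]
  · rw [Set.inter_singleton_eq_empty.2 hxC, measure_empty, measure_empty]

/-- The density b - a cancels the denominator of the exit probability (x - a) / (b - a). Finite
pairs contribute k D ν(C) and pairs with lower end `⊥` contribute c₂ ν(C), while the other
components do not charge C. -/
lemma measure_preimage_eq_of_map_eq_mixLaw {Ω : Type*} [mΩ : MeasurableSpace Ω] {P : Measure Ω}
    [IsProbabilityMeasure P] {𝓕 : Filtration ℝ≥0 mΩ} {Θ : Ω → EReal × EReal}
    (hΘm : Measurable[𝓕 0] Θ) {Z : Ω → ℝ} (hZm : Measurable Z)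
    (hZ : ∀ᵐ ω ∂P, (Z ω : EReal) = (Θ ω).1 ∨ (Z ω : EReal) = (Θ ω).2)
    (hE : ∀ (n : ℕ) (G : Ω → ℝ) (D : ℝ), StronglyMeasurable[𝓕 0] G → (∀ ω, ‖G ω‖ ≤ D) →
        (∀ ω, G ω ≠ 0 → ((-(n : ℝ) : ℝ) : EReal) ≤ (Θ ω).1 ∧ (Θ ω).2 ≤ (n : ℝ)) →
        ∫ ω, G ω * Z ω ∂P = x * ∫ ω, G ω ∂P)
    (hx1 : ∀ ω, (Θ ω).1 ≤ x) (hΘ : P.map Θ = mixLaw ν x k c₁ c₂)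
    (h₂ : ν (Set.Ioi x) ≠ 0 → k * ∫⁻ a in Set.Iio x, ENNReal.ofReal (x - a) ∂ν + c₂ = 1)
    {C : Set ℝ} (hC : MeasurableSet C) (hCx : C ⊆ Set.Ioi x) : P (Z ⁻¹' C) = ν C := by
  have hΘm' : Measurable Θ := hΘm.mono (𝓕.le 0) le_rfl
  have hfr1 : Measurable fun p : EReal × EReal =>
      ENNReal.ofReal ((x - p.1.toReal) / (p.2.toReal - p.1.toReal)) :=
    ((measurable_fst.ereal_toReal.const_sub x).div
      (measurable_snd.ereal_toReal.sub measurable_fst.ereal_toReal)).ennreal_ofReal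
  have hCE := measurableSet_coe_image hC
  rw [measure_preimage_of_subset_Ioi hΘm.fst hΘm.snd hZm hZ hE hx1 hC hCx]
  set S₁ : Set (EReal × EReal) := {p | p.1 = ⊥ ∧ p.2 ∈ Real.toEReal '' C}
  set S₂ : Set (EReal × EReal) := {p | p.1 ≠ ⊥ ∧ p.2 ∈ Real.toEReal '' C}
  have hS₁ : MeasurableSet S₁ :=
    (measurable_fst (measurableSet_singleton ⊥)).inter (measurable_snd hCE)
  have hS₂ : MeasurableSet S₂ :=
    (measurable_fst (measurableSet_singleton ⊥)).compl.inter (measurable_snd hCE)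
  have e1 : P {ω | (Θ ω).1 = ⊥ ∧ (Θ ω).2 ∈ Real.toEReal '' C} = c₂ * ν C := by
    have : P {ω | (Θ ω).1 = ⊥ ∧ (Θ ω).2 ∈ Real.toEReal '' C} = P.map Θ S₁ :=
      (Measure.map_apply hΘm' hS₁).symm
    rw [this, hΘ, ← lintegral_indicator_one hS₁,
      lintegral_mixLaw (measurable_one.indicator hS₁)]
    have i1 : ∀ a b : ℝ, S₁.indicator (1 : EReal × EReal → ℝ≥0∞) (a, b) = 0 := fun a b =>
      Set.indicator_of_notMem (fun h => EReal.coe_ne_bot _ h.1) _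
    have i2 : ∀ a : ℝ, S₁.indicator (1 : EReal × EReal → ℝ≥0∞) (a, ⊤) = 0 := fun a =>
      Set.indicator_of_notMem (fun h => EReal.coe_ne_bot _ h.1) _
    have i3 : ∀ b : ℝ, S₁.indicator (1 : EReal × EReal → ℝ≥0∞) (⊥, b) = C.indicator 1 b := by
      intro b
      by_cases hb : b ∈ C
      · rw [Set.indicator_of_mem hb, Set.indicator_of_mem
          (show ((⊥ : EReal), (b : EReal)) ∈ S₁ from ⟨rfl, b, hb, rfl⟩)]
        rfl
      · rw [Set.indicator_of_notMem hb, Set.indicator_of_notMem]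
        rintro ⟨-, b', hb', h⟩
        exact hb (EReal.coe_eq_coe_iff.1 h ▸ hb')
    simp only [i1, i2, i3, mul_zero, lintegral_zero, zero_add, add_zero]
    rw [lintegral_indicator_one hC, Measure.restrict_apply hC, Set.inter_eq_left.2 hCx]
  have e2 : ∫⁻ ω in {ω | (Θ ω).1 ≠ ⊥ ∧ (Θ ω).2 ∈ Real.toEReal '' C},
      ENNReal.ofReal ((x - (Θ ω).1.toReal) / ((Θ ω).2.toReal - (Θ ω).1.toReal)) ∂P =
        k * (∫⁻ a in Set.Iio x, ENNReal.ofReal (x - a) ∂ν) * ν C := by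
    have : ∫⁻ ω in {ω | (Θ ω).1 ≠ ⊥ ∧ (Θ ω).2 ∈ Real.toEReal '' C},
        ENNReal.ofReal ((x - (Θ ω).1.toReal) / ((Θ ω).2.toReal - (Θ ω).1.toReal)) ∂P =
        ∫⁻ p in S₂, ENNReal.ofReal ((x - p.1.toReal) / (p.2.toReal - p.1.toReal)) ∂(P.map Θ) :=
      (setLIntegral_map hS₂ hfr1 hΘm').symm
    rw [this, hΘ, ← lintegral_indicator hS₂, lintegral_mixLaw (hfr1.indicator hS₂)]
    have i1 : ∀ a ∈ Set.Iio x, ∫⁻ b in Set.Ioi x, ENNReal.ofReal (b - a) * S₂.indicator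
        (fun p => ENNReal.ofReal ((x - p.1.toReal) / (p.2.toReal - p.1.toReal))) (a, b) ∂ν =
        ENNReal.ofReal (x - a) * ν C := by
      intro a ha
      have : ∀ b ∈ Set.Ioi x, ENNReal.ofReal (b - a) * S₂.indicator
        (fun p => ENNReal.ofReal ((x - p.1.toReal) / (p.2.toReal - p.1.toReal))) (a, b) =
        ENNReal.ofReal (x - a) * C.indicator 1 b := by
        intro b hb
        have hab : 0 < b - a := sub_pos.2 (lt_trans ha hb)
        by_cases hbC : b ∈ C
        · rw [Set.indicator_of_mem hbC, Set.indicator_of_mem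
            (show ((a : EReal), (b : EReal)) ∈ S₂ from ⟨EReal.coe_ne_bot _, b, hbC, rfl⟩),
            EReal.toReal_coe, EReal.toReal_coe, ← ENNReal.ofReal_mul hab.le,
            mul_div_cancel₀ _ hab.ne', Pi.one_apply, mul_one]
        · rw [Set.indicator_of_notMem hbC, Set.indicator_of_notMem, mul_zero, mul_zero]
          rintro ⟨-, b', hb', h⟩
          exact hbC (EReal.coe_eq_coe_iff.1 h ▸ hb')
      rw [setLIntegral_congr_fun measurableSet_Ioi this,
        lintegral_const_mul _ (measurable_one.indicator hC), lintegral_indicator_one hC,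
        Measure.restrict_apply hC, Set.inter_eq_left.2 hCx]
    have i2 : ∀ a : ℝ, S₂.indicator (fun p => ENNReal.ofReal ((x - p.1.toReal) /
        (p.2.toReal - p.1.toReal))) ((a : EReal), ⊤) = 0 := fun a =>
      Set.indicator_of_notMem (by rintro ⟨-, b', hb', h⟩; exact EReal.coe_ne_top _ h) _
    have i3 : ∀ b : ℝ, S₂.indicator (fun p => ENNReal.ofReal ((x - p.1.toReal) /
        (p.2.toReal - p.1.toReal))) (⊥, (b : EReal)) = 0 := fun b =>
      Set.indicator_of_notMem (fun h => h.1 rfl) _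
    have i4 : S₂.indicator (fun p => ENNReal.ofReal ((x - p.1.toReal) /
        (p.2.toReal - p.1.toReal))) ((x : EReal), (x : EReal)) = 0 :=
      Set.indicator_of_notMem (by
        rintro ⟨-, b', hb', h⟩
        exact (lt_irrefl x) (EReal.coe_eq_coe_iff.1 h ▸ hCx hb')) _
    rw [setLIntegral_congr_fun measurableSet_Iio i1, lintegral_mul_const _ (by fun_prop)]
    simp only [i2, i3, i4, mul_zero, lintegral_zero, add_zero, mul_assoc]
  rw [e1, e2, add_comm, ← add_mul]
  by_cases h : ν (Set.Ioi x) = 0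
  · rw [measure_mono_null hCx h, mul_zero]
  · rw [h₂ h, one_mul]

/-- A fair two-valued variable whose pair of values is distributed according to `mixLaw ν` has
law `ν`. -/
theorem map_eq_of_map_eq_mixLaw {Ω : Type*} [mΩ : MeasurableSpace Ω] {P : Measure Ω}
    [IsProbabilityMeasure P] {𝓕 : Filtration ℝ≥0 mΩ} {Θ : Ω → EReal × EReal}
    (hΘm : Measurable[𝓕 0] Θ) {Z : Ω → ℝ} (hZm : Measurable Z)
    (hZ : ∀ᵐ ω ∂P, (Z ω : EReal) = (Θ ω).1 ∨ (Z ω : EReal) = (Θ ω).2)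
    (hE : ∀ (n : ℕ) (G : Ω → ℝ) (D : ℝ), StronglyMeasurable[𝓕 0] G → (∀ ω, ‖G ω‖ ≤ D) →
        (∀ ω, G ω ≠ 0 → ((-(n : ℝ) : ℝ) : EReal) ≤ (Θ ω).1 ∧ (Θ ω).2 ≤ (n : ℝ)) →
        ∫ ω, G ω * Z ω ∂P = x * ∫ ω, G ω ∂P)
    (hx1 : ∀ ω, (Θ ω).1 ≤ x) (hx2 : ∀ ω, x ≤ (Θ ω).2) (hΘ : P.map Θ = mixLaw ν x k c₁ c₂)
    (h₁ : ν (Set.Iio x) ≠ 0 → k * ∫⁻ b in Set.Ioi x, ENNReal.ofReal (b - x) ∂ν + c₁ = 1)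
    (h₂ : ν (Set.Ioi x) ≠ 0 → k * ∫⁻ a in Set.Iio x, ENNReal.ofReal (x - a) ∂ν + c₂ = 1) :
    P.map Z = ν := by
  have : IsProbabilityMeasure (P.map Z) := Measure.isProbabilityMeasure_map hZm.aemeasurable
  have : IsProbabilityMeasure (ν.map fun z => -z) :=
    Measure.isProbabilityMeasure_map measurable_neg.aemeasurable
  refine eq_of_forall_subset_eq (x := x) (fun C hC hCx => ?_) fun C hC hCx => ?_
  · have hCn : MeasurableSet ((fun z : ℝ => -z) ⁻¹' C) := measurable_neg hC
    have hp : (fun z : ℝ => -z) ⁻¹' Set.Ioi (-x) = Set.Iio x := by ext; simp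
    have hp' : (fun z : ℝ => -z) ⁻¹' Set.Iio (-x) = Set.Ioi x := by ext; simp
    have hCC : (fun z : ℝ => -z) ⁻¹' ((fun z : ℝ => -z) ⁻¹' C) = C := by ext; simp
    have key := measure_preimage_eq_of_map_eq_mixLaw (P := P) (ν := ν.map fun z => -z) (x := -x)
      (k := k) (c₁ := c₂) (c₂ := c₁) (Θ := fun ω => (-(Θ ω).2, -(Θ ω).1)) (Z := fun ω => - Z ω)
      (hΘm.snd.neg.prodMk hΘm.fst.neg) hZm.neg ?_ ?_ ?_ ?_ ?_ hCn ?_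
    · rw [Measure.map_apply measurable_neg hCn, hCC] at key
      rw [Measure.map_apply hZm hC, ← key, ← Set.preimage_comp]
      simp [Set.preimage]
    · filter_upwards [hZ] with ω hω
      rw [EReal.coe_neg, neg_inj, neg_inj]
      exact hω.symm
    · intro n G D hG hGD hsupp
      have := hE n G D hG hGD fun ω h => by
        obtain ⟨h1, h2⟩ := hsupp ω h
        rw [EReal.coe_neg] at h1 ⊢
        exact ⟨EReal.neg_le.1 h2, EReal.neg_le_neg_iff.1 h1⟩
      simp only [mul_neg, integral_neg, this, neg_mul]
    · intro ω
      rw [EReal.coe_neg]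
      exact EReal.neg_le_neg_iff.2 (hx2 ω)
    · have hg : Measurable fun p : EReal × EReal => (-p.2, -p.1) :=
        measurable_snd.neg.prodMk measurable_fst.neg
      rw [← map_neg_mixLaw, ← hΘ, Measure.map_map hg (hΘm.mono (𝓕.le 0) le_rfl)]
      rfl
    · intro h
      rw [Measure.map_apply measurable_neg measurableSet_Ioi, hp] at h
      rw [setLIntegral_map measurableSet_Iio (by fun_prop) measurable_neg, hp', ← h₁ h]
      simp only [neg_sub_neg]
    · intro z hz
      have : -z < x := hCx hz
      exact neg_lt.1 this
  · rw [Measure.map_apply hZm hC]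
    exact measure_preimage_eq_of_map_eq_mixLaw hΘm hZm hZ hE hx1 hΘ h₂ hC hCx

/-- The law `mixLaw ν` is carried by the pairs of thresholds on both sides of `x` which are limits
of points of `J` if `ν` is carried by the closure of `J`. -/
lemma mixLaw_compl_eq_zero {J : Set ℝ} (hν : ν (closure J)ᶜ = 0) (hx : x ∈ J)
    (h₁ : ν (Set.Iio x) ≠ 0 → c₁ ≠ 0 → ⊤ ∈ closure (Real.toEReal '' J))
    (h₂ : ν (Set.Ioi x) ≠ 0 → c₂ ≠ 0 → ⊥ ∈ closure (Real.toEReal '' J))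
    {K : Set (EReal × EReal)} (hKm : MeasurableSet K)
    (hK : ∀ a b : EReal, a ≤ x → x ≤ b → a ∈ closure (Real.toEReal '' J) →
      b ∈ closure (Real.toEReal '' J) → (a ≠ ⊥ ∨ b ≠ ⊤) → (a, b) ∈ K) :
    mixLaw ν x k c₁ c₂ Kᶜ = 0 := by
  have hcl : ∀ a ∈ closure J, (a : EReal) ∈ closure (Real.toEReal '' J) := fun a ha =>
    image_closure_subset_closure_image continuous_coe_real_ereal ⟨a, ha, rfl⟩
  have hae : ∀ᵐ a ∂ν, a ∈ closure J := hν
  have hb : ∀ z : ℝ, (z : EReal) ≠ ⊥ := EReal.coe_ne_bot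
  have ht : ∀ z : ℝ, (z : EReal) ≠ ⊤ := EReal.coe_ne_top
  have hx' := hcl x (subset_closure hx)
  have hind : ∀ p ∈ K, Kᶜ.indicator (1 : EReal × EReal → ℝ≥0∞) p = 0 := fun p hp =>
    Set.indicator_of_notMem (fun h : p ∈ Kᶜ => h hp) _
  rw [← lintegral_indicator_one hKm.compl, lintegral_mixLaw (measurable_one.indicator hKm.compl)]
  have e1 : ∫⁻ a in Set.Iio x, ∫⁻ b in Set.Ioi x, ENNReal.ofReal (b - a) *
      Kᶜ.indicator (1 : EReal × EReal → ℝ≥0∞) (a, b) ∂ν ∂ν = 0 := by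
    rw [← lintegral_zero (μ := ν.restrict (Set.Iio x))]
    refine lintegral_congr_ae ?_
    filter_upwards [ae_restrict_mem measurableSet_Iio, ae_restrict_of_ae hae] with a ha haJ
    rw [← lintegral_zero (μ := ν.restrict (Set.Ioi x))]
    refine lintegral_congr_ae ?_
    filter_upwards [ae_restrict_mem measurableSet_Ioi, ae_restrict_of_ae hae] with b hb' hbJ
    rw [hind _ (hK _ _ (EReal.coe_le_coe_iff.2 (le_of_lt ha)) (EReal.coe_le_coe_iff.2
      (le_of_lt hb')) (hcl a haJ) (hcl b hbJ) (Or.inl (hb a))), mul_zero]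
  have e2 : c₁ * ∫⁻ a in Set.Iio x, Kᶜ.indicator (1 : EReal × EReal → ℝ≥0∞) (a, ⊤) ∂ν = 0 := by
    by_cases hc : c₁ = 0
    · rw [hc, zero_mul]
    by_cases hI : ν (Set.Iio x) = 0
    · rw [setLIntegral_measure_zero _ _ hI, mul_zero]
    have h : ∫⁻ a in Set.Iio x, Kᶜ.indicator (1 : EReal × EReal → ℝ≥0∞) (a, ⊤) ∂ν =
        ∫⁻ a in Set.Iio x, 0 ∂ν := by
      refine lintegral_congr_ae ?_
      filter_upwards [ae_restrict_mem measurableSet_Iio, ae_restrict_of_ae hae] with a ha haJ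
      exact hind _ (hK _ _ (EReal.coe_le_coe_iff.2 (le_of_lt ha)) le_top (hcl a haJ) (h₁ hI hc)
        (Or.inl (hb a)))
    rw [h, lintegral_zero, mul_zero]
  have e3 : c₂ * ∫⁻ b in Set.Ioi x, Kᶜ.indicator (1 : EReal × EReal → ℝ≥0∞) (⊥, b) ∂ν = 0 := by
    by_cases hc : c₂ = 0
    · rw [hc, zero_mul]
    by_cases hI : ν (Set.Ioi x) = 0
    · rw [setLIntegral_measure_zero _ _ hI, mul_zero]
    have h : ∫⁻ b in Set.Ioi x, Kᶜ.indicator (1 : EReal × EReal → ℝ≥0∞) (⊥, b) ∂ν =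
        ∫⁻ b in Set.Ioi x, 0 ∂ν := by
      refine lintegral_congr_ae ?_
      filter_upwards [ae_restrict_mem measurableSet_Ioi, ae_restrict_of_ae hae] with b hb' hbJ
      exact hind _ (hK _ _ bot_le (EReal.coe_le_coe_iff.2 (le_of_lt hb')) (h₂ hI hc) (hcl b hbJ)
        (Or.inr (ht b)))
    rw [h, lintegral_zero, mul_zero]
  rw [e1, e2, e3, hind _ (hK _ _ le_rfl le_rfl hx' hx' (Or.inl (hb x)))]
  simp

end MixLaw

/-! ### Realizing a law of thresholds at time 0 -/

section Randomization

lemma continuous_cdf {μ : Measure ℝ} [IsProbabilityMeasure μ] (h : ∀ u, μ {u} = 0) :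
    Continuous (cdf μ) := by
  refine continuous_iff_continuousAt.2 fun a => ?_
  rw [(monotone_cdf μ).continuousAt_iff_leftLim_eq_rightLim, (cdf μ).rightLim_eq]
  refine le_antisymm ((monotone_cdf μ).leftLim_le le_rfl) ?_
  have := (cdf μ).measure_singleton a
  rw [measure_cdf, h, eq_comm, ENNReal.ofReal_eq_zero] at this
  linarith

/-- The distribution function of an atomless law transports this law to the uniform law. -/
lemma map_cdf_eq_volume {μ : Measure ℝ} [IsProbabilityMeasure μ] (h : ∀ u, μ {u} = 0) :
    μ.map (fun u => (⟨cdf μ u, cdf_nonneg μ u, cdf_le_one μ u⟩ : unitInterval)) = volume := by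
  have hF := continuous_cdf h
  have hm : Measurable fun u => (⟨cdf μ u, cdf_nonneg μ u, cdf_le_one μ u⟩ : unitInterval) :=
    hF.measurable.subtype_mk
  have : IsProbabilityMeasure
      (μ.map fun u => (⟨cdf μ u, cdf_nonneg μ u, cdf_le_one μ u⟩ : unitInterval)) :=
    Measure.isProbabilityMeasure_map hm.aemeasurable
  refine Measure.ext_of_Iic _ _ fun t => ?_
  rw [unitInterval.volume_Iic, Measure.map_apply hm measurableSet_Iic]
  have hpre : (fun u => (⟨cdf μ u, cdf_nonneg μ u, cdf_le_one μ u⟩ : unitInterval)) ⁻¹' Set.Iic t =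
      {u | cdf μ u ≤ t} := rfl
  rw [hpre]
  rcases t.2.2.lt_or_eq with ht | ht
  · rcases Set.eq_empty_or_nonempty {u | cdf μ u ≤ t} with hS | hS
    · rw [hS, measure_empty, eq_comm, ENNReal.ofReal_eq_zero]
      by_contra! h0
      obtain ⟨u, hu⟩ := ((tendsto_cdf_atBot μ).eventually_lt_const h0).exists
      exact (Set.mem_empty_iff_false u).1 (hS ▸ hu.le)
    · obtain ⟨v, hv⟩ := ((tendsto_cdf_atTop μ).eventually_const_lt ht).exists
      have hbdd : BddAbove {u | cdf μ u ≤ t} := ⟨v, fun u hu => by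
        by_contra! huv
        exact absurd (monotone_cdf μ huv.le) (not_le.2 (lt_of_le_of_lt hu hv))⟩
      have hcl : IsClosed {u | cdf μ u ≤ t} := isClosed_le hF continuous_const
      have hmem := hcl.csSup_mem hS hbdd
      -- The largest point where the distribution function is at most t < 1. A value strictly below
      -- t would persist to the right of w by continuity, so the value at w is t.
      set w := sSup {u | cdf μ u ≤ t} with hw
      have hIic : {u | cdf μ u ≤ t} = Set.Iic w :=
        Set.Subset.antisymm (fun u hu => le_csSup hbdd hu)
          fun u hu => (monotone_cdf μ hu).trans hmem
      have hwt : cdf μ w = t := by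
        refine le_antisymm hmem ?_
        by_contra! hlt
        obtain ⟨z, hz, hzw⟩ := (((hF.tendsto w).eventually_lt_const hlt).filter_mono
          nhdsWithin_le_nhds |>.and (self_mem_nhdsWithin (s := Set.Ioi w))).exists
        exact absurd (le_csSup hbdd (show z ∈ {u | cdf μ u ≤ t} from hz.le)) (not_le.2 hzw)
      rw [hIic, ← hwt, ofReal_cdf]
  · rw [ht, ENNReal.ofReal_one]
    have : {u | cdf μ u ≤ 1} = Set.univ := Set.eq_univ_of_forall fun u => cdf_le_one μ u
    rw [this, measure_univ]

variable {Ω : Type*} [mΩ : MeasurableSpace Ω] {P : Measure Ω} [IsProbabilityMeasure P]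
  {𝓕 : Filtration ℝ≥0 mΩ} {Y : ℝ≥0 → Ω → ℝ}

/-- A law on a measurable set `K` is realized by an initial random variable with values in `K`
which is independent of `Y`. -/
theorem HasInitialRandomization.exists_map_eq (hU : HasInitialRandomization P 𝓕 Y)
    {E : Type*} [MeasurableSpace E] [StandardBorelSpace E] (ζ : Measure E)
    [IsProbabilityMeasure ζ] {K : Set E} (hK : MeasurableSet K) (hζ : ζ Kᶜ = 0) :
    ∃ Θ : Ω → E, Measurable[𝓕 0] Θ ∧ (∀ ω, Θ ω ∈ K) ∧ P.map Θ = ζ ∧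
      IndepFun Θ (fun ω t => Y t ω) P := by
  classical
  obtain ⟨U, hUm, hU0, hUY⟩ := hU
  have hUm' : Measurable U := hUm.mono (𝓕.le 0) le_rfl
  have : IsProbabilityMeasure (P.map U) := Measure.isProbabilityMeasure_map hUm'.aemeasurable
  obtain ⟨k₀, hk₀⟩ : K.Nonempty := by
    by_contra! h
    rw [h, Set.compl_empty, measure_univ] at hζ
    exact one_ne_zero hζ
  have : Nonempty E := ⟨k₀⟩
  -- A map f carrying the uniform law on the unit interval to ζ; the distribution function of U
  -- supplies the uniform variable.
  obtain ⟨f, hf, hfζ⟩ := ζ.exists_measurable_map_eq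
  set F : ℝ → unitInterval := fun u =>
    ⟨cdf (P.map U) u, cdf_nonneg (P.map U) u, cdf_le_one (P.map U) u⟩
  have hF : Measurable F := (continuous_cdf hU0).measurable.subtype_mk
  -- Redirecting the null set outside `K` to a fixed point gives values in `K` everywhere without
  -- changing the law.
  set g : E → E := fun e => if e ∈ K then e else k₀
  have hg : Measurable g := Measurable.ite hK measurable_id measurable_const
  have hgf : Measurable fun u => g (f (F u)) := hg.comp (hf.comp hF)
  refine ⟨fun ω => g (f (F (U ω))), hgf.comp hUm, fun ω => ?_, ?_, hUY.comp hgf measurable_id⟩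
  · by_cases h : f (F (U ω)) ∈ K
    · simp only [g, if_pos h, h]
    · simp only [g, if_neg h, hk₀]
  · have e1 : P.map (fun ω => g (f (F (U ω)))) = ((((P.map U).map F).map f).map g) := by
      rw [Measure.map_map hg hf, Measure.map_map (hg.comp hf) hF,
        Measure.map_map ((hg.comp hf).comp hF) hUm']
      rfl
    rw [e1, map_cdf_eq_volume hU0, hfζ]
    refine (Measure.map_congr ?_).trans Measure.map_id
    have : ∀ᵐ e ∂ζ, e ∈ K := hζ
    filter_upwards [this] with e he using if_pos he

end Randomization

/-! ### The scale function and its inverse on the extended line -/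

section Scale

/-- A path without a limit in the extended line crosses some (a, b) infinitely often. Separation
turns this into infinitely many crossings of (p, q) by f, contradicting its convergence. The lemma
serves both to pass from Y to s(Y) and back, without extending s to the ends of I. -/
lemma exists_tendsto_of_forall_exists_separated {f g : ℝ≥0 → ℝ}
    (hf : ∃ l : EReal, Tendsto (fun t => (f t : EReal)) atTop (𝓝 l))
    (H : ∀ a b : EReal, a < b → (∃ t, (g t : EReal) < a) → (∃ t, b < g t) →
      ∃ p q : ℝ, p < q ∧ ∀ t, ((g t : EReal) < a → f t < p) ∧ (b < g t → q < f t)) :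
    ∃ l : EReal, Tendsto (fun t => (g t : EReal)) atTop (𝓝 l) := by
  obtain ⟨l, hl⟩ := hf
  refine tendsto_of_no_upcrossings dense_univ fun a _ b _ hab ⟨h1, h2⟩ => ?_
  obtain ⟨p, q, hpq, h⟩ := H a b hab h1.exists h2.exists
  have hp : l ≤ p := by
    by_contra! hlp
    obtain ⟨t, ht1, ht2⟩ := (h1.and_eventually (hl.eventually_const_lt hlp)).exists
    exact lt_asymm ht2 (EReal.coe_lt_coe_iff.2 ((h t).1 ht1))
  have hq : (q : EReal) ≤ l := by
    by_contra! hlq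
    obtain ⟨t, ht1, ht2⟩ := (h2.and_eventually (hl.eventually_lt_const hlq)).exists
    exact lt_asymm ht2 (EReal.coe_lt_coe_iff.2 ((h t).2 ht1))
  exact absurd (EReal.coe_le_coe_iff.1 (hq.trans hp)) (not_le.2 hpq)

variable {I : Set ℝ} {s : ℝ → ℝ}

/-- Between two points of the extended line separating values of `s`, there are points of `I`. -/
lemma exists_lt_lt_of_lt (hI : I.OrdConnected) (hsc : ContinuousOn s I) {u v : ℝ} (hu : u ∈ I)
    (hv : v ∈ I) {a b : EReal} (hab : a < b) (ha : (s u : EReal) ≤ a) (hb : b ≤ s v) :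
    ∃ w ∈ I, a < s w ∧ (s w : EReal) < b := by
  obtain ⟨c, hc1, hc2⟩ := EReal.lt_iff_exists_real_btwn.1 hab
  have hJ : (s '' I).OrdConnected := (hI.isPreconnected.image s hsc).ordConnected
  obtain ⟨w, hw, rfl⟩ := hJ.out ⟨u, hu, rfl⟩ ⟨v, hv, rfl⟩
    ⟨EReal.coe_le_coe_iff.1 (ha.trans hc1.le), EReal.coe_le_coe_iff.1 (hc2.le.trans hb)⟩
  exact ⟨w, hw, hc1, hc2⟩

lemma exists_tendsto_scale (hI : I.OrdConnected) (hs : StrictMonoOn s I) (hsc : ContinuousOn s I)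
    {v : ℝ≥0 → ℝ} (hv : ∀ t, v t ∈ I)
    (h : ∃ l : EReal, Tendsto (fun t => (v t : EReal)) atTop (𝓝 l)) :
    ∃ l : EReal, Tendsto (fun t => (s (v t) : EReal)) atTop (𝓝 l) := by
  refine exists_tendsto_of_forall_exists_separated h fun a b hab ⟨t₁, h₁⟩ ⟨t₂, h₂⟩ => ?_
  obtain ⟨q, hq, hq1, hq2⟩ := exists_lt_lt_of_lt hI hsc (hv t₁) (hv t₂) hab h₁.le h₂.le
  obtain ⟨p, hp, hp1, hp2⟩ := exists_lt_lt_of_lt hI hsc (hv t₁) hq hq1 h₁.le le_rfl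
  refine ⟨p, q, (hs.lt_iff_lt hp hq).1 (EReal.coe_lt_coe_iff.1 hp2), fun t => ⟨fun ht => ?_,
    fun ht => ?_⟩⟩
  · exact (hs.lt_iff_lt (hv t) hp).1 (EReal.coe_lt_coe_iff.1 (ht.trans hp1))
  · exact (hs.lt_iff_lt hq (hv t)).1 (EReal.coe_lt_coe_iff.1 (hq2.trans ht))

lemma exists_tendsto_of_scale (hI : I.OrdConnected) (hs : StrictMonoOn s I)
    {v : ℝ≥0 → ℝ} (hv : ∀ t, v t ∈ I)
    (h : ∃ l : EReal, Tendsto (fun t => (s (v t) : EReal)) atTop (𝓝 l)) :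
    ∃ l : EReal, Tendsto (fun t => (v t : EReal)) atTop (𝓝 l) := by
  refine exists_tendsto_of_forall_exists_separated h fun a b hab ⟨t₁, h₁⟩ ⟨t₂, h₂⟩ => ?_
  obtain ⟨q, hq1, hq2⟩ := EReal.lt_iff_exists_real_btwn.1 hab
  obtain ⟨p, hp1, hp2⟩ := EReal.lt_iff_exists_real_btwn.1 hq1
  have hpq := EReal.coe_lt_coe_iff.1 hp2
  have h1 : v t₁ < p := EReal.coe_lt_coe_iff.1 (h₁.trans hp1)
  have h2 : q < v t₂ := EReal.coe_lt_coe_iff.1 (hq2.trans h₂)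
  have hp := hI.out (hv t₁) (hv t₂) ⟨h1.le, (hpq.trans h2).le⟩
  have hq := hI.out (hv t₁) (hv t₂) ⟨(h1.trans hpq).le, h2.le⟩
  exact ⟨s p, s q, hs hp hq hpq, fun t =>
    ⟨fun ht => hs (hv t) hp (EReal.coe_lt_coe_iff.1 (ht.trans hp1)),
      fun ht => hs hq (hv t) (EReal.coe_lt_coe_iff.1 (hq2.trans ht))⟩⟩

/-- The inverse of the scale function, extended to the extended real line. -/
def scaleInv (I : Set ℝ) (s : ℝ → ℝ) (z : EReal) : EReal :=
  -- If no point of I has scale value at most z, the supremum is that of the empty set, namely `⊥`;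
  -- the maximum with the infimum of I keeps the value in the closure of I.
  max (sInf (Real.toEReal '' I)) (sSup (Real.toEReal '' {u ∈ I | (s u : EReal) ≤ z}))

lemma monotone_scaleInv : Monotone (scaleInv I s) := fun _ _ h =>
  max_le_max le_rfl (sSup_le_sSup (Set.image_mono fun _ hu => ⟨hu.1, hu.2.trans h⟩))

lemma le_scaleInv {z : EReal} {u : ℝ} (hu : u ∈ I) (h : s u ≤ z) : u ≤ scaleInv I s z :=
  le_max_of_le_right (le_sSup (Set.mem_image_of_mem _ (show u ∈ {u ∈ I | (s u : EReal) ≤ z} from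
    ⟨hu, h⟩)))

lemma sInf_le_of_mem {u : ℝ} (hu : u ∈ I) : sInf (Real.toEReal '' I) ≤ u :=
  sInf_le (Set.mem_image_of_mem _ hu)

/-- For z < s u a point w of I with z < s w < s u bounds the inverse by w < u. Such a w exists
because z is a limit of scale values; for z strictly below s(I) and u the least point of I the
equivalence would fail. -/
lemma scaleInv_lt_iff (hI : I.OrdConnected) (hs : StrictMonoOn s I) (hsc : ContinuousOn s I)
    {z : EReal} (hz : z ∈ closure (Real.toEReal '' (s '' I))) {u : ℝ} (hu : u ∈ I) :
    scaleInv I s z < u ↔ z < s u := by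
  refine ⟨fun h => ?_, fun h => ?_⟩
  · by_contra! h'
    exact absurd h (not_lt.2 (le_scaleInv hu h'))
  · obtain ⟨_, hp, _, ⟨p, hpI, rfl⟩, rfl⟩ := mem_closure_iff.1 hz _ isOpen_Iio h
    obtain ⟨w, hw, hw1, hw2⟩ := exists_lt_lt_of_lt hI hsc hpI hu (max_lt h hp) (le_max_right _ _)
      le_rfl
    refine max_lt ((sInf_le_of_mem hpI).trans_lt (EReal.coe_lt_coe_iff.2
      ((hs.lt_iff_lt hpI hu).1 (EReal.coe_lt_coe_iff.1 hp)))) (lt_of_le_of_lt (sSup_le ?_)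
      (EReal.coe_lt_coe_iff.2 ((hs.lt_iff_lt hw hu).1 (EReal.coe_lt_coe_iff.1 hw2))))
    rintro _ ⟨q, ⟨hq, hqz⟩, rfl⟩
    exact EReal.coe_le_coe_iff.2 ((hs.lt_iff_lt hq hw).1 (EReal.coe_lt_coe_iff.1
      (hqz.trans_lt ((le_max_left _ _).trans_lt hw1)))).le

lemma lt_scaleInv_iff (hI : I.OrdConnected) (hs : StrictMonoOn s I) (hsc : ContinuousOn s I)
    {z : EReal} (hz : z ∈ closure (Real.toEReal '' (s '' I))) {u : ℝ} (hu : u ∈ I) :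
    u < scaleInv I s z ↔ s u < z := by
  refine ⟨fun h => ?_, fun h => ?_⟩
  · rcases lt_max_iff.1 h with h | h
    · exact absurd h (not_lt.2 (sInf_le_of_mem hu))
    · obtain ⟨_, ⟨w, ⟨hw, hwz⟩, rfl⟩, huw⟩ := lt_sSup_iff.1 h
      exact (EReal.coe_lt_coe_iff.2 (hs hu hw (EReal.coe_lt_coe_iff.1 huw))).trans_le hwz
  · obtain ⟨_, hp, _, ⟨p, hpI, rfl⟩, rfl⟩ := mem_closure_iff.1 hz _ isOpen_Ioi h
    obtain ⟨w, hw, hw1, hw2⟩ := exists_lt_lt_of_lt hI hsc hu hpI (lt_min h hp) le_rfl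
      (min_le_right _ _)
    refine lt_of_lt_of_le (EReal.coe_lt_coe_iff.2 ((hs.lt_iff_lt hu hw).1
      (EReal.coe_lt_coe_iff.1 hw1))) (le_scaleInv hw ?_)
    exact (hw2.trans_le (min_le_left _ _)).le

lemma scaleInv_mem_closure (hI : I.Nonempty) (z : EReal) :
    scaleInv I s z ∈ closure (Real.toEReal '' I) := by
  have h1 : sInf (Real.toEReal '' I) ∈ closure (Real.toEReal '' I) :=
    (isGLB_sInf _).mem_closure (hI.image _)
  rcases Set.eq_empty_or_nonempty {u ∈ I | (s u : EReal) ≤ z} with h | h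
  · rwa [scaleInv, h, Set.image_empty, sSup_empty, max_eq_left bot_le]
  · have h2 := closure_mono (Set.image_mono fun u (hu : u ∈ {u ∈ I | (s u : EReal) ≤ z}) => hu.1)
      ((isLUB_sSup (Real.toEReal '' {u ∈ I | (s u : EReal) ≤ z})).mem_closure (h.image _))
    rcases max_choice (sInf (Real.toEReal '' I))
      (sSup (Real.toEReal '' {u ∈ I | (s u : EReal) ≤ z})) with h | h
    · rwa [scaleInv, h]
    · rwa [scaleInv, h]

lemma exitTime_scaleInv (hI : I.OrdConnected) (hs : StrictMonoOn s I) (hsc : ContinuousOn s I)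
    {Ω : Type*} {Y : ℝ≥0 → Ω → ℝ} (hY : ∀ t ω, Y t ω ∈ I) {Θ : Ω → EReal × EReal}
    (hΘ : ∀ ω, (Θ ω).1 ∈ closure (Real.toEReal '' (s '' I)) ∧
      (Θ ω).2 ∈ closure (Real.toEReal '' (s '' I))) :
    exitTime Y (fun ω => (scaleInv I s (Θ ω).1, scaleInv I s (Θ ω).2)) =
      exitTime (fun t ω => s (Y t ω)) Θ := by
  funext ω
  have h : ∀ t, (Y t ω ∈ {z : ℝ | (z : EReal) ∉ Set.Ioo (scaleInv I s (Θ ω).1)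
      (scaleInv I s (Θ ω).2)}) = (s (Y t ω) ∈ {z : ℝ | (z : EReal) ∉ Set.Ioo (Θ ω).1 (Θ ω).2}) := by
    intro t
    have := and_congr (scaleInv_lt_iff hI hs hsc (hΘ ω).1 (hY t ω))
      (lt_scaleInv_iff hI hs hsc (hΘ ω).2 (hY t ω))
    exact propext (not_congr this)
  classical
  simp only [exitTime, hittingAfter]
  exact if_congr (exists_congr fun t => by rw [h]) (by simp only [h]) rfl

end Scale

/-! ### The diffusion in natural scale -/

section ScaledDiffusion

variable {Ω : Type*} [mΩ : MeasurableSpace Ω] {P : Measure Ω}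
  {𝓕 : Filtration ℝ≥0 mΩ} {I : Set ℝ} {y : ℝ} {Y : ℝ≥0 → Ω → ℝ} {s : ℝ → ℝ}

lemma IsRegularDiffusion.mem_state (hY : IsRegularDiffusion P 𝓕 I y Y) (t : ℝ≥0) (ω : Ω) :
    Y t ω ∈ I := by
  obtain ⟨-, -, -, κ, hκ, -⟩ := hY
  exact hκ.mem_state t ω

lemma IsRegularDiffusion.isContLocalMartingale (hY : IsRegularDiffusion P 𝓕 I y Y)
    (hs : IsScaleFunction P 𝓕 I Y s) :
    IsContLocalMartingale P 𝓕 (fun t ω => s (Y t ω)) (s y) := by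
  obtain ⟨-, -, h0, κ, hκ, -⟩ := hY
  refine ⟨fun t => ?_, fun ω => ?_, hs.2.2, ?_⟩
  · have h1 : Measurable[𝓕 t] fun ω => (⟨Y t ω, hκ.mem_state t ω⟩ : I) :=
      (hκ.adapted t).measurable.subtype_mk
    exact ((continuousOn_iff_continuous_domRestrict.1 hs.2.1).measurable.comp h1).stronglyMeasurable
  · exact hs.2.1.comp_continuous (hκ.continuous_path ω) fun t => hκ.mem_state t ω
  · filter_upwards [h0] with ω hω
    rw [hω]

/-- Convergence of s(Y) to a value strictly inside s(I) would keep Y eventually in a compact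
interval with points of I on both sides. Rational endpoints suffice, so one null set serves all
limits L. -/
lemma IsRegularDiffusion.ae_not_tendsto_scale [IsProbabilityMeasure P]
    (hY : IsRegularDiffusion P 𝓕 I y Y)
    (hs : IsScaleFunction P 𝓕 I Y s) :
    ∀ᵐ ω ∂P, ∀ L : ℝ, (∃ p ∈ s '' I, p < L) → (∃ q ∈ s '' I, L < q) →
      ¬ Tendsto (fun t => s (Y t ω)) atTop (𝓝 L) := by
  have hY' := hY
  obtain ⟨hI, -, -, κ, hκ, -⟩ := hY'
  have hesc : ∀ᵐ ω ∂P, ∀ c d : ℚ, (∃ w ∈ I, w < (c : ℝ)) → (∃ w ∈ I, (d : ℝ) < w) →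
      ∀ n : ℕ, ∃ t : ℝ≥0, (n : ℝ≥0) ≤ t ∧ Y t ω ∉ Set.Icc (c : ℝ) d := by
    refine ae_all_iff.2 fun c => ae_all_iff.2 fun d => ?_
    by_cases hc : ∃ w ∈ I, w < (c : ℝ)
    · by_cases hd : ∃ w ∈ I, (d : ℝ) < w
      · filter_upwards [hY.exists_notMem_Icc hc hd] with ω hω _ _ using hω
      · exact ae_of_all _ fun ω _ h => absurd h hd
    · exact ae_of_all _ fun ω h => absurd h hc
  filter_upwards [hesc] with ω hω L hp hq hL
  obtain ⟨_, ⟨p, hp, rfl⟩, hpL⟩ := hp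
  obtain ⟨_, ⟨q, hq, rfl⟩, hLq⟩ := hq
  have hJ : (s '' I).OrdConnected := (hI.isPreconnected.image s hs.2.1).ordConnected
  obtain ⟨l, hl, rfl⟩ := hJ.out ⟨p, hp, rfl⟩ ⟨q, hq, rfl⟩ ⟨hpL.le, hLq.le⟩
  have hpl := (hs.1.lt_iff_lt hp hl).1 hpL
  have hlq := (hs.1.lt_iff_lt hl hq).1 hLq
  obtain ⟨c, hpc, hcl⟩ := exists_rat_btwn hpl
  obtain ⟨d, hld, hdq⟩ := exists_rat_btwn hlq
  have hcI : (c : ℝ) ∈ I := hI.out hp hl ⟨hpc.le, hcl.le⟩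
  have hdI : (d : ℝ) ∈ I := hI.out hl hq ⟨hld.le, hdq.le⟩
  have hev := (hL.eventually_const_lt (hs.1 hcI hl hcl)).and
    (hL.eventually_lt_const (hs.1 hl hdI hld))
  obtain ⟨t₀, ht₀⟩ := eventually_atTop.1 hev
  obtain ⟨n, hn⟩ := exists_nat_ge t₀
  obtain ⟨t, ht, hYt⟩ := hω c d ⟨p, hp, hpc⟩ ⟨q, hq, hdq⟩ n
  obtain ⟨h1, h2⟩ := ht₀ t (hn.trans ht)
  exact hYt ⟨((hs.1.lt_iff_lt hcI (hκ.mem_state t ω)).1 h1).le,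
    ((hs.1.lt_iff_lt (hκ.mem_state t ω) hdI).1 h2).le⟩

end ScaledDiffusion

/-! ### Upper and lower first moments about x -/

section Partial

variable {ν : Measure ℝ} {x : ℝ}

lemma measure_Ioi_eq_zero_of_lintegral (h : ∫⁻ b in Set.Ioi x, ENNReal.ofReal (b - x) ∂ν = 0) :
    ν (Set.Ioi x) = 0 := by
  by_contra h0
  refine absurd h (ne_of_gt ((setLIntegral_pos_iff (by fun_prop)).2
    ((pos_iff_ne_zero.2 h0).trans_le (measure_mono fun b (hb : x < b) => ⟨?_, hb⟩))))
  exact (ENNReal.ofReal_pos.2 (sub_pos.2 hb)).ne'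

lemma measure_Iio_eq_zero_of_lintegral (h : ∫⁻ a in Set.Iio x, ENNReal.ofReal (x - a) ∂ν = 0) :
    ν (Set.Iio x) = 0 := by
  by_contra h0
  refine absurd h (ne_of_gt ((setLIntegral_pos_iff (by fun_prop)).2
    ((pos_iff_ne_zero.2 h0).trans_le (measure_mono fun a (ha : a < x) => ⟨?_, ha⟩))))
  exact (ENNReal.ofReal_pos.2 (sub_pos.2 ha)).ne'

/-- Since U - D is the mean minus x, each mean condition becomes a comparison of U with D. -/
lemma lintegral_parts_of_integrable [IsProbabilityMeasure ν] (hν : Integrable (fun z : ℝ => z) ν) :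
    ∫⁻ b in Set.Ioi x, ENNReal.ofReal (b - x) ∂ν ≠ ⊤ ∧
    ∫⁻ a in Set.Iio x, ENNReal.ofReal (x - a) ∂ν ≠ ⊤ ∧
    ∫ z, z ∂ν - x = (∫⁻ b in Set.Ioi x, ENNReal.ofReal (b - x) ∂ν).toReal -
      (∫⁻ a in Set.Iio x, ENNReal.ofReal (x - a) ∂ν).toReal := by
  have hi : Integrable (fun z : ℝ => z - x) ν := hν.sub (integrable_const x)
  have e1 : ∫⁻ b in Set.Ioi x, ENNReal.ofReal (b - x) ∂ν = ∫⁻ b, ENNReal.ofReal (b - x) ∂ν := by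
    rw [← lintegral_indicator measurableSet_Ioi]
    refine lintegral_congr fun b => ?_
    by_cases hb : b ∈ Set.Ioi x
    · rw [Set.indicator_of_mem hb]
    · rw [Set.indicator_of_notMem hb, ENNReal.ofReal_of_nonpos (sub_nonpos.2 (not_lt.1 hb))]
  have e2 : ∫⁻ a in Set.Iio x, ENNReal.ofReal (x - a) ∂ν =
      ∫⁻ a, ENNReal.ofReal (-(a - x)) ∂ν := by
    rw [← lintegral_indicator measurableSet_Iio]
    refine lintegral_congr fun a => ?_
    rw [neg_sub]
    by_cases ha : a ∈ Set.Iio x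
    · rw [Set.indicator_of_mem ha]
    · rw [Set.indicator_of_notMem ha, ENNReal.ofReal_of_nonpos (sub_nonpos.2 (not_lt.1 ha))]
  have e3 : ∫ z, z ∂ν - x = ∫ z, (z - x) ∂ν := by
    rw [integral_sub hν (integrable_const x), integral_const, probReal_univ, one_smul]
  rw [e1, e2, e3, ← integral_eq_lintegral_pos_part_sub_lintegral_neg_part hi]
  exact ⟨hi.lintegral_lt_top.ne, hi.neg.lintegral_lt_top.ne, rfl⟩

end Partial

/-! ### Constraints on stopped laws, and their attainment -/

section Laws

variable {Ω : Type*} [mΩ : MeasurableSpace Ω] {P : Measure Ω} [IsProbabilityMeasure P]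
  {𝓕 : Filtration ℝ≥0 mΩ} {I : Set ℝ} {y : ℝ} {Y : ℝ≥0 → Ω → ℝ} {s : ℝ → ℝ}
  {τ : Ω → WithTop ℝ≥0} {Z : Ω → ℝ} {ν : Measure ℝ}

/-- The stopped value `X_τ` exists in `ℝ` for each time `τ` in the class `𝒯`. -/
theorem IsRegularDiffusion.exists_isStoppedLimit (hY : IsRegularDiffusion P 𝓕 I y Y)
    (hs : IsScaleFunction P 𝓕 I Y s) (hτ : τ ∈ stoppingTimes P 𝓕 Y) :
    ∃ Z : Ω → ℝ, IsStoppedLimit P (fun t ω => s (Y t ω)) τ Z := by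
  have hX := hY.isContLocalMartingale hs
  refine hX.exists_isStoppedLimit hτ.1 ?_
  filter_upwards [hτ.2, hX.not_tendsto_atTop hτ.1, hX.neg.not_tendsto_atTop hτ.1] with ω h1 h2 h3
  obtain ⟨l, hl⟩ := exists_tendsto_scale hY.1 hs.1 hs.2.1
    (v := fun t => stoppedProcess Y τ t ω) (fun t => hY.mem_state _ ω) h1
  induction l with
  | bot =>
    exact absurd (tendsto_neg_atBot_atTop.comp (EReal.tendsto_coe_nhds_bot_iff.1 hl)) h3
  | top => exact absurd (EReal.tendsto_coe_nhds_top_iff.1 hl) h2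
  | coe l => exact ⟨l, EReal.tendsto_coe.1 hl⟩

lemma IsRegularDiffusion.map_mem_lawsOn (hY : IsRegularDiffusion P 𝓕 I y Y)
    (hZ : IsStoppedLimit P (fun t ω => s (Y t ω)) τ Z) : P.map Z ∈ lawsOn (closure (s '' I)) := by
  refine ⟨Measure.isProbabilityMeasure_map hZ.1.aemeasurable, ?_⟩
  rw [Measure.map_apply hZ.1 isClosed_closure.measurableSet.compl]
  have : ∀ᵐ ω ∂P, Z ω ∈ closure (s '' I) := by
    filter_upwards [hZ.2] with ω hω
    exact isClosed_closure.mem_of_tendsto hω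
      (Eventually.of_forall fun t => subset_closure ⟨_, hY.mem_state _ ω, rfl⟩)
  exact this

lemma IsRegularDiffusion.integrable_and_integral_le (hY : IsRegularDiffusion P 𝓕 I y Y)
    (hs : IsScaleFunction P 𝓕 I Y s) (hI : BddBelow (s '' I)) (hτ : IsStoppingTime 𝓕 τ)
    (hZ : IsStoppedLimit P (fun t ω => s (Y t ω)) τ Z) :
    Integrable (fun z => z) (P.map Z) ∧ ∫ z, z ∂(P.map Z) ≤ s y := by
  obtain ⟨m, hm⟩ := hI
  obtain ⟨h1, h2⟩ := (hY.isContLocalMartingale hs).integrable_and_integral_le (c := -m) hτ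
    (ae_of_all _ fun ω u _ => by
      rw [neg_neg]
      exact hm ⟨_, hY.mem_state u ω, rfl⟩) hZ
  rw [integral_map (f := fun z : ℝ => z) hZ.1.aemeasurable measurable_id.aestronglyMeasurable]
  exact ⟨(integrable_map_measure measurable_id.aestronglyMeasurable hZ.1.aemeasurable).2 h1, h2⟩

lemma IsRegularDiffusion.integrable_and_le_integral (hY : IsRegularDiffusion P 𝓕 I y Y)
    (hs : IsScaleFunction P 𝓕 I Y s) (hI : BddAbove (s '' I)) (hτ : IsStoppingTime 𝓕 τ)
    (hZ : IsStoppedLimit P (fun t ω => s (Y t ω)) τ Z) :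
    Integrable (fun z => z) (P.map Z) ∧ s y ≤ ∫ z, z ∂(P.map Z) := by
  obtain ⟨m, hm⟩ := hI
  obtain ⟨h1, h2⟩ := (hY.isContLocalMartingale hs).neg.integrable_and_integral_le (c := m) hτ
    (ae_of_all _ fun ω u _ => neg_le_neg (hm ⟨_, hY.mem_state u ω, rfl⟩)) (Z := fun ω => - Z ω)
    ⟨hZ.1.neg, by filter_upwards [hZ.2] with ω hω using hω.neg⟩
  rw [integral_neg] at h2
  have h1' : Integrable Z P := by simpa using h1.neg
  rw [integral_map (f := fun z : ℝ => z) hZ.1.aemeasurable measurable_id.aestronglyMeasurable]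
  exact ⟨(integrable_map_measure measurable_id.aestronglyMeasurable hZ.1.aemeasurable).2 h1',
    neg_le_neg_iff.1 h2⟩

lemma top_mem_closure_of_not_bddAbove {J : Set ℝ} (hJ : ¬ BddAbove J) :
    ⊤ ∈ closure (Real.toEReal '' J) := by
  refine mem_closure_iff_nhds.2 fun t ht => ?_
  obtain ⟨c, hc⟩ := EReal.mem_nhds_top_iff.1 ht
  obtain ⟨p, hp, hcp⟩ := not_bddAbove_iff.1 hJ c
  exact ⟨p, hc (EReal.coe_lt_coe_iff.2 hcp), p, hp, rfl⟩

lemma bot_mem_closure_of_not_bddBelow {J : Set ℝ} (hJ : ¬ BddBelow J) :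
    ⊥ ∈ closure (Real.toEReal '' J) := by
  refine mem_closure_iff_nhds.2 fun t ht => ?_
  obtain ⟨c, hc⟩ := EReal.mem_nhds_bot_iff.1 ht
  obtain ⟨p, hp, hcp⟩ := not_bddBelow_iff.1 hJ c
  exact ⟨p, hc (EReal.coe_lt_coe_iff.2 hcp), p, hp, rfl⟩

/-- A law which decomposes into a mixture of fair two-point laws is the law of the process in
natural scale stopped at a randomized threshold time. -/
theorem IsRegularDiffusion.mem_stoppedLaws (hY : IsRegularDiffusion P 𝓕 I y Y)
    (hs : IsScaleFunction P 𝓕 I Y s) (hU : HasInitialRandomization P 𝓕 Y)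
    (hν : ν ∈ lawsOn (closure (s '' I))) {k c₁ c₂ : ℝ≥0∞}
    (h₁ : ν (Set.Iio (s y)) ≠ 0 →
      k * ∫⁻ b in Set.Ioi (s y), ENNReal.ofReal (b - s y) ∂ν + c₁ = 1)
    (h₂ : ν (Set.Ioi (s y)) ≠ 0 →
      k * ∫⁻ a in Set.Iio (s y), ENNReal.ofReal (s y - a) ∂ν + c₂ = 1)
    (hc₁ : c₁ ≠ 0 → ¬ BddAbove (s '' I)) (hc₂ : c₂ ≠ 0 → ¬ BddBelow (s '' I)) :
    ν ∈ stoppedLaws P (fun t ω => s (Y t ω)) (randomizedThresholdTimes P 𝓕 I y Y) := by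
  obtain ⟨hνp, hνI⟩ := hν
  have hX := hY.isContLocalMartingale hs
  have hyI : y ∈ I := interior_subset hY.2.1
  have hζ := isProbabilityMeasure_mixLaw h₁ h₂
  set cl := closure (Real.toEReal '' (s '' I)) with hcl
  have hclm : MeasurableSet cl := isClosed_closure.measurableSet
  -- The pair (-∞, ∞) is excluded, since it imposes no stopping and X need not converge then. No
  -- component of `mixLaw` charges it.
  set K : Set (EReal × EReal) := {p | (p.1 ≤ s y ∧ (s y : EReal) ≤ p.2) ∧ (p.1 ∈ cl ∧ p.2 ∈ cl) ∧
    (p.1 ≠ ⊥ ∨ p.2 ≠ ⊤)} with hK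
  have hKm : MeasurableSet K :=
    ((measurableSet_le measurable_fst measurable_const).inter
      (measurableSet_le measurable_const measurable_snd)).inter
      (((measurable_fst hclm).inter (measurable_snd hclm)).inter
        ((measurable_fst (measurableSet_singleton ⊥)).compl.union
          (measurable_snd (measurableSet_singleton ⊤)).compl))
  obtain ⟨Θ, hΘm, hΘK, hΘζ, hΘY⟩ := hU.exists_map_eq (mixLaw ν (s y) k c₁ c₂) hKm
    (mixLaw_compl_eq_zero hνI ⟨y, hyI, rfl⟩
      (fun _ h => top_mem_closure_of_not_bddAbove (hc₁ h))
      (fun _ h => bot_mem_closure_of_not_bddBelow (hc₂ h)) hKm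
      fun a b h1 h2 h3 h4 h5 => ⟨⟨h1, h2⟩, ⟨h3, h4⟩, h5⟩)
  obtain ⟨Z, hZ, hZΘ, hZE⟩ := hX.exists_exit (hY.ae_not_tendsto_scale hs) hΘm
    (fun ω => (hΘK ω).1.1) (fun ω => (hΘK ω).1.2)
    (fun ω z hz => by
      obtain ⟨_, hp, p, hpJ, rfl⟩ := mem_closure_iff.1 (hΘK ω).2.1.1 _ isOpen_Iio hz
      exact ⟨p, hpJ, EReal.coe_lt_coe_iff.1 hp⟩)
    (fun ω z hz => by
      obtain ⟨_, hp, p, hpJ, rfl⟩ := mem_closure_iff.1 (hΘK ω).2.1.2 _ isOpen_Ioi hz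
      exact ⟨p, hpJ, EReal.coe_lt_coe_iff.1 hp⟩)
    (ae_of_all _ fun ω => (hΘK ω).2.2)
  -- The thresholds are drawn for X; their images under the inverse scale are thresholds for Y with
  -- the same exit time.
  have hexit := exitTime_scaleInv hY.1 hs.1 hs.2.1 hY.mem_state (fun ω => (hΘK ω).2.1)
  have hr : Measurable fun p : EReal × EReal => (scaleInv I s p.1, scaleInv I s p.2) :=
    (monotone_scaleInv.measurable.comp measurable_fst).prodMk
      (monotone_scaleInv.measurable.comp measurable_snd)
  have hrΘ : Measurable fun ω => (scaleInv I s (Θ ω).1, scaleInv I s (Θ ω).2) :=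
    hr.comp (hΘm.mono (𝓕.le 0) le_rfl)
  have hpairs : ∀ ω, (scaleInv I s (Θ ω).1, scaleInv I s (Θ ω).2) ∈ thresholdPairs I y := by
    intro ω
    refine ⟨⟨?_, scaleInv_mem_closure ⟨y, hyI⟩ _⟩, ?_, scaleInv_mem_closure ⟨y, hyI⟩ _⟩
    · exact not_lt.1 fun h => absurd ((lt_scaleInv_iff hY.1 hs.1 hs.2.1 (hΘK ω).2.1.1 hyI).1 h)
        (not_lt.2 (hΘK ω).1.1)
    · exact not_lt.1 fun h => absurd ((scaleInv_lt_iff hY.1 hs.1 hs.2.1 (hΘK ω).2.1.2 hyI).1 h)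
        (not_lt.2 (hΘK ω).1.2)
  have hpm : MeasurableSet (thresholdPairs I y) :=
    (measurableSet_Iic.inter isClosed_closure.measurableSet).prod
      (measurableSet_Ici.inter isClosed_closure.measurableSet)
  refine ⟨exitTime (fun t ω => s (Y t ω)) Θ, ⟨⟨isStoppingTime_exitTime hX.continuous_path
    (fun t => (hX.adapted t).measurable) hΘm, ?_⟩, P.map _,
    Measure.isProbabilityMeasure_map hrΘ.aemeasurable, ?_, _, hr.comp hΘm, rfl,
    hΘY.comp hr measurable_id, hexit.symm⟩, Z, hZ,
    map_eq_of_map_eq_mixLaw hΘm hZ.1 hZΘ hZE (fun ω => (hΘK ω).1.1) (fun ω => (hΘK ω).1.2) hΘζ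
      h₁ h₂⟩
  · filter_upwards [hZ.2] with ω hω
    exact exists_tendsto_of_scale hY.1 hs.1 (v := fun t => stoppedProcess Y _ t ω)
      (fun t => hY.mem_state _ ω) ⟨Z ω, EReal.tendsto_coe.2 hω⟩
  · rw [Measure.map_apply hrΘ hpm.compl]
    have : (fun ω => (scaleInv I s (Θ ω).1, scaleInv I s (Θ ω).2)) ⁻¹' (thresholdPairs I y)ᶜ = ∅ :=
      Set.eq_empty_of_forall_notMem fun ω h => h (hpairs ω)
    exact this ▸ measure_empty

end Laws

end ThresholdStopping

end

/-! ### The four cases: choice of the weights -/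

theorem mainTheorem2 {Ω : Type*} [mΩ : MeasurableSpace Ω] (P : Measure Ω) [IsProbabilityMeasure P]
    (𝓕 : Filtration ℝ≥0 mΩ) (I : Set ℝ) (y : ℝ) (Y : ℝ≥0 → Ω → ℝ) (s : ℝ → ℝ)
    (hY : IsRegularDiffusion P 𝓕 I y Y)
    (hs : IsScaleFunction P 𝓕 I Y s)
    (hU : HasInitialRandomization P 𝓕 Y) :
    let X : ℝ≥0 → Ω → ℝ := fun t ω => s (Y t ω)
    let x : ℝ := s y
    let IX : Set ℝ := s '' I
    let T := stoppingTimes P 𝓕 Y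
    let TR := randomizedThresholdTimes P 𝓕 I y Y
    (∀ τ ∈ T, ∃ Z : Ω → ℝ, IsStoppedLimit P X τ Z) ∧
    stoppedLaws P X T = stoppedLaws P X TR ∧
    (BddBelow IX → ¬ BddAbove IX → stoppedLaws P X T =
      {ν | ν ∈ lawsOn (closure IX) ∧ Integrable (fun z => z) ν ∧ ∫ z, z ∂ν ≤ x}) ∧
    (¬ BddBelow IX → BddAbove IX → stoppedLaws P X T =
      {ν | ν ∈ lawsOn (closure IX) ∧ Integrable (fun z => z) ν ∧ x ≤ ∫ z, z ∂ν}) ∧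
    (BddBelow IX → BddAbove IX → stoppedLaws P X T =
      {ν | ν ∈ lawsOn (closure IX) ∧ Integrable (fun z => z) ν ∧ ∫ z, z ∂ν = x}) ∧
    (¬ BddBelow IX → ¬ BddAbove IX → stoppedLaws P X T =
      {ν | IsProbabilityMeasure ν}) := by
  intro X x IX T TR
  have hsub : stoppedLaws P X TR ⊆ stoppedLaws P X T := fun ν ⟨τ, hτ, h⟩ => ⟨τ, hτ.1, h⟩
  have key : ∀ S : Set (Measure ℝ), stoppedLaws P X T ⊆ S → S ⊆ stoppedLaws P X TR →
      stoppedLaws P X T = stoppedLaws P X TR ∧ stoppedLaws P X T = S := fun S h1 h2 =>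
    ⟨(h1.trans h2).antisymm hsub, h1.antisymm (h2.trans hsub)⟩
  have hmul : ∀ {a : ℝ≥0∞}, a ≠ 0 → a ≠ ⊤ → a⁻¹ * a = 1 := ENNReal.inv_mul_cancel
  have h1 : BddBelow IX → ¬ BddAbove IX → stoppedLaws P X T = stoppedLaws P X TR ∧
      stoppedLaws P X T =
        {ν | ν ∈ lawsOn (closure IX) ∧ Integrable (fun z => z) ν ∧ ∫ z, z ∂ν ≤ x} := by
    intro hb ha
    refine key _ ?_ ?_
    · rintro _ ⟨τ, hτ, Z, hZ, rfl⟩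
      exact ⟨hY.map_mem_lawsOn hZ, hY.integrable_and_integral_le hs hb hτ.1 hZ⟩
    · rintro ν ⟨hν, hi, hle⟩
      have := hν.1
      obtain ⟨hU', hD', hUD⟩ := lintegral_parts_of_integrable (x := x) hi
      have hle' := (ENNReal.toReal_le_toReal hU' hD').1 (by linarith)
      -- With k = 1/D the upper equation holds with c₂ = 0, and U ≤ D leaves room for c₁ = 1 - U/D.
      -- If D = 0 then k is `⊤`, but U = 0 as well, so neither half-line has ν-mass and both
      -- conditions are vacuous.
      refine hY.mem_stoppedLaws hs hU hν (c₁ := 1 -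
        (∫⁻ a in Set.Iio x, ENNReal.ofReal (x - a) ∂ν)⁻¹ *
          ∫⁻ b in Set.Ioi x, ENNReal.ofReal (b - x) ∂ν) (c₂ := 0) (fun h => ?_) (fun h => ?_)
        (fun _ => ha) (fun h => absurd rfl h) (k := (∫⁻ a in Set.Iio x, ENNReal.ofReal (x - a) ∂ν)⁻¹)
      · exact add_tsub_cancel_of_le ((mul_le_mul_right hle' _).trans
          (hmul (mt measure_Iio_eq_zero_of_lintegral h) hD').le)
      · rw [add_zero]
        exact hmul (fun h0 => h (measure_Ioi_eq_zero_of_lintegral (le_zero_iff.1 (h0 ▸ hle')))) hD'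
  have h2 : ¬ BddBelow IX → BddAbove IX → stoppedLaws P X T = stoppedLaws P X TR ∧
      stoppedLaws P X T =
        {ν | ν ∈ lawsOn (closure IX) ∧ Integrable (fun z => z) ν ∧ x ≤ ∫ z, z ∂ν} := by
    intro hb ha
    refine key _ ?_ ?_
    · rintro _ ⟨τ, hτ, Z, hZ, rfl⟩
      exact ⟨hY.map_mem_lawsOn hZ, hY.integrable_and_le_integral hs ha hτ.1 hZ⟩
    · rintro ν ⟨hν, hi, hle⟩
      have := hν.1
      obtain ⟨hU', hD', hUD⟩ := lintegral_parts_of_integrable (x := x) hi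
      have hle' := (ENNReal.toReal_le_toReal hD' hU').1 (by linarith)
      -- The mirror image: D ≤ U, hence k = 1/U, and the deficit above x is filled by the intervals
      -- (-∞, b).
      refine hY.mem_stoppedLaws hs hU hν (c₁ := 0) (c₂ := 1 -
        (∫⁻ b in Set.Ioi x, ENNReal.ofReal (b - x) ∂ν)⁻¹ *
          ∫⁻ a in Set.Iio x, ENNReal.ofReal (x - a) ∂ν) (fun h => ?_) (fun h => ?_)
        (fun h => absurd rfl h) (fun _ => hb) (k := (∫⁻ b in Set.Ioi x, ENNReal.ofReal (b - x) ∂ν)⁻¹)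
      · rw [add_zero]
        exact hmul (fun h0 => h (measure_Iio_eq_zero_of_lintegral (le_zero_iff.1 (h0 ▸ hle')))) hU'
      · exact add_tsub_cancel_of_le ((mul_le_mul_right hle' _).trans
          (hmul (mt measure_Ioi_eq_zero_of_lintegral h) hU').le)
  have h3 : BddBelow IX → BddAbove IX → stoppedLaws P X T = stoppedLaws P X TR ∧
      stoppedLaws P X T =
        {ν | ν ∈ lawsOn (closure IX) ∧ Integrable (fun z => z) ν ∧ ∫ z, z ∂ν = x} := by
    intro hb ha
    refine key _ ?_ ?_
    · rintro _ ⟨τ, hτ, Z, hZ, rfl⟩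
      obtain ⟨hi, hle⟩ := hY.integrable_and_integral_le hs hb hτ.1 hZ
      exact ⟨hY.map_mem_lawsOn hZ, hi,
        hle.antisymm (hY.integrable_and_le_integral hs ha hτ.1 hZ).2⟩
    · rintro ν ⟨hν, hi, hle⟩
      have := hν.1
      obtain ⟨hU', hD', hUD⟩ := lintegral_parts_of_integrable (x := x) hi
      have heq := (ENNReal.toReal_eq_toReal_iff' hU' hD').1 (by linarith)
      -- Here U = D, so k = 1/D solves both equations and no infinite threshold is needed.
      refine hY.mem_stoppedLaws hs hU hν (c₁ := 0) (c₂ := 0) (fun h => ?_) (fun h => ?_)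
        (fun h => absurd rfl h) (fun h => absurd rfl h)
        (k := (∫⁻ a in Set.Iio x, ENNReal.ofReal (x - a) ∂ν)⁻¹)
      · rw [add_zero]
        exact (congrArg _ heq).trans (hmul (mt measure_Iio_eq_zero_of_lintegral h) hD')
      · rw [add_zero]
        exact hmul (fun h0 => h (measure_Ioi_eq_zero_of_lintegral (heq.trans h0))) hD'
  have h4 : ¬ BddBelow IX → ¬ BddAbove IX → stoppedLaws P X T = stoppedLaws P X TR ∧
      stoppedLaws P X T = {ν | IsProbabilityMeasure ν} := by
    intro hb ha
    refine key _ ?_ fun ν hν => ?_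
    · rintro _ ⟨τ, hτ, Z, hZ, rfl⟩
      exact Measure.isProbabilityMeasure_map hZ.1.aemeasurable
    · have hIX : IX = Set.univ :=
        (hY.1.isPreconnected.image s hs.2.1).eq_univ_of_unbounded hb ha
      refine hY.mem_stoppedLaws hs hU ⟨hν, ?_⟩ (k := 0) (c₁ := 1) (c₂ := 1) (fun _ => by simp)
        (fun _ => by simp) (fun _ => ha) (fun _ => hb)
      rw [show s '' I = Set.univ from hIX, closure_univ, Set.compl_univ, measure_empty]
  refine ⟨fun τ hτ => hY.exists_isStoppedLimit hs hτ, ?_, fun hb ha => (h1 hb ha).2,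
    fun hb ha => (h2 hb ha).2, fun hb ha => (h3 hb ha).2, fun hb ha => (h4 hb ha).2⟩
  by_cases hb : BddBelow IX
  · by_cases ha : BddAbove IX
    · exact (h3 hb ha).1
    · exact (h1 hb ha).1
  · by_cases ha : BddAbove IX
    · exact (h2 hb ha).1
    · exact (h4 hb ha).1
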